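/- Let $L,T\ge 1$ and let $G=(V,A)$ be the $L$-by-$T$ grid: the directed graph with vertices $v_{l,t}$ ($1\le l\le L$, $1\le t\le T$) and arcs $(v_{l,t},v_{l+1,t})$ for $l\le L-1$ and $(v_{l,t},v_{l,t+1})$ for $t\le T-1$. An instance of the uncapacitated minimum-concave-cost flow problem on $G$ (U-MFG) consists of supplies $b\in\mathbb Z^{V}$ with $\sum_{v}b_v=0$ and, for each arc $a$, a cost function $c_a$ that is concave on $[0,\infty)$. The problem is to minimize $\sum_{a\in A}c_a(x_a)$ over all $x\in\mathbb R^{A}$ with $x\ge 0$ and $\sum_{a\in\delta^+(v)}x_a-\sum_{a\in\delta^-(v)}x_a=b_v$ for all $v\in V$, where $\delta^+(v)$ and $\delta^-(v)$ are the sets of arcs leaving and entering $v$. A source is a vertex $v$ with $b_v>0$. The cost functions are given by an oracle that returns $c_a(x)$ in a single step, given $a$ and $x$. Then for every fixed number of rows $L$ the U-MFG with all sources in one row is polynomially solvable: there are a program $P$ and a polynomial $q$, depending only on $L$, such that for every $T$ and every such instance on the $L$-by-$T$ grid, $P$, given $L$, $T$, $b$ and the oracle, halts after at most $q(T)$ steps;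 it outputs an optimal flow, with integral values, if the instance is feasible, and reports infeasibility otherwise. Here a program is a random access program over integer and real memory in which each operation takes one step: addition, subtraction, comparison, reading or writing a memory cell, logical connectives and branching, and an oracle call (at an integral flow value). There is no multiplication, and real numbers are obtained only from the constant $0$ and from the oracle. -/

import Mathlib

namespace GridFlow

/-! ### The minimum-concave-cost flow problem on a grid -/

/-- The vertices of the `L`-by-`T` grid: (row, column), counted from `0`. -/
abbrev Vertex (L T : ℕ) : Type := Fin L × Fin T

/-- `(u, v)` is an arc of the grid: `v` is directly below `u` or directly to the right of `u`. -/
def IsArc {L T : ℕ} (u v : Vertex L T) : Prop :=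
  (v.1.val = u.1.val + 1 ∧ v.2 = u.2) ∨ (v.1 = u.1 ∧ v.2.val = u.2.val + 1)

instance {L T : ℕ} (u v : Vertex L T) : Decidable (IsArc u v) := by
  unfold IsArc; infer_instance

/-- The arc set of the grid, as a subtype of the pairs of vertices. -/
abbrev Arc (L T : ℕ) : Type := {e : Vertex L T × Vertex L T // IsArc e.1 e.2}

namespace Arc

variable {L T : ℕ}

def tail (a : Arc L T) : Vertex L T := a.1.1

def head (a : Arc L T) : Vertex L T := a.1.2

/-- `true` for a downward arc (both ends in the same column), `false` for a forward arc. -/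
def isDown (a : Arc L T) : Bool := decide (a.tail.2 = a.head.2)

end Arc

/-- An instance of the problem on the `L`-by-`T` grid: integral supplies with sum zero, capacities
in `{0, 1, 2, …} ∪ {∞}`, and a cost function for each arc, concave on the nonnegative reals. -/
structure MFG (L T : ℕ) where
  supply : Vertex L T → ℤ
  capacity : Arc L T → ℕ∞
  cost : Arc L T → ℝ → ℝ
  sum_supply : ∑ v, supply v = 0
  concave_cost : ∀ a, ConcaveOn ℝ (Set.Ici 0) (cost a)

namespace MFG

variable {L T : ℕ}

/-- Feasible flows: flow balance at each vertex, nonnegativity, and the capacity bounds. -/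
def IsFeasible (I : MFG L T) (x : Arc L T → ℝ) : Prop :=
  (∀ v : Vertex L T,
    (∑ a : Arc L T with a.tail = v, x a) - (∑ a : Arc L T with a.head = v, x a) = I.supply v) ∧
  (∀ a, 0 ≤ x a) ∧
  (∀ a, ∀ u : ℕ, I.capacity a = u → x a ≤ u)

noncomputable def totalCost (I : MFG L T) (x : Arc L T → ℝ) : ℝ := ∑ a, I.cost a (x a)

/-- `x` is an optimal flow: feasible, and of least cost among all (real) feasible flows. -/
def IsOptimal (I : MFG L T) (x : Arc L T → ℝ) : Prop :=
  I.IsFeasible x ∧ ∀ y, I.IsFeasible y → I.totalCost x ≤ I.totalCost y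

/-- The uncapacitated problem (U-MFG). -/
def IsUncapacitated (I : MFG L T) : Prop := ∀ a, I.capacity a = ⊤

/-- All sources, i.e. vertices with positive supply, are in one row. -/
def SourcesInOneRow (I : MFG L T) : Prop := ∃ l : Fin L, ∀ v, 0 < I.supply v → v.1 = l

end MFG

/-! ### Oracle programs and their running time

Imperative programs over two kinds of memory, integers and reals. Each memory consists of
two-dimensional arrays, which are named by natural numbers and indexed by pairs of integers.
The arithmetic is addition and subtraction only, so that `n` steps lengthen the binary
representation of the integers by at most `O(n)` bits. Real numbers arise only from the
constant `0` and from the oracle, and can only be added, subtracted, compared and stored. -/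

/-- A cost oracle: direction (`true` for downward), row and column of the tail of an arc, and the
flow value on the arc. -/
abbrev Oracle : Type := Bool → ℤ → ℤ → ℤ → ℝ

/-- A memory state: the integer arrays and the real arrays. -/
structure Store where
  ints : ℕ → ℤ → ℤ → ℤ
  reals : ℕ → ℤ → ℤ → ℝ

/-- The array family `m` with entry `(i, j)` of array `r` replaced by `w`. -/
def writeCell {β : Type} (m : ℕ → ℤ → ℤ → β) (r : ℕ) (i j : ℤ) (w : β) : ℕ → ℤ → ℤ → β :=
  fun r' i' j' => if r' = r ∧ i' = i ∧ j' = j then w else m r' i' j'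

/-- Integer expressions. -/
inductive IExpr where
  | const (z : ℤ)
  | cell (r : ℕ) (i j : IExpr)
  | add (e₁ e₂ : IExpr)
  | sub (e₁ e₂ : IExpr)

namespace IExpr

def eval (s : Store) : IExpr → ℤ
  | const z => z
  | cell r i j => s.ints r (eval s i) (eval s j)
  | add e₁ e₂ => eval s e₁ + eval s e₂
  | sub e₁ e₂ => eval s e₁ - eval s e₂

/-- The number of steps of an evaluation: one for each operation. -/
def steps : IExpr → ℕ
  | const _ => 1
  | cell _ i j => steps i + steps j + 1
  | add e₁ e₂ => steps e₁ + steps e₂ + 1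
  | sub e₁ e₂ => steps e₁ + steps e₂ + 1

end IExpr

/-- Real expressions; `query d l t x` asks the oracle for the cost of the flow value `x` on
the arc with direction `d` and tail in row `l` and column `t`. -/
inductive RExpr where
  | zero
  | cell (r : ℕ) (i j : IExpr)
  | query (d : Bool) (l t x : IExpr)
  | add (e₁ e₂ : RExpr)
  | sub (e₁ e₂ : RExpr)

namespace RExpr

noncomputable def eval (O : Oracle) (s : Store) : RExpr → ℝ
  | zero => 0
  | cell r i j => s.reals r (i.eval s) (j.eval s)
  | query d l t x => O d (l.eval s) (t.eval s) (x.eval s)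
  | add e₁ e₂ => eval O s e₁ + eval O s e₂
  | sub e₁ e₂ => eval O s e₁ - eval O s e₂

/-- The number of steps of an evaluation: one for each operation and each oracle call. -/
def steps : RExpr → ℕ
  | zero => 1
  | cell _ i j => i.steps + j.steps + 1
  | query _ l t x => l.steps + t.steps + x.steps + 1
  | add e₁ e₂ => steps e₁ + steps e₂ + 1
  | sub e₁ e₂ => steps e₁ + steps e₂ + 1

end RExpr

/-- Tests: comparisons of integers or of reals, and their Boolean combinations. -/
inductive Test where
  | ile (e₁ e₂ : IExpr)
  | rle (e₁ e₂ : RExpr)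
  | neg (b : Test)
  | conj (b₁ b₂ : Test)

namespace Test

def Holds (O : Oracle) (s : Store) : Test → Prop
  | ile e₁ e₂ => e₁.eval s ≤ e₂.eval s
  | rle e₁ e₂ => e₁.eval O s ≤ e₂.eval O s
  | neg b => ¬ Holds O s b
  | conj b₁ b₂ => Holds O s b₁ ∧ Holds O s b₂

def steps : Test → ℕ
  | ile e₁ e₂ => e₁.steps + e₂.steps + 1
  | rle e₁ e₂ => e₁.steps + e₂.steps + 1
  | neg b => steps b + 1
  | conj b₁ b₂ => steps b₁ + steps b₂ + 1

end Test

/-- Programs. -/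
inductive Prog where
  | skip
  | iset (r : ℕ) (i j : IExpr) (e : IExpr)
  | rset (r : ℕ) (i j : IExpr) (e : RExpr)
  | seq (p q : Prog)
  | cond (b : Test) (p q : Prog)
  | loop (b : Test) (p : Prog)

/-- `Exec O p s n s'`: with oracle `O`, the program `p` started in the memory state `s` halts
after exactly `n` steps in the memory state `s'`. -/
inductive Exec (O : Oracle) : Prog → Store → ℕ → Store → Prop
  | skip (s : Store) : Exec O Prog.skip s 1 s
  | iset (r : ℕ) (i j e : IExpr) (s : Store) :
      Exec O (Prog.iset r i j e) s (i.steps + j.steps + e.steps + 1)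
        { s with ints := writeCell s.ints r (i.eval s) (j.eval s) (e.eval s) }
  | rset (r : ℕ) (i j : IExpr) (e : RExpr) (s : Store) :
      Exec O (Prog.rset r i j e) s (i.steps + j.steps + e.steps + 1)
        { s with reals := writeCell s.reals r (i.eval s) (j.eval s) (e.eval O s) }
  | seq {p q : Prog} {s₁ s₂ s₃ : Store} {m n : ℕ} (hp : Exec O p s₁ m s₂)
      (hq : Exec O q s₂ n s₃) : Exec O (Prog.seq p q) s₁ (m + n) s₃
  | cond_true {b : Test} {p q : Prog} {s s' : Store} {n : ℕ} (hb : b.Holds O s)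
      (hp : Exec O p s n s') : Exec O (Prog.cond b p q) s (b.steps + n + 1) s'
  | cond_false {b : Test} {p q : Prog} {s s' : Store} {n : ℕ} (hb : ¬ b.Holds O s)
      (hq : Exec O q s n s') : Exec O (Prog.cond b p q) s (b.steps + n + 1) s'
  | loop_true {b : Test} {p : Prog} {s₁ s₂ s₃ : Store} {m n : ℕ} (hb : b.Holds O s₁)
      (hp : Exec O p s₁ m s₂) (hl : Exec O (Prog.loop b p) s₂ n s₃) :
      Exec O (Prog.loop b p) s₁ (b.steps + m + n + 1) s₃
  | loop_false {b : Test} {p : Prog} {s : Store} (hb : ¬ b.Holds O s) :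
      Exec O (Prog.loop b p) s (b.steps + 1) s

/-- Programs are deterministic: the final state and the number of steps are unique. -/
theorem Exec.unique {O : Oracle} {p : Prog} {s s₁ s₂ : Store} {m n : ℕ}
    (h₁ : Exec O p s m s₁) (h₂ : Exec O p s n s₂) : m = n ∧ s₁ = s₂ := by
  induction h₁ generalizing n s₂ with
  | skip s => cases h₂; exact ⟨rfl, rfl⟩
  | iset => cases h₂; exact ⟨rfl, rfl⟩
  | rset => cases h₂; exact ⟨rfl, rfl⟩
  | seq _ _ ihp ihq =>
    cases h₂ with
    | seq hp hq =>
      obtain ⟨rfl, rfl⟩ := ihp hp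
      obtain ⟨rfl, rfl⟩ := ihq hq
      exact ⟨rfl, rfl⟩
  | cond_true hb _ ih =>
    cases h₂ with
    | cond_true _ hp => obtain ⟨rfl, rfl⟩ := ih hp; exact ⟨rfl, rfl⟩
    | cond_false hb' _ => exact absurd hb hb'
  | cond_false hb _ ih =>
    cases h₂ with
    | cond_true hb' _ => exact absurd hb' hb
    | cond_false _ hp => obtain ⟨rfl, rfl⟩ := ih hp; exact ⟨rfl, rfl⟩
  | loop_true hb _ _ ihp ihl =>
    cases h₂ with
    | loop_true _ hp hl =>
      obtain ⟨rfl, rfl⟩ := ihp hp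
      obtain ⟨rfl, rfl⟩ := ihl hl
      exact ⟨rfl, rfl⟩
    | loop_false hb' => exact absurd hb hb'
  | loop_false hb =>
    cases h₂ with
    | loop_true hb' _ _ => exact absurd hb' hb
    | loop_false _ => exact ⟨rfl, rfl⟩

/-! ### Input, output, and polynomial solvability -/

section Encoding

variable {L T : ℕ}

/-- The integer coordinates of a vertex. -/
def vertexKey (v : Vertex L T) : ℤ × ℤ := ((v.1.val : ℤ), (v.2.val : ℤ))

/-- The index of an arc: its direction and the integer coordinates of its tail. -/
def arcKey (a : Arc L T) : Bool × ℤ × ℤ := (a.isDown, vertexKey a.tail)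

theorem vertexKey_injective : Function.Injective (vertexKey (L := L) (T := T)) := by
  rintro ⟨l, t⟩ ⟨l', t'⟩ h
  simp only [vertexKey, Prod.mk.injEq, Nat.cast_inj] at h
  exact Prod.ext (Fin.ext h.1) (Fin.ext h.2)

theorem arcKey_injective : Function.Injective (arcKey (L := L) (T := T)) := by
  rintro ⟨⟨u, v⟩, h⟩ ⟨⟨u', v'⟩, h'⟩ e
  obtain ⟨e₁, e₂⟩ := Prod.mk.inj e
  obtain rfl : u = u' := vertexKey_injective e₂
  have e₃ : (u.2 = v.2) ↔ (u.2 = v'.2) := decide_eq_decide.mp e₁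
  obtain rfl : v = v' := by
    rw [Fin.ext_iff, Fin.ext_iff] at e₃
    simp only [IsArc, Fin.ext_iff] at h h'
    refine Prod.ext (Fin.ext ?_) (Fin.ext ?_) <;> omega
  rfl

/-- The oracle of an instance: it returns the cost of the given (integral) flow value on the arc
with the given index, and `0` if there is no such arc. -/
noncomputable def MFG.oracle (I : MFG L T) : Oracle :=
  fun d l t x => Function.extend arcKey (fun a => I.cost a x) 0 (d, l, t)

/-- An arc capacity as an integer, with `-1` for infinity. -/
def capacityCode (u : ℕ∞) : ℤ := if u = ⊤ then -1 else (u.toNat : ℤ)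

/-- The initial memory state. Integer array `0` holds `L` at `(0, 0)` and `T` at `(0, 1)`,
integer array `1` holds the supplies, integer arrays `2` and `3` hold the capacities of the
downward and the forward arcs (at the coordinates of the tail). All else is `0`. -/
noncomputable def MFG.input (I : MFG L T) : Store where
  ints := fun r i j =>
    match r with
    | 0 => if i = 0 ∧ j = 0 then (L : ℤ) else if i = 0 ∧ j = 1 then (T : ℤ) else 0
    | 1 => Function.extend vertexKey I.supply 0 (i, j)
    | 2 => Function.extend arcKey (fun a => capacityCode (I.capacity a)) 0 (true, i, j)
    | 3 => Function.extend arcKey (fun a => capacityCode (I.capacity a)) 0 (false, i, j)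
    | _ => 0
  reals := fun _ _ _ => 0

/-- The flow in a memory state: integer arrays `5` and `6` hold the flow values on the
downward and the forward arcs (at the coordinates of the tail). -/
def outputFlow (s : Store) (a : Arc L T) : ℝ :=
  (s.ints (if a.isDown then 5 else 6) (a.tail.1.val : ℤ) (a.tail.2.val : ℤ) : ℝ)

/-- The memory state `s` solves the instance: if the instance is feasible, the flag (integer
array `4` at `(0, 0)`) is `1` and the output flow is optimal; otherwise the flag is `0`. -/
def MFG.SolvedBy (I : MFG L T) (s : Store) : Prop :=
  ((∃ x, I.IsFeasible x) → s.ints 4 0 0 = 1 ∧ I.IsOptimal (outputFlow s)) ∧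
  ((¬ ∃ x, I.IsFeasible x) → s.ints 4 0 0 = 0)

end Encoding

/-- The class `C` of instances on grids with `L` rows is polynomially solvable: one program solves
each instance of `C`, within a number of steps bounded by a polynomial in the number of columns. -/
def PolynomiallySolvable (L : ℕ) (C : ∀ T : ℕ, MFG L T → Prop) : Prop :=
  ∃ (p : Prog) (q : Polynomial ℕ), ∀ (T : ℕ) (I : MFG L T), C T I →
    ∃ (n : ℕ) (s : Store), Exec I.oracle p I.input n s ∧ n ≤ q.eval T ∧ I.SolvedBy s

end GridFlow

/-! Two facts carry the theorem: some optimal flow takes its values in a set of polynomial size that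
can be listed from the supplies alone, and a dynamic program over the columns finds the best flow
with values in that set.

Forests. If the support of a feasible flow carries a nonzero circulation `z`, the flow can be pushed
along `z` and along `-z` until an arc becomes empty; by concavity one of the two results costs no
more. Hence each feasible flow is dominated by one whose support is a forest
(`MFG.IsFeasible.exists_forest`). On a forest, the flow on an arc `e = (u, w)` is the total supply
of any vertex set that contains `u` but not `w` and is crossed by no other arc of the support.

Planarity. Let all sources be in row `r`. Each vertex touched by the flow is reached from row `r`,
so after deletion of `e` it is reached from row `r` or from `w`. Components of the remaining planar
digraph do not cross in row `r` (`IsGridStep.noncrossing`), so some interval `K` of row `r` is a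
union of traces of components and separates those of `u` and `w`. Label a vertex reached from row
`r` by the leftmost vertex of row `r` that reaches it. Labels are monotone along each row, so the
vertices with label in `K` form an interval of each row, up to irrelevant vertices; so do the
vertices reached from `w` only. This yields a separating set which in each row is `I \ J`, or in
each row the complement of `I ∪ J`, for intervals `I` and `J` (`IsGridStep.exists_separating_set`).
Since the supplies sum to zero, the flow on `e` is, row by row, an alternating sum of six prefix
sums of supplies (`MFG.IsFeasible.exists_flowValue`). There are at most `(T + 1) ^ (6 * L)` such
values, and all are integers.

Dynamic program. A column is a path, so the flows entering and leaving it determine the flows down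
in it. The states are therefore the vectors of `L` candidate values. They are generated by `6 * L ^
2` rounds, each of which adds a signed prefix sum to one entry and multiplies the length of the list
by `T + 2`; this is polynomial in `T` for fixed `L`. The table of least completion costs is a lower
bound for all feasible flows (`table_le`) and is attained by following the recorded choices
(`bestPath_spec`). -/

namespace GridFlow

open Relation

/-- Each step of `E` leads one row down or one column to the right. -/
def IsGridStep (E : ℕ × ℕ → ℕ × ℕ → Prop) : Prop :=
  ∀ u v, E u v → v = (u.1 + 1, u.2) ∨ v = (u.1, u.2 + 1)

/-! ### Planarity: components of a grid digraph do not cross in the top row. -/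

section Planar

variable {E : ℕ × ℕ → ℕ × ℕ → Prop}

theorem IsGridStep.le_of_reach (hE : IsGridStep E) {u v : ℕ × ℕ} (h : ReflTransGen E u v) :
    u.1 ≤ v.1 ∧ u.2 ≤ v.2 := by
  induction h with
  | refl => simp
  | tail _ hbc ih =>
    rcases hE _ _ hbc with h | h <;> rw [h] <;> constructor <;> simp <;> omega

/-- Two monotone lattice paths between the same two rows which start and end in opposite orders
have a common vertex. -/
theorem IsGridStep.exists_common (hE : IsGridStep E) {i p q : ℕ} (hqp : q ≤ p) (n : ℕ) :
    ∀ j x y, ReflTransGen E (j, x) (i, p) → ReflTransGen E (j, y) (i, q) → x ≤ y →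
      (i - j) + (i - j) + (p - x) + (q - y) ≤ n →
      ∃ m, ReflTransGen E (j, x) m ∧ ReflTransGen E m (i, p) ∧
        ReflTransGen E (j, y) m ∧ ReflTransGen E m (i, q) := by
  induction n with
  | zero =>
    intro j x y h₁ h₂ hxy hn
    have a₁ := hE.le_of_reach h₁
    have a₂ := hE.le_of_reach h₂
    simp only at a₁ a₂
    obtain rfl : x = y := by omega
    exact ⟨_, .refl, h₁, .refl, h₂⟩
  | succ n ih =>
    intro j x y h₁ h₂ hxy hn
    have a₁ := hE.le_of_reach h₁
    have a₂ := hE.le_of_reach h₂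
    simp only at a₁ a₂
    rcases eq_or_lt_of_le hxy with rfl | hlt
    · exact ⟨_, .refl, h₁, .refl, h₂⟩
    rcases h₁.cases_head with he | ⟨u, hu, h₁'⟩
    · simp only [Prod.mk.injEq] at he
      omega
    have b₁ := hE.le_of_reach h₁'
    -- Steps to the right are made first, by one path at a time, and downward steps by both paths
    -- together. So the two current vertices stay in one row and in the order `x ≤ y` until they
    -- coincide.
    rcases hE _ _ hu with rfl | rfl
    · simp only at b₁ h₁'
      rcases h₂.cases_head with he | ⟨w, hw, h₂'⟩
      · simp only [Prod.mk.injEq] at he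
        omega
      have b₂ := hE.le_of_reach h₂'
      rcases hE _ _ hw with rfl | rfl
      · simp only at b₂ h₂'
        obtain ⟨m, m₁, m₂, m₃, m₄⟩ := ih _ _ _ h₁' h₂' hxy (by omega)
        exact ⟨m, m₁.head hu, m₂, m₃.head hw, m₄⟩
      · simp only at b₂ h₂'
        obtain ⟨m, m₁, m₂, m₃, m₄⟩ := ih _ _ _ h₁ h₂' (by omega) (by omega)
        exact ⟨m, m₁, m₂, m₃.head hw, m₄⟩
    · simp only at b₁ h₁'
      obtain ⟨m, m₁, m₂, m₃, m₄⟩ := ih _ _ _ h₁' h₂ (by omega) (by omega)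
      exact ⟨m, m₁.head hu, m₂, m₃, m₄⟩

theorem IsGridStep.down_split (hE : IsGridStep E) {u v : ℕ × ℕ} (h : ReflTransGen E u v) {k : ℕ}
    (hk : u.1 ≤ k) (hk' : k < v.1) :
    ∃ y, ReflTransGen E u (k, y) ∧ E (k, y) (k + 1, y) ∧ ReflTransGen E (k + 1, y) v := by
  induction h using ReflTransGen.head_induction_on with
  | refl => omega
  | head hbc hcv ih =>
    rename_i b c
    by_cases hc : c.1 ≤ k
    · obtain ⟨y, h₁, h₂⟩ := ih hc
      exact ⟨y, h₁.head hbc, h₂⟩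
    · rcases hE _ _ hbc with rfl | rfl
      · obtain rfl : b.1 = k := by simp only at hc; omega
        exact ⟨b.2, .refl, hbc, hcv⟩
      · exact absurd hk hc

theorem IsGridStep.row_split (hE : IsGridStep E) {u v : ℕ × ℕ} (h : ReflTransGen E u v) {k : ℕ}
    (hk : u.1 ≤ k) (hk' : k ≤ v.1) :
    ∃ y, ReflTransGen E u (k, y) ∧ ReflTransGen E (k, y) v := by
  rcases eq_or_lt_of_le hk' with rfl | hlt
  · exact ⟨v.2, h, .refl⟩
  · obtain ⟨y, h₁, h₂, h₃⟩ := hE.down_split h hk hlt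
    exact ⟨y, h₁, h₃.head h₂⟩

theorem IsGridStep.col_split (hE : IsGridStep E) {j x y z : ℕ}
    (h : ReflTransGen E (j, x) (j, z)) (hxy : x ≤ y) (hyz : y ≤ z) :
    ReflTransGen E (j, x) (j, y) ∧ ReflTransGen E (j, y) (j, z) := by
  obtain ⟨n, hn⟩ := Nat.exists_eq_add_of_le hxy
  clear hxy
  induction n generalizing x with
  | zero => obtain rfl : y = x := by omega
            exact ⟨.refl, h⟩
  | succ n ih =>
    rcases h.cases_head with he | ⟨u, hu, h'⟩
    · simp only [Prod.mk.injEq, true_and] at he; omega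
    · have := hE.le_of_reach h'
      rcases hE _ _ hu with rfl | rfl
      · simp only at this; omega
      · obtain ⟨h₁, h₂⟩ := ih h' (by omega)
        exact ⟨h₁.head hu, h₂⟩

/-- The vertex `v` is on a path from `s` to `m`. -/
def OnPath (E : ℕ × ℕ → ℕ × ℕ → Prop) (s m v : ℕ × ℕ) : Prop :=
  ReflTransGen E s v ∧ ReflTransGen E v m

/-- All vertices of the row of `v` on paths from `s` to `m` are to the left of `v`. -/
def RightOf (E : ℕ × ℕ → ℕ × ℕ → Prop) (s m v : ℕ × ℕ) : Prop :=
  ∀ z, OnPath E s m (v.1, z) → z < v.2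

/-- All vertices of the row of `v` on paths from `s` to `m` are to the right of `v`. -/
def LeftOf (E : ℕ × ℕ → ℕ × ℕ → Prop) (s m v : ℕ × ℕ) : Prop :=
  ∀ z, OnPath E s m (v.1, z) → v.2 < z

theorem IsGridStep.rightOf_right (s m : ℕ × ℕ) {j y : ℕ}
    (hv : ¬ OnPath E s m (j, y)) :
    RightOf E s m (j, y) ↔ RightOf E s m (j, y + 1) := by
  constructor
  · intro h z hz
    have := h z hz
    simp only at this ⊢; omega
  · intro h z hz
    have := h z hz
    simp only at this hz ⊢
    rcases Nat.lt_succ_iff_lt_or_eq.mp this with h | rfl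
    · exact h
    · exact absurd hz hv

theorem IsGridStep.leftOf_right (s m : ℕ × ℕ) {j y : ℕ}
    (hv : ¬ OnPath E s m (j, y + 1)) :
    LeftOf E s m (j, y) ↔ LeftOf E s m (j, y + 1) := by
  constructor
  · intro h z hz
    have := h z hz
    simp only at this hz ⊢
    rcases Nat.lt_or_eq_of_le (Nat.succ_le_of_lt this) with h | h
    · exact h
    · subst h; exact absurd hz hv
  · intro h z hz
    have := h z hz
    simp only at this hz ⊢; omega

/-- A path that enters row `j + 1` to the left of column `y` and reaches column `y` or beyond in
that row would contain `(j + 1, y)`. Conversely, a path leaves row `j` at or to the right of each of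
its vertices there. The bounds on `j` ensure that the paths pass from row `j` to row `j + 1`. -/
theorem IsGridStep.rightOf_down (hE : IsGridStep E) {s m : ℕ × ℕ} {j y : ℕ}
    (hv' : ¬ OnPath E s m (j + 1, y)) (hs : s.1 ≤ j) (hm : j + 1 ≤ m.1) :
    RightOf E s m (j, y) ↔ RightOf E s m (j + 1, y) := by
  constructor
  · rintro h z ⟨hz₁, hz₂⟩
    obtain ⟨x, h₁, h₂, h₃⟩ := hE.down_split hz₁ hs (Nat.lt_succ_self j)
    have hx : x < y := h x ⟨h₁, (h₃.trans hz₂).head h₂⟩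
    by_contra hzy
    obtain ⟨h₄, h₅⟩ := hE.col_split h₃ hx.le (not_lt.mp hzy)
    exact hv' ⟨(h₁.tail h₂).trans h₄, h₅.trans hz₂⟩
  · rintro h z ⟨hz₁, hz₂⟩
    obtain ⟨x, h₁, h₂, h₃⟩ := hE.down_split hz₂ le_rfl hm
    have hx : x < y := h x ⟨(hz₁.trans h₁).tail h₂, h₃⟩
    have := (hE.le_of_reach h₁).2
    simp only at this ⊢; omega

theorem IsGridStep.leftOf_down (hE : IsGridStep E) {s m : ℕ × ℕ} {j y : ℕ}
    (hv : ¬ OnPath E s m (j, y)) (hs : s.1 ≤ j) (hm : j + 1 ≤ m.1) :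
    LeftOf E s m (j, y) ↔ LeftOf E s m (j + 1, y) := by
  constructor
  · rintro h z ⟨hz₁, hz₂⟩
    obtain ⟨x, h₁, h₂, h₃⟩ := hE.down_split hz₁ hs (Nat.lt_succ_self j)
    have hx : y < x := h x ⟨h₁, (h₃.trans hz₂).head h₂⟩
    have := (hE.le_of_reach h₃).2
    simp only at this ⊢; omega
  · rintro h z ⟨hz₁, hz₂⟩
    obtain ⟨x, h₁, h₂, h₃⟩ := hE.down_split hz₂ le_rfl hm
    have hx : y < x := h x ⟨(hz₁.trans h₁).tail h₂, h₃⟩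
    by_contra hzy
    obtain ⟨h₄, h₅⟩ := hE.col_split h₁ (not_lt.mp hzy) hx.le
    exact hv ⟨hz₁.trans h₄, (h₅.tail h₂).trans h₃⟩

/-- The vertex `v` is in the region enclosed by row `r` and paths from `(r, c)` and `(r, d)`
to `m`. -/
def Inside (E : ℕ × ℕ → ℕ × ℕ → Prop) (r c d : ℕ) (m v : ℕ × ℕ) : Prop :=
  v.1 ≤ m.1 ∧ RightOf E (r, c) m v ∧ LeftOf E (r, d) m v

/-- A discrete Jordan curve argument: an arc that avoids the paths to `m` does not cross the
boundary of the region. -/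
theorem IsGridStep.inside_iff (hE : IsGridStep E) {r c d : ℕ} {m v v' : ℕ × ℕ}
    (hr : ∀ u v, E u v → r ≤ u.1) (hc : ReflTransGen E (r, c) m) (hd : ReflTransGen E (r, d) m)
    (hvv : E v v') (hv : ¬ ReflTransGen E v m) (hv' : ¬ ReflTransGen E v' m) :
    Inside E r c d m v ↔ Inside E r c d m v' := by
  have hr' := hr _ _ hvv
  have n₁ : ∀ s, ¬ OnPath E s m v := fun s h => hv h.2
  have n₂ : ∀ s, ¬ OnPath E s m v' := fun s h => hv' h.2
  obtain ⟨j, y⟩ := v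
  rcases hE _ _ hvv with rfl | rfl
  · simp only [Inside]
    -- The region has no vertex in the row of `m`, because `m` lies on both families of paths. So no
    -- arc can leave the region at the bottom.
    have hlast : j = m.1 → RightOf E (r, c) m (j, y) → LeftOf E (r, d) m (j, y) → False := by
      rintro rfl h₁ h₂
      have a := h₁ m.2 ⟨hc, .refl⟩
      have b := h₂ m.2 ⟨hd, .refl⟩
      exact lt_asymm a b
    constructor
    · rintro ⟨h₁, h₂, h₃⟩
      have hm : j + 1 ≤ m.1 := by
        rcases Nat.lt_or_eq_of_le h₁ with h | h
        · exact h
        · exact (hlast h h₂ h₃).elim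
      exact ⟨hm, (hE.rightOf_down (n₂ _) hr' hm).mp h₂, (hE.leftOf_down (n₁ _) hr' hm).mp h₃⟩
    · rintro ⟨hm, h₂, h₃⟩
      exact ⟨(Nat.le_succ j).trans hm, (hE.rightOf_down (n₂ _) hr' hm).mpr h₂,
        (hE.leftOf_down (n₁ _) hr' hm).mpr h₃⟩
  · simp only [Inside]
    rw [IsGridStep.rightOf_right _ _ (n₁ _), IsGridStep.leftOf_right _ _ (n₂ _)]

/-- In row `r`, a path from `(r, c)` that gets past column `x` contains `(r, x)`, which does not
reach `m`; and paths from `(r, d)` never go to the left of `d`. -/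
theorem IsGridStep.inside_top (hE : IsGridStep E) {r c d x : ℕ} {m : ℕ × ℕ}
    (hc : ReflTransGen E (r, c) m) (hd : ReflTransGen E (r, d) m)
    (hx : ¬ ReflTransGen E (r, x) m) :
    Inside E r c d m (r, x) ↔ c < x ∧ x < d := by
  constructor
  · rintro ⟨-, h₁, h₂⟩
    exact ⟨h₁ c ⟨.refl, hc⟩, h₂ d ⟨.refl, hd⟩⟩
  · rintro ⟨h₁, h₂⟩
    refine ⟨(hE.le_of_reach hc).1, ?_, ?_⟩
    · rintro z ⟨hz₁, hz₂⟩
      by_contra hzx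
      exact hx ((hE.col_split hz₁ h₁.le (not_lt.mp hzx)).2.trans hz₂)
    · rintro z ⟨hz₁, hz₂⟩
      exact lt_of_lt_of_le h₂ (hE.le_of_reach hz₁).2

theorem eqvGen_of_reach {u v : ℕ × ℕ} (h : ReflTransGen E u v) : EqvGen E u v := by
  induction h with
  | refl => exact .refl _
  | tail _ hbc ih => exact ih.trans _ _ _ (.rel _ _ hbc)

theorem IsGridStep.inside_iff_of_eqvGen (hE : IsGridStep E) {r c d : ℕ} {m v v' : ℕ × ℕ}
    (hr : ∀ u v, E u v → r ≤ u.1) (hc : ReflTransGen E (r, c) m) (hd : ReflTransGen E (r, d) m)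
    (hvv : EqvGen E v v') (hv : ¬ EqvGen E v m) :
    Inside E r c d m v ↔ Inside E r c d m v' := by
  induction hvv with
  | rel u v h =>
    exact hE.inside_iff hr hc hd h (fun h' => hv (eqvGen_of_reach h'))
      (fun h' => hv ((EqvGen.rel _ _ h).trans _ _ _ (eqvGen_of_reach h')))
  | refl => rfl
  | symm u v h ih => exact (ih fun h' => hv ((h.symm _ _).trans _ _ _ h')).symm
  | trans u v w h₁ _ ih₁ ih₂ =>
    exact (ih₁ hv).trans (ih₂ fun h' => hv (h₁.trans _ _ _ h'))

/-- The components of a planar digraph whose vertices are all reached from row `r` do not cross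
other components in row `r`. -/
theorem IsGridStep.noncrossing (hE : IsGridStep E) {r : ℕ} (hr : ∀ u v, E u v → r ≤ u.1)
    {v v' : ℕ × ℕ} (hvv : EqvGen E v v')
    (htop : ∀ x, EqvGen E v x → ∃ c, ReflTransGen E (r, c) x)
    {p q : ℕ} (hpq : EqvGen E (r, p) (r, q)) (hvp : ¬ EqvGen E v (r, p)) {c d : ℕ}
    (hc : ReflTransGen E (r, c) v) (hd : ReflTransGen E (r, d) v') :
    (c < p ↔ c < q) ↔ (d < p ↔ d < q) := by
  -- If `c` and `d` reach the same vertex `x`, they enclose a region. The component of `p` and `q`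
  -- avoids that of `x`, so it is entirely inside or entirely outside.
  have key : ∀ x, ¬ EqvGen E x (r, p) → ∀ c d, c < d → ReflTransGen E (r, c) x →
      ReflTransGen E (r, d) x → ((c < p ↔ c < q) ↔ (d < p ↔ d < q)) := by
    intro x hx c d hcd hc hd
    have hp : ¬ EqvGen E (r, p) x := fun h => hx (h.symm _ _)
    have hq : ¬ EqvGen E (r, q) x := fun h => hp (hpq.trans _ _ _ h)
    have h := hE.inside_iff_of_eqvGen hr hc hd hpq hp
    rw [hE.inside_top hc hd fun h => hp (eqvGen_of_reach h),
      hE.inside_top hc hd fun h => hq (eqvGen_of_reach h)] at h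
    have e₁ : d ≠ p := by rintro rfl; exact hp (eqvGen_of_reach hd)
    have e₂ : d ≠ q := by rintro rfl; exact hq (eqvGen_of_reach hd)
    omega
  have key' : ∀ x, ¬ EqvGen E x (r, p) → ∀ c d, ReflTransGen E (r, c) x →
      ReflTransGen E (r, d) x → ((c < p ↔ c < q) ↔ (d < p ↔ d < q)) := by
    intro x hx c d hc hd
    rcases lt_trichotomy c d with h | rfl | h
    · exact key x hx c d h hc hd
    · rfl
    · exact (key x hx d c h hd hc).symm
  induction hvv generalizing c d with
  | rel u v h =>
    exact key' v (fun h' => hvp ((EqvGen.rel _ _ h).trans _ _ _ h')) c d (hc.tail h) hd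
  | refl u => exact key' u hvp c d hc hd
  | symm u v h ih =>
    exact (ih (fun x hx => htop x ((h.symm _ _).trans _ _ _ hx))
      (fun h' => hvp ((h.symm _ _).trans _ _ _ h')) hd hc).symm
  | trans u v w h₁ _ ih₁ ih₂ =>
    -- An undirected walk is traversed vertex by vertex; each intermediate vertex needs a top of its
    -- own, which is why the whole component has to be reached from row `r`.
    obtain ⟨e, he⟩ := htop v h₁
    exact (ih₁ htop hvp hc he).trans (ih₂ (fun x hx => htop x (h₁.trans _ _ _ hx))
      (fun h' => hvp (h₁.trans _ _ _ h')) he hd)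

end Planar

/-! ### Labels by the leftmost top, and separating sets that are simple in each row. -/

section Potential

variable {E : ℕ × ℕ → ℕ × ℕ → Prop}

/-- The vertex `v` is reached from row `r`. -/
def Topped (E : ℕ × ℕ → ℕ × ℕ → Prop) (r : ℕ) (v : ℕ × ℕ) : Prop :=
  ∃ c, ReflTransGen E (r, c) v

/-- The leftmost vertex of row `r` from which `v` is reached. -/
noncomputable def leftmostTop (E : ℕ × ℕ → ℕ × ℕ → Prop) (r : ℕ) (v : ℕ × ℕ) : ℕ :=
  sInf {c | ReflTransGen E (r, c) v}

theorem Topped.reach_leftmostTop {r : ℕ} {v : ℕ × ℕ} (h : Topped E r v) :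
    ReflTransGen E (r, leftmostTop E r v) v := Nat.sInf_mem (s := {c | ReflTransGen E (r, c) v}) h

theorem leftmostTop_le {r c : ℕ} {v : ℕ × ℕ} (h : ReflTransGen E (r, c) v) :
    leftmostTop E r v ≤ c := Nat.sInf_le (s := {c | ReflTransGen E (r, c) v}) h

/-- If the labels were in the wrong order, the two paths would meet, and the smaller label would
also reach the left vertex. -/
theorem IsGridStep.leftmostTop_mono (hE : IsGridStep E) {r i p q : ℕ} (hp : Topped E r (i, p))
    (hq : Topped E r (i, q)) (hpq : p ≤ q) : leftmostTop E r (i, p) ≤ leftmostTop E r (i, q) := by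
  by_contra h
  obtain ⟨m, h₁, -, -, h₄⟩ := hE.exists_common hpq _ r _ _ hq.reach_leftmostTop
    hp.reach_leftmostTop (not_le.mp h).le le_rfl
  exact h (leftmostTop_le (h₁.trans h₄))

/-- A path from row `r` to `(i, p)` passes through the row of `w`, on one side of `w` or at `w`
itself. It must then meet the path from `w` to `(i, p₁)` or to `(i, p₂)`, so that this vertex would
be reached from row `r` too. -/
theorem IsGridStep.not_topped_of_between (hE : IsGridStep E) {r i p p₁ p₂ : ℕ} {w : ℕ × ℕ}
    (hw : r ≤ w.1) (h₁ : ReflTransGen E w (i, p₁)) (h₂ : ReflTransGen E w (i, p₂))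
    (n₁ : ¬ Topped E r (i, p₁)) (n₂ : ¬ Topped E r (i, p₂)) (l₁ : p₁ ≤ p) (l₂ : p ≤ p₂) :
    ¬ Topped E r (i, p) := by
  rintro ⟨c, hc⟩
  obtain ⟨y, hy₁, hy₂⟩ := hE.row_split hc hw (hE.le_of_reach h₁).1
  rcases le_total w.2 y with h | h
  · obtain ⟨m, -, m₂, m₃, -⟩ := hE.exists_common l₂ _ w.1 _ _ h₂ hy₂ h le_rfl
    exact n₂ ⟨c, (hy₁.trans m₃).trans m₂⟩
  · obtain ⟨m, m₁, -, -, m₄⟩ := hE.exists_common l₁ _ w.1 _ _ hy₂ h₁ h le_rfl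
    exact n₁ ⟨c, (hy₁.trans m₁).trans m₄⟩

/-- The order-convex hull of a set of natural numbers. -/
def hull (A : Set ℕ) : Set ℕ := {p | ∃ a ∈ A, ∃ b ∈ A, a ≤ p ∧ p ≤ b}

theorem subset_hull {A : Set ℕ} {a : ℕ} (h : a ∈ A) : a ∈ hull A := ⟨a, h, a, h, le_rfl, le_rfl⟩

theorem ordConnected_hull (A : Set ℕ) : (hull A).OrdConnected :=
  ⟨fun _ ⟨a, ha, _, _, h₁, _⟩ _ ⟨_, _, d, hd, _, h₂⟩ _ hz =>
    ⟨a, ha, d, hd, h₁.trans hz.1, hz.2.trans h₂⟩⟩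

theorem IsGridStep.mem_hull_iff (hE : IsGridStep E) {r : ℕ} {K : Set ℕ} (hK : K.OrdConnected)
    {v : ℕ × ℕ} (hv : Topped E r v) :
    v.2 ∈ hull {p | Topped E r (v.1, p) ∧ leftmostTop E r (v.1, p) ∈ K} ↔
      leftmostTop E r v ∈ K := by
  constructor
  · rintro ⟨a, ⟨ha, ha'⟩, b, ⟨hb, hb'⟩, h₁, h₂⟩
    exact hK.out ha' hb' ⟨hE.leftmostTop_mono ha hv h₁, hE.leftmostTop_mono hv hb h₂⟩
  · intro h
    exact subset_hull ⟨hv, h⟩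

theorem IsGridStep.mem_hull_orphans_iff (hE : IsGridStep E) {r : ℕ} {w v : ℕ × ℕ} (hw : r ≤ w.1)
    (hv : Topped E r v ∨ ReflTransGen E w v) :
    v.2 ∈ hull {p | ¬ Topped E r (v.1, p) ∧ ReflTransGen E w (v.1, p)} ↔ ¬ Topped E r v := by
  constructor
  · rintro ⟨a, ⟨ha, ha'⟩, b, ⟨hb, hb'⟩, h₁, h₂⟩
    exact hE.not_topped_of_between hw ha' hb' ha hb h₁ h₂
  · intro h
    exact subset_hull ⟨h, hv.resolve_left h⟩

/-- Being reached from row `r` or from `w` passes along an arc from tail to head, and by hypothesis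
every tail has this property anyway. -/
theorem live_of_eqvGen {r : ℕ} {w : ℕ × ℕ}
    (hlive : ∀ a b, E a b → Topped E r a ∨ ReflTransGen E w a) {v x : ℕ × ℕ} (h : EqvGen E v x) :
    (Topped E r v ∨ ReflTransGen E w v) ↔ (Topped E r x ∨ ReflTransGen E w x) := by
  induction h with
  | rel a b h =>
    have h₁ := hlive a b h
    exact ⟨fun _ => h₁.imp (fun ⟨c, hc⟩ => ⟨c, hc.tail h⟩) (fun hc => hc.tail h), fun _ => h₁⟩
  | refl => rfl
  | symm _ _ _ ih => exact ih.symm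
  | trans _ _ _ _ _ ih₁ ih₂ => exact ih₁.trans ih₂

/-- Let `A` and `B` be the traces in row `r` of the components of `u` and `w`. They do not cross, so
`A` avoids the hull of `B` or `B` avoids the hull of `A`. Either hull is a union of traces, because
a trace which is partly inside and partly outside would cross. -/
theorem IsGridStep.exists_separating_interval (hE : IsGridStep E) {r : ℕ}
    (hr : ∀ u v, E u v → r ≤ u.1) {u w : ℕ × ℕ} (huw : ¬ EqvGen E u w)
    (hlive : ∀ a b, E a b → Topped E r a ∨ ReflTransGen E w a) :
    ∃ K : Set ℕ, K.OrdConnected ∧ (∀ c d, EqvGen E (r, c) (r, d) → (c ∈ K ↔ d ∈ K)) ∧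
      ((∀ c, EqvGen E (r, c) w → c ∈ K) ∧ (∀ c, EqvGen E (r, c) u → c ∉ K) ∨
        (∀ c, EqvGen E (r, c) w → c ∉ K) ∧ (∀ c, EqvGen E (r, c) u → c ∈ K)) := by
  -- `IsGridStep.noncrossing` needs one component whose vertices are all reached from row `r`. Every
  -- component but that of `w` qualifies, as it has no vertex reached from `w`.
  have top : ∀ v, (Topped E r v ∨ ReflTransGen E w v) → ¬ EqvGen E v w →
      ∀ x, EqvGen E v x → Topped E r x := by
    intro v hv hvw x hx
    exact ((live_of_eqvGen hlive hx).mp hv).resolve_right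
      fun h => hvw (hx.trans _ _ _ ((eqvGen_of_reach h).symm _ _))
  set A : Set ℕ := {c | EqvGen E (r, c) u} with hA
  set B : Set ℕ := {c | EqvGen E (r, c) w} with hB
  have nc : ∀ c d, EqvGen E (r, c) (r, d) → ¬ EqvGen E (r, c) w → ∀ p q,
      EqvGen E (r, p) (r, q) → ¬ EqvGen E (r, c) (r, p) →
      ((c < p ↔ c < q) ↔ (d < p ↔ d < q)) := fun c d hcd hcw p q hpq hcp =>
    hE.noncrossing hr hcd (top _ (Or.inl ⟨c, .refl⟩) hcw) hpq hcp .refl .refl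
  have nAw : ∀ c ∈ A, ¬ EqvGen E (r, c) w := fun c hc h =>
    huw ((EqvGen.symm _ _ hc).trans _ _ _ h)
  have nAB : ∀ c ∈ A, ∀ d ∈ B, ¬ EqvGen E (r, c) (r, d) := fun c hc d hd h =>
    nAw c hc (h.trans _ _ _ hd)
  have eqA : ∀ c ∈ A, ∀ d ∈ A, EqvGen E (r, c) (r, d) := fun c hc d hd =>
    EqvGen.trans _ _ _ hc (EqvGen.symm _ _ hd)
  have eqB : ∀ c ∈ B, ∀ d ∈ B, EqvGen E (r, c) (r, d) := fun c hc d hd =>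
    EqvGen.trans _ _ _ hc (EqvGen.symm _ _ hd)
  by_cases hcase : ∀ c ∈ A, c ∉ hull B
  · refine ⟨hull B, ordConnected_hull B, ?_, Or.inl ⟨fun c hc => subset_hull hc, hcase⟩⟩
    have half : ∀ c d, EqvGen E (r, c) (r, d) → c ∈ hull B → d ∈ hull B := by
      rintro c d hcd ⟨a, ha, b, hb, h₁, h₂⟩
      by_cases hcw : EqvGen E (r, c) w
      · exact subset_hull (a := d) ((hcd.symm _ _).trans _ _ _ hcw)
      · have e₁ : ¬ EqvGen E (r, c) (r, a) := fun h => hcw (h.trans _ _ _ ha)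
        have := nc c d hcd hcw a b (eqB a ha b hb) e₁
        have e₂ : c ≠ b := by rintro rfl; exact hcw hb
        exact ⟨a, ha, b, hb, by omega, by omega⟩
    exact fun c d h => ⟨half c d h, half d c (h.symm _ _)⟩
  · refine ⟨hull A, ordConnected_hull A, ?_, Or.inr ⟨?_, fun c hc => subset_hull hc⟩⟩
    · have half : ∀ c d, EqvGen E (r, c) (r, d) → c ∈ hull A → d ∈ hull A := by
        rintro c d hcd ⟨a, ha, b, hb, h₁, h₂⟩
        by_cases hcu : EqvGen E (r, c) u
        · exact subset_hull (a := d) ((hcd.symm _ _).trans _ _ _ hcu)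
        · have e₁ : ¬ EqvGen E (r, a) (r, c) := fun h => hcu ((h.symm _ _).trans _ _ _ ha)
          have := nc a b (eqA a ha b hb) (nAw a ha) c d hcd e₁
          have e₂ : c ≠ a := by rintro rfl; exact hcu ha
          exact ⟨a, ha, b, hb, by omega, by omega⟩
      exact fun c d h => ⟨half c d h, half d c (h.symm _ _)⟩
    · rintro c hc ⟨a, ha, b, hb, h₁, h₂⟩
      push Not at hcase
      obtain ⟨s, hs, x, hx, y, hy, h₃, h₄⟩ := hcase
      have e₁ : s ≠ x := by rintro rfl; exact nAw s hs hx
      have e₂ : s ≠ y := by rintro rfl; exact nAw s hs hy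
      have e₃ : a ≠ c := by rintro rfl; exact nAw a ha hc
      have e₄ : b ≠ c := by rintro rfl; exact nAw b hb hc
      -- Since `s` lies between `x` and `y`, so do `a` and `b`. Then `c` is between `a` and `b`
      -- while `y` is not, so the pairs `c, y` and `a, b` cross.
      have k₁ := nc s a (eqA s hs a ha) (nAw s hs) x y (eqB x hx y hy) (nAB s hs x hx)
      have k₂ := nc s b (eqA s hs b hb) (nAw s hs) x y (eqB x hx y hy) (nAB s hs x hx)
      have k₃ := nc a b (eqA a ha b hb) (nAw a ha) c y (eqB c hc y hy) (nAB a ha c hc)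
      omega

/-- If `u` and `w` are in different components of a planar digraph whose vertices are all reached
from row `r` or from `w`, then there is a set of vertices that separates `u` from `w`, is closed
under adjacency, and is simple in each row. -/
theorem IsGridStep.exists_separating_set (hE : IsGridStep E) {r : ℕ}
    (hr : ∀ u v, E u v → r ≤ u.1) {u w : ℕ × ℕ} (hu : Topped E r u) (hw : r ≤ w.1)
    (huw : ¬ EqvGen E u w) (hlive : ∀ a b, E a b → Topped E r a ∨ ReflTransGen E w a) :
    ∃ (h : ℕ × ℕ → Prop) (I J : ℕ → Set ℕ), (∀ i, (I i).OrdConnected) ∧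
      (∀ i, (J i).OrdConnected) ∧ (∀ a b, E a b → (h a ↔ h b)) ∧ h u ∧ ¬ h w ∧
      ((∀ v, (Topped E r v ∨ ReflTransGen E w v) → (h v ↔ v.2 ∈ I v.1 ∧ v.2 ∉ J v.1)) ∨
        ∀ v, (Topped E r v ∨ ReflTransGen E w v) → (h v ↔ ¬ (v.2 ∈ I v.1 ∨ v.2 ∈ J v.1))) := by
  obtain ⟨K, hKo, hK, hKuw⟩ := hE.exists_separating_interval hr huw hlive
  have lam : ∀ a b, EqvGen E a b → Topped E r a → Topped E r b →
      (leftmostTop E r a ∈ K ↔ leftmostTop E r b ∈ K) := fun a b hab ha hb =>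
    hK _ _ (((eqvGen_of_reach ha.reach_leftmostTop).trans _ _ _ hab).trans _ _ _
      ((eqvGen_of_reach hb.reach_leftmostTop).symm _ _))
  have lamx : ∀ a b, EqvGen E a b → Topped E r a → EqvGen E (r, leftmostTop E r a) b :=
    fun a b hab ha => (eqvGen_of_reach ha.reach_leftmostTop).trans _ _ _ hab
  have orph : ∀ a b, E a b → ¬ Topped E r a → EqvGen E b w := fun a b hab ha =>
    (((eqvGen_of_reach ((hlive a b hab).resolve_left ha)).trans _ _ _ (.rel _ _ hab)).symm _ _)
  have up : ∀ a b, E a b → Topped E r a → Topped E r b := fun a b hab ⟨c, hc⟩ => ⟨c, hc.tail hab⟩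
  -- The separating set consists of the topped vertices with label on the same side of `K` as the
  -- label of `u`. The intervals are the hulls of the vertices with label in `K` and of the vertices
  -- reached from `w` only.
  refine ⟨fun v => Topped E r v ∧ (leftmostTop E r v ∈ K ↔ leftmostTop E r u ∈ K),
    fun i => hull {p | Topped E r (i, p) ∧ leftmostTop E r (i, p) ∈ K},
    fun i => hull {p | ¬ Topped E r (i, p) ∧ ReflTransGen E w (i, p)},
    fun i => ordConnected_hull _, fun i => ordConnected_hull _, ?_, ⟨hu, Iff.rfl⟩, ?_, ?_⟩
  · intro a b hab
    by_cases ha : Topped E r a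
    · have hb := up a b hab ha
      have := lam a b (.rel _ _ hab) ha hb
      simp [ha, hb, this]
    -- A tail not reached from row `r` is reached from `w`. Its head is thus in the component of
    -- `w`, and if the head has a label, this is on the side of `w`.
    · simp only [ha, false_and, false_iff, not_and]
      intro hb
      have h₁ := lamx b w (orph a b hab ha) hb
      have h₂ := lamx u u (.refl _) hu
      rcases hKuw with ⟨k₁, k₂⟩ | ⟨k₁, k₂⟩
      · simp [k₁ _ h₁, k₂ _ h₂]
      · simp [k₁ _ h₁, k₂ _ h₂]
  · rintro ⟨hw', h⟩
    have h₁ := lamx w w (.refl _) hw'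
    have h₂ := lamx u u (.refl _) hu
    rcases hKuw with ⟨k₁, k₂⟩ | ⟨k₁, k₂⟩
    · simp [k₁ _ h₁, k₂ _ h₂] at h
    · simp [k₁ _ h₁, k₂ _ h₂] at h
  · have h₂ := lamx u u (.refl _) hu
    rcases hKuw with ⟨k₁, k₂⟩ | ⟨k₁, k₂⟩
    -- Here the label of `u` is outside `K`, so the set is what remains after removal of the labels
    -- in `K` and of the vertices reached from `w` only.
    · right
      intro v hv
      have hJ := hE.mem_hull_orphans_iff hw hv
      simp only [hJ, k₂ _ h₂, iff_false]
      by_cases ht : Topped E r v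
      · simp [ht, hE.mem_hull_iff hKo ht]
      · simp [ht]
    · left
      intro v hv
      have hJ := hE.mem_hull_orphans_iff hw hv
      simp only [hJ, k₂ _ h₂, iff_true]
      by_cases ht : Topped E r v
      · simp [ht, hE.mem_hull_iff hKo ht]
      · simp [ht]

end Potential

/-! ### Reduction to flows with forest support by concavity. -/

section Circulations

variable {L T : ℕ}

/-- The net outflow of `x` at the vertex `v`. -/
def netOutflow (x : Arc L T → ℝ) (v : Vertex L T) : ℝ :=
  (∑ a : Arc L T with a.tail = v, x a) - ∑ a : Arc L T with a.head = v, x a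

theorem netOutflow_add (x y : Arc L T → ℝ) (v : Vertex L T) :
    netOutflow (x + y) v = netOutflow x v + netOutflow y v := by
  simp only [netOutflow, Pi.add_apply, Finset.sum_add_distrib]; ring

theorem netOutflow_smul (c : ℝ) (x : Arc L T → ℝ) (v : Vertex L T) :
    netOutflow (c • x) v = c * netOutflow x v := by
  simp only [netOutflow, Pi.smul_apply, smul_eq_mul, ← Finset.mul_sum]; ring

theorem netOutflow_single (a : Arc L T) (v : Vertex L T) :
    netOutflow (Pi.single a 1) v = (if a.tail = v then 1 else 0) - if a.head = v then 1 else 0 := by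
  simp only [netOutflow, Finset.sum_filter, Pi.single_apply]
  congr 1
  · rw [Finset.sum_eq_single a] <;> simp +contextual
  · rw [Finset.sum_eq_single a] <;> simp +contextual

/-- Summation by parts. It is used with the rank as potential, to see that circulations have sum
zero, and with the indicator of a vertex set, to evaluate a flow across a cut. -/
theorem sum_mul_netOutflow (φ : Vertex L T → ℝ) (x : Arc L T → ℝ) :
    ∑ v, φ v * netOutflow x v = ∑ a, (φ a.tail - φ a.head) * x a := by
  have key : ∀ g : Arc L T → Vertex L T,
      ∑ v, φ v * (∑ a : Arc L T with g a = v, x a) = ∑ a, φ (g a) * x a := by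
    intro g
    rw [← Finset.sum_fiberwise (g := g) (f := fun a => φ (g a) * x a)]
    refine Finset.sum_congr rfl fun v _ => ?_
    rw [Finset.mul_sum]
    refine Finset.sum_congr rfl fun a ha => ?_
    rw [(Finset.mem_filter.mp ha).2]
  simp only [netOutflow, mul_sub, Finset.sum_sub_distrib, sub_mul, key]

theorem Arc.rank_head (a : Arc L T) :
    a.head.1.val + a.head.2.val = a.tail.1.val + a.tail.2.val + 1 := by
  obtain ⟨⟨u, v⟩, h⟩ := a
  simp only [Arc.head, Arc.tail]
  simp only [IsArc, Fin.ext_iff] at h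
  omega

/-- Each arc raises row plus column by exactly `1`, so the negative of this rank has difference `1`
along every arc. Consequently a nonzero circulation takes both signs. -/
theorem sum_eq_zero_of_circulation {z : Arc L T → ℝ} (hz : ∀ v, netOutflow z v = 0) :
    ∑ a, z a = 0 := by
  have h := sum_mul_netOutflow (fun v : Vertex L T => -((v.1.val + v.2.val : ℕ) : ℝ)) z
  simp only [hz, mul_zero, Finset.sum_const_zero] at h
  rw [h]
  refine Finset.sum_congr rfl fun a _ => ?_
  rw [a.rank_head]; push_cast; ring

namespace MFG

theorem isFeasible_iff {I : MFG L T} (hI : I.IsUncapacitated) (x : Arc L T → ℝ) :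
    I.IsFeasible x ↔ (∀ v, netOutflow x v = I.supply v) ∧ ∀ a, 0 ≤ x a := by
  refine ⟨fun h => ⟨h.1, h.2.1⟩, fun h => ⟨h.1, h.2, fun a u hu => ?_⟩⟩
  rw [hI a] at hu
  exact absurd hu (ENat.top_ne_natCast u)

/-- Moving a flow along a circulation in its support until an arc becomes empty. -/
theorem IsFeasible.exists_push {I : MFG L T} (hI : I.IsUncapacitated) {y z : Arc L T → ℝ}
    (hy : I.IsFeasible y) (hz : ∀ v, netOutflow z v = 0) (hyz : ∀ a, y a = 0 → z a = 0)
    (hneg : ∃ a, z a < 0) :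
    ∃ c : ℝ, 0 < c ∧ I.IsFeasible (y + c • z) ∧
      {a | (y + c • z) a ≠ 0}.ncard < {a | y a ≠ 0}.ncard := by
  obtain ⟨a₀, ha₀⟩ := hneg
  rw [isFeasible_iff hI] at hy
  obtain ⟨hy₁, hy₂⟩ := hy
  -- The ratio test: the arc with the least ratio among those on which `z` is negative becomes empty
  -- first and determines the step length.
  obtain ⟨a, ha, hmin⟩ := Finset.exists_min_image (Finset.univ.filter fun a => z a < 0)
    (fun a => y a / (-z a)) ⟨a₀, by simpa using ha₀⟩
  replace ha : z a < 0 := by simpa using ha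
  have hya : 0 < y a := lt_of_le_of_ne (hy₂ a) fun h => ha.ne (hyz a h.symm)
  refine ⟨y a / (-z a), div_pos hya (by linarith), ?_, ?_⟩
  · rw [isFeasible_iff hI]
    refine ⟨fun v => by rw [netOutflow_add, netOutflow_smul, hz, hy₁]; ring, fun b => ?_⟩
    simp only [Pi.add_apply, Pi.smul_apply, smul_eq_mul]
    rcases lt_or_ge (z b) 0 with hb | hb
    · have h := hmin b (by simpa using hb)
      rw [le_div_iff₀ (by linarith)] at h
      linarith
    · have : 0 ≤ y a / (-z a) := (div_pos hya (by linarith)).le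
      have := hy₂ b
      positivity
  · refine Set.ncard_lt_ncard ⟨fun b hb h => hb ?_, fun h => ?_⟩ (Set.toFinite _)
    · simp [h, hyz b h]
    · refine h (show y a ≠ 0 from hya.ne') ?_
      simp only [Pi.add_apply, Pi.smul_apply, smul_eq_mul]
      have : z a ≠ 0 := ha.ne
      field_simp
      ring

/-- The flow `y` is the convex combination of the two pushed flows with weights `d / (c + d)` and `c
/ (c + d)`, so by concavity its cost is at least the same average of their costs. -/
theorem totalCost_between (I : MFG L T) {y z : Arc L T → ℝ} {c d : ℝ} (hc : 0 < c) (hd : 0 < d)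
    (h₁ : ∀ a, 0 ≤ (y + c • z) a) (h₂ : ∀ a, 0 ≤ (y - d • z) a) :
    I.totalCost (y + c • z) ≤ I.totalCost y ∨ I.totalCost (y - d • z) ≤ I.totalCost y := by
  have key : d / (c + d) * I.totalCost (y + c • z) + c / (c + d) * I.totalCost (y - d • z) ≤
      I.totalCost y := by
    simp only [totalCost, Finset.mul_sum, ← Finset.sum_add_distrib]
    refine Finset.sum_le_sum fun a _ => ?_
    have h := (I.concave_cost a).2 (h₁ a) (h₂ a) 
      (show 0 ≤ d / (c + d) by positivity) (show 0 ≤ c / (c + d) by positivity)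
      (by field_simp; ring)
    simp only [smul_eq_mul] at h
    convert h using 2
    simp only [Pi.add_apply, Pi.sub_apply, Pi.smul_apply, smul_eq_mul]
    field_simp
    ring
  by_contra hcon
  push Not at hcon
  have e : d / (c + d) + c / (c + d) = 1 := by field_simp; ring
  have p₁ : 0 < d / (c + d) := by positivity
  have p₂ : 0 < c / (c + d) := by positivity
  have q₁ := mul_lt_mul_of_pos_left hcon.1 p₁
  have q₂ := mul_lt_mul_of_pos_left hcon.2 p₂
  have q₃ : d / (c + d) * I.totalCost y + c / (c + d) * I.totalCost y = I.totalCost y := by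
    rw [← add_mul, e, one_mul]
  linarith

/-- Each feasible flow is dominated by one whose support carries no circulation. -/
theorem IsFeasible.exists_forest {I : MFG L T} (hI : I.IsUncapacitated) {y : Arc L T → ℝ}
    (hy : I.IsFeasible y) :
    ∃ x, I.IsFeasible x ∧ I.totalCost x ≤ I.totalCost y ∧
      ∀ z : Arc L T → ℝ, (∀ v, netOutflow z v = 0) → (∀ a, x a = 0 → z a = 0) → z = 0 := by
  induction hn : {a | y a ≠ 0}.ncard using Nat.strong_induction_on generalizing y with
  | _ n ih =>
    by_cases hforest : ∀ z : Arc L T → ℝ, (∀ v, netOutflow z v = 0) →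
        (∀ a, y a = 0 → z a = 0) → z = 0
    · exact ⟨y, hy, le_rfl, hforest⟩
    push Not at hforest
    obtain ⟨z, hz, hyz, hne⟩ := hforest
    have hsum := sum_eq_zero_of_circulation hz
    have hneg : ∃ a, z a < 0 := by
      by_contra h
      push Not at h
      exact hne (funext fun a => (Finset.sum_eq_zero_iff_of_nonneg fun a _ => h a).mp hsum a
        (Finset.mem_univ a))
    have hpos : ∃ a, (-z) a < 0 := by
      by_contra h
      push Not at h
      refine hne (funext fun a => ?_)
      have := (Finset.sum_eq_zero_iff_of_nonneg fun a _ => h a).mp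
        (by simp only [Pi.neg_apply, Finset.sum_neg_distrib, hsum, neg_zero]) a (Finset.mem_univ a)
      simpa using this
    -- Both directions can be blocked, since `z` takes both signs; both pushed flows have smaller
    -- support, so the induction applies to the cheaper one.
    obtain ⟨c, hc, hfc, hcc⟩ := hy.exists_push hI hz hyz hneg
    obtain ⟨d, hd, hfd, hcd⟩ := hy.exists_push (z := -z) hI
      (fun v => by rw [← neg_one_smul ℝ z, netOutflow_smul, hz, mul_zero])
      (fun a ha => by simp [hyz a ha]) hpos
    rw [smul_neg, ← sub_eq_add_neg] at hfd hcd
    rcases I.totalCost_between hc hd hfc.2.1 hfd.2.1 with h | h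
    · obtain ⟨x, h₁, h₂, h₃⟩ := ih _ (hn ▸ hcc) hfc rfl
      exact ⟨x, h₁, h₂.trans h, h₃⟩
    · obtain ⟨x, h₁, h₂, h₃⟩ := ih _ (hn ▸ hcd) hfd rfl
      exact ⟨x, h₁, h₂.trans h, h₃⟩

end MFG

end Circulations

/-! ### The values of a forest flow as alternating sums of prefix sums of supplies. -/

section Forest

variable {L T : ℕ}

/-- The coordinates of a vertex as natural numbers. -/
def coords (v : Vertex L T) : ℕ × ℕ := (v.1.val, v.2.val)

theorem coords_injective : Function.Injective (coords (L := L) (T := T)) := by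
  rintro ⟨l, t⟩ ⟨l', t'⟩ h
  simp only [coords, Prod.mk.injEq] at h
  exact Prod.ext (Fin.ext h.1) (Fin.ext h.2)

/-- Adjacency by an arc of the set `S`, in coordinates. -/
def ArcRel (S : Arc L T → Prop) (u v : ℕ × ℕ) : Prop :=
  ∃ a, S a ∧ coords a.tail = u ∧ coords a.head = v

theorem isGridStep_arcRel (S : Arc L T → Prop) : IsGridStep (ArcRel S) := by
  rintro u v ⟨⟨⟨p, q⟩, h⟩, -, rfl, rfl⟩
  simp only [IsArc, Fin.ext_iff] at h
  simp only [coords, Arc.head, Arc.tail, Prod.mk.injEq]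
  omega

theorem exists_unit_flow (S : Arc L T → Prop) {p q : ℕ × ℕ} (h : EqvGen (ArcRel S) p q) :
    ∃ z : Arc L T → ℝ, (∀ a, ¬ S a → z a = 0) ∧ ∀ v, netOutflow z v =
      (if coords v = p then 1 else 0) - if coords v = q then 1 else 0 := by
  induction h with
  | rel p q h =>
    obtain ⟨a, ha, rfl, rfl⟩ := h
    refine ⟨Pi.single a 1, fun b hb => ?_, fun v => ?_⟩
    · rw [Pi.single_apply, if_neg]
      rintro rfl
      exact hb ha
    · simp only [netOutflow_single, coords_injective.eq_iff, eq_comm]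
  | refl p => exact ⟨0, fun _ _ => rfl, fun v => by simp [netOutflow]⟩
  | symm p q _ ih =>
    obtain ⟨z, h₁, h₂⟩ := ih
    refine ⟨(-1 : ℝ) • z, fun a ha => by simp [h₁ a ha], fun v => ?_⟩
    rw [netOutflow_smul, h₂]; ring
  | trans p q s _ _ ih₁ ih₂ =>
    obtain ⟨z, h₁, h₂⟩ := ih₁
    obtain ⟨y, h₃, h₄⟩ := ih₂
    refine ⟨z + y, fun a ha => by simp [h₁ a ha, h₃ a ha], fun v => ?_⟩
    rw [netOutflow_add, h₂, h₄]; ring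

namespace MFG

variable {I : MFG L T}

/-- Flow is traced back along positive arcs, which lowers the rank. This can only end at a vertex
without inflow, and such a vertex has positive supply, hence is in row `r`. -/
theorem IsFeasible.topped {x : Arc L T → ℝ} (hx : I.IsFeasible x) {r : Fin L}
    (hr : ∀ v, 0 < I.supply v → v.1 = r) (n : ℕ) : ∀ v : Vertex L T, v.1.val + v.2.val ≤ n →
      (I.supply v ≠ 0 ∨ ∃ a, 0 < x a ∧ (a.tail = v ∨ a.head = v)) →
      Topped (ArcRel fun a => 0 < x a) r (coords v) := by
  induction n using Nat.strong_induction_on with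
  | _ n ih =>
    intro v hn hv
    by_cases hin : ∃ a, 0 < x a ∧ a.head = v
    · obtain ⟨a, ha, rfl⟩ := hin
      have hrank := a.rank_head
      obtain ⟨c, hc⟩ := ih (n - 1) (by omega) a.tail (by omega) (Or.inr ⟨a, ha, Or.inl rfl⟩)
      exact ⟨c, hc.tail ⟨a, ha, rfl, rfl⟩⟩
    · push Not at hin
      have hzero : ∑ a : Arc L T with a.head = v, x a = 0 := by
        refine Finset.sum_eq_zero fun a ha => ?_
        refine le_antisymm ?_ (hx.2.1 a)
        by_contra h
        exact hin a (not_le.mp h) (Finset.mem_filter.mp ha).2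
      have hbal := hx.1 v
      rw [hzero, sub_zero] at hbal
      have hpos : 0 < I.supply v := by
        rw [← Int.cast_pos (R := ℝ), ← hbal]
        have hnn : 0 ≤ ∑ a : Arc L T with a.tail = v, x a := Finset.sum_nonneg fun a _ => hx.2.1 a
        rcases hv with hv | ⟨a, ha, ha' | ha'⟩
        · refine lt_of_le_of_ne hnn fun h => hv ?_
          rw [← h] at hbal
          exact_mod_cast hbal.symm
        · exact lt_of_lt_of_le ha (Finset.single_le_sum (f := x) (fun a _ => hx.2.1 a)
            (by simpa using ha'))
        · exact absurd ha' (hin a ha)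
      refine ⟨v.2.val, ?_⟩
      rw [show ((r : ℕ), v.2.val) = coords v by rw [← hr v hpos]; rfl]

/-- This applies the planar result to the positive arcs other than `e`, with the ends of `e` as `u`
and `w`. The description by intervals is only valid at vertices reached from row `r` or from `w`,
which include all vertices with nonzero supply. -/
theorem IsFeasible.exists_separating_set {x : Arc L T → ℝ} (hx : I.IsFeasible x)
    (hforest : ∀ z : Arc L T → ℝ, (∀ v, netOutflow z v = 0) → (∀ a, x a = 0 → z a = 0) → z = 0)
    (hI : I.SourcesInOneRow) {e : Arc L T} (he : 0 < x e) :
    ∃ (h : ℕ × ℕ → Prop) (A B : ℕ → Set ℕ), (∀ i, (A i).OrdConnected) ∧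
      (∀ i, (B i).OrdConnected) ∧
      (∀ a, a ≠ e → 0 < x a → (h (coords a.tail) ↔ h (coords a.head))) ∧
      h (coords e.tail) ∧ ¬ h (coords e.head) ∧
      ((∀ v, I.supply v ≠ 0 → (h (coords v) ↔ v.2.val ∈ A v.1 ∧ v.2.val ∉ B v.1)) ∨
        ∀ v, I.supply v ≠ 0 → (h (coords v) ↔ ¬ (v.2.val ∈ A v.1 ∨ v.2.val ∈ B v.1))) := by
  obtain ⟨r, hr⟩ := hI
  set S : Arc L T → Prop := fun a => a ≠ e ∧ 0 < x a with hS
  have hE := isGridStep_arcRel S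
  have topF := fun v hv => hx.topped hr _ v le_rfl hv
  -- A positive path that uses `e` is cut off at its last use of `e`; the rest starts at the head of
  -- `e`.
  have split : ∀ s v, ReflTransGen (ArcRel fun a => 0 < x a) s v →
      ReflTransGen (ArcRel S) s v ∨ ReflTransGen (ArcRel S) (coords e.head) v := by
    intro s v h
    induction h with
    | refl => exact Or.inl .refl
    | tail _ hbc ih =>
      obtain ⟨a, ha, rfl, rfl⟩ := hbc
      by_cases hae : a = e
      · subst hae; exact Or.inr .refl
      · have : ArcRel S (coords a.tail) (coords a.head) := ⟨a, ⟨hae, ha⟩, rfl, rfl⟩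
        exact ih.imp (fun h => h.tail this) (fun h => h.tail this)
  have live : ∀ v, (I.supply v ≠ 0 ∨ ∃ a, 0 < x a ∧ (a.tail = v ∨ a.head = v)) →
      Topped (ArcRel S) r (coords v) ∨ ReflTransGen (ArcRel S) (coords e.head) (coords v) := by
    intro v hv
    obtain ⟨c, hc⟩ := topF v hv
    exact (split _ _ hc).imp (fun h => ⟨c, h⟩) id
  have rank := e.rank_head
  have hu : Topped (ArcRel S) r (coords e.tail) := by
    refine (live e.tail (Or.inr ⟨e, he, Or.inl rfl⟩)).resolve_right fun h => ?_
    have := hE.le_of_reach h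
    simp only [coords] at this
    omega
  have hrow : ∀ v, (I.supply v ≠ 0 ∨ ∃ a, 0 < x a ∧ (a.tail = v ∨ a.head = v)) →
      r.val ≤ v.1.val := by
    intro v hv
    obtain ⟨c, hc⟩ := topF v hv
    exact ((isGridStep_arcRel _).le_of_reach hc).1
  -- A detour around `e` in the support, together with `e` reversed, would be a circulation that is
  -- nonzero on `e`.
  have huw : ¬ EqvGen (ArcRel S) (coords e.tail) (coords e.head) := by
    intro h
    obtain ⟨z, hz₁, hz₂⟩ := exists_unit_flow S h
    have hz := hforest (z + (-1 : ℝ) • Pi.single e 1)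
      (fun v => by
        rw [netOutflow_add, netOutflow_smul, netOutflow_single, hz₂]
        simp only [coords_injective.eq_iff, eq_comm (a := v)]
        ring)
      (fun a ha => by
        have hae : a ≠ e := by rintro rfl; exact he.ne' ha
        have hz := hz₁ a (fun h => h.2.ne' ha)
        simp [hz, hae])
    have := congrFun hz e
    simp [hz₁ e fun h => h.1 rfl] at this
  obtain ⟨h, A, B, hA, hB, hadj, hu', hw', hAB⟩ := hE.exists_separating_set
    (r := r) (fun u v ⟨a, ha, h₁, _⟩ => h₁ ▸ hrow a.tail (Or.inr ⟨a, ha.2, Or.inl rfl⟩)) hu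
    (hrow e.head (Or.inr ⟨e, he, Or.inr rfl⟩)) huw
    (by
      rintro u v ⟨a, ha, rfl, rfl⟩
      exact live a.tail (Or.inr ⟨a, ha.2, Or.inl rfl⟩))
  refine ⟨h, A, B, hA, hB, fun a hae ha => hadj _ _ ⟨a, ⟨hae, ha⟩, rfl, rfl⟩, hu', hw', ?_⟩
  exact hAB.imp (fun k v hv => k (coords v) (live v (Or.inl hv)))
    (fun k v hv => k (coords v) (live v (Or.inl hv)))

/-- The supply at the given coordinates, and `0` off the grid. -/
noncomputable def supplyAt (I : MFG L T) (i t : ℤ) : ℤ :=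
  Function.extend vertexKey I.supply 0 (i, t)

/-- The sum of the first `n` supplies of row `i`. -/
noncomputable def prefixSupply (I : MFG L T) (i n : ℕ) : ℤ :=
  ∑ t ∈ Finset.range n, I.supplyAt i t

/-- The alternating sums of six prefix sums of the supplies of row `i`. -/
def rowValues (I : MFG L T) (i : ℕ) : Set ℤ :=
  {d | ∃ z : Fin 6 → ℕ, (∀ k, z k ≤ T) ∧
    d = I.prefixSupply i (z 0) - I.prefixSupply i (z 1) + I.prefixSupply i (z 2) -
      I.prefixSupply i (z 3) + I.prefixSupply i (z 4) - I.prefixSupply i (z 5)}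

/-- The candidates for the values of an optimal flow. -/
def flowValues (I : MFG L T) : Set ℤ :=
  {c | ∃ d : ℕ → ℤ, (∀ i < L, d i ∈ I.rowValues i) ∧ c = ∑ i ∈ Finset.range L, d i}

theorem supplyAt_coe (I : MFG L T) (v : Vertex L T) :
    I.supplyAt (v.1.val : ℤ) (v.2.val : ℤ) = I.supply v :=
  vertexKey_injective.extend_apply I.supply 0 v

-- The part of an interval inside the row runs from its least to its greatest element. If that part
-- is empty, both prefixes are taken empty.
open Classical in
theorem exists_prefixSupply_sub (I : MFG L T) (i : Fin L) {A : Set ℕ} (hA : A.OrdConnected) :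
    ∃ m n, m ≤ T ∧ n ≤ T ∧ (∑ t : Fin T, if t.val ∈ A then I.supply (i, t) else 0) =
      I.prefixSupply i m - I.prefixSupply i n := by
  have key : ∀ m n, n ≤ m → m ≤ T → (∀ t < T, t ∈ A ↔ n ≤ t ∧ t < m) →
      (∑ t : Fin T, if t.val ∈ A then I.supply (i, t) else 0) =
      I.prefixSupply i m - I.prefixSupply i n := by
    intro m n hnm hm h
    rw [prefixSupply, prefixSupply, ← Finset.sum_Ico_eq_sub _ hnm]
    have e : ∀ t : Fin T, (if t.val ∈ A then I.supply (i, t) else 0) =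
        (fun t : ℕ => if t ∈ A then I.supplyAt (i.val : ℤ) (t : ℤ) else 0) t.val := by
      intro t
      simp only [← I.supplyAt_coe (i, t)]
    rw [Finset.sum_congr rfl fun t _ => e t, Fin.sum_univ_eq_sum_range
      (fun t : ℕ => if t ∈ A then I.supplyAt (i.val : ℤ) (t : ℤ) else 0), ← Finset.sum_filter]
    refine Finset.sum_congr ?_ fun _ _ => rfl
    ext t
    simp only [Finset.mem_filter, Finset.mem_range, Finset.mem_Ico]
    constructor
    · rintro ⟨h₁, h₂⟩; exact (h t h₁).mp h₂
    · intro h₁; exact ⟨by omega, (h t (by omega)).mpr h₁⟩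
  by_cases hne : ∃ t < T, t ∈ A
  · set F : Finset ℕ := (Finset.range T).filter (· ∈ A) with hF
    have hFne : F.Nonempty := by
      obtain ⟨t, h₁, h₂⟩ := hne
      exact ⟨t, by simp [hF, h₁, h₂]⟩
    have hmin := F.min'_mem hFne
    have hmax := F.max'_mem hFne
    have hle := F.min'_le _ hmax
    have hmin' := hmin
    have hmax' := hmax
    simp only [hF, Finset.mem_filter, Finset.mem_range] at hmin' hmax'
    refine ⟨F.max' hFne + 1, F.min' hFne, hmax'.1, hmin'.1.le, key _ _ (by omega) hmax'.1 ?_⟩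
    intro t ht
    constructor
    · intro htA
      have hmem : t ∈ F := by simp [hF, ht, htA]
      exact ⟨F.min'_le _ hmem, Nat.lt_succ_of_le (F.le_max' _ hmem)⟩
    · rintro ⟨h₁, h₂⟩
      exact hA.out hmin'.2 hmax'.2 ⟨h₁, Nat.le_of_lt_succ h₂⟩
  · push Not at hne
    exact ⟨0, 0, by omega, by omega, key 0 0 le_rfl (by omega) fun t ht => by simp [hne t ht]⟩

theorem zero_mem_rowValues (I : MFG L T) (i : ℕ) : 0 ∈ I.rowValues i :=
  ⟨fun _ => 0, fun _ => Nat.zero_le _, by simp⟩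

theorem zero_mem_flowValues (I : MFG L T) : 0 ∈ I.flowValues :=
  ⟨fun _ => 0, fun i _ => I.zero_mem_rowValues i, by simp⟩

/-- The arc `e` is the only arc of the support across the cut, so its flow is the total supply of
the separating set, which inclusion and exclusion express by interval sums. -/
theorem IsFeasible.exists_flowValue {x : Arc L T → ℝ} (hx : I.IsFeasible x)
    (hforest : ∀ z : Arc L T → ℝ, (∀ v, netOutflow z v = 0) → (∀ a, x a = 0 → z a = 0) → z = 0)
    (hI : I.SourcesInOneRow) (e : Arc L T) : ∃ c ∈ I.flowValues, x e = (c : ℝ) := by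
  classical
  rcases (hx.2.1 e).eq_or_lt with he | he
  · exact ⟨0, I.zero_mem_flowValues, by simp [← he]⟩
  obtain ⟨h, A, B, hA, hB, hadj, hu, hw, hAB⟩ := hx.exists_separating_set hforest hI he
  -- Summation by parts against the indicator of `h`: the two ends of any other positive arc are on
  -- the same side.
  have hval : x e = ((∑ v, if h (coords v) then I.supply v else 0 : ℤ) : ℝ) := by
    have k := sum_mul_netOutflow (fun v : Vertex L T => if h (coords v) then (1 : ℝ) else 0) x
    have k₁ : ∑ a, ((if h (coords a.tail) then (1 : ℝ) else 0) -
        if h (coords a.head) then 1 else 0) * x a = x e := by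
      rw [Finset.sum_eq_single e]
      · simp [hu, hw]
      · intro a _ hae
        rcases (hx.2.1 a).eq_or_lt with ha | ha
        · simp [← ha]
        · simp [hadj a hae ha]
      · simp
    rw [← k₁, ← k]
    push_cast
    refine Finset.sum_congr rfl fun v _ => ?_
    rw [show netOutflow x v = I.supply v from hx.1 v]
    split_ifs <;> simp
  have rows : ∀ f : Vertex L T → ℤ, ∑ v, f v = ∑ i : Fin L, ∑ t : Fin T, f (i, t) :=
    fun f => Fintype.sum_prod_type f
  choose mA nA hmA hnA eA using fun i : Fin L => I.exists_prefixSupply_sub i (hA i)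
  choose mB nB hmB hnB eB using fun i : Fin L => I.exists_prefixSupply_sub i (hB i)
  obtain ⟨C, hC⟩ : ∃ C : ℕ → Set ℕ, ∀ i, C i = A i ∩ B i := ⟨_, fun _ => rfl⟩
  choose mC nC hmC hnC eC using fun i : Fin L =>
    I.exists_prefixSupply_sub i (A := C i) (hC i ▸ (hA i).inter (hB i))
  refine ⟨_, ?_, hval⟩
  rcases hAB with k | k
  · refine ⟨fun i => if hi : i < L then I.prefixSupply i (mA ⟨i, hi⟩) -
      I.prefixSupply i (nA ⟨i, hi⟩) + I.prefixSupply i (nC ⟨i, hi⟩) -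
      I.prefixSupply i (mC ⟨i, hi⟩) + I.prefixSupply i 0 - I.prefixSupply i 0 else 0, ?_, ?_⟩
    · intro i hi
      simp only [hi, dite_true]
      refine ⟨![mA ⟨i, hi⟩, nA ⟨i, hi⟩, nC ⟨i, hi⟩, mC ⟨i, hi⟩, 0, 0], ?_, rfl⟩
      intro j
      fin_cases j <;> simp [hmA, hnA, hmC, hnC]
    · rw [rows, ← Fin.sum_univ_eq_sum_range]
      refine Finset.sum_congr rfl fun i _ => ?_
      simp only [i.isLt, dite_true, Fin.eta]
      have : ∀ t : Fin T, (if h (coords (i, t)) then I.supply (i, t) else 0) =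
          (if t.val ∈ A i then I.supply (i, t) else 0) -
          if t.val ∈ C i then I.supply (i, t) else 0 := by
        intro t
        by_cases hs : I.supply (i, t) = 0
        · simp [hs]
        · have := k (i, t) hs
          simp only at this
          by_cases h₁ : t.val ∈ A i <;> by_cases h₂ : t.val ∈ B i <;> simp [this, hC, h₁, h₂]
      rw [Finset.sum_congr rfl fun t _ => this t, Finset.sum_sub_distrib, eA, eC]
      ring
  · refine ⟨fun i => if hi : i < L then I.prefixSupply i (nA ⟨i, hi⟩) -
      I.prefixSupply i (mA ⟨i, hi⟩) + I.prefixSupply i (nB ⟨i, hi⟩) -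
      I.prefixSupply i (mB ⟨i, hi⟩) + I.prefixSupply i (mC ⟨i, hi⟩) -
      I.prefixSupply i (nC ⟨i, hi⟩) else 0, ?_, ?_⟩
    · intro i hi
      simp only [hi, dite_true]
      refine ⟨![nA ⟨i, hi⟩, mA ⟨i, hi⟩, nB ⟨i, hi⟩, mB ⟨i, hi⟩, mC ⟨i, hi⟩, nC ⟨i, hi⟩], ?_, rfl⟩
      intro j
      fin_cases j <;> simp [hmA, hnA, hmB, hnB, hmC, hnC]
    -- As all supplies sum to zero, the supply of the set is minus that of its complement, which is
    -- `A ∪ B` in each row; `A ∪ B` contributes `A` plus `B` minus `A ∩ B`.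
    · have tot : (∑ v, if h (coords v) then I.supply v else 0) =
          ∑ v, ((if h (coords v) then I.supply v else 0) - I.supply v) := by
        rw [Finset.sum_sub_distrib, I.sum_supply, sub_zero]
      rw [tot, rows, ← Fin.sum_univ_eq_sum_range]
      refine Finset.sum_congr rfl fun i _ => ?_
      simp only [i.isLt, dite_true, Fin.eta]
      have : ∀ t : Fin T, (if h (coords (i, t)) then I.supply (i, t) else 0) - I.supply (i, t) =
          (if t.val ∈ C i then I.supply (i, t) else 0) -
          (if t.val ∈ A i then I.supply (i, t) else 0) -
          if t.val ∈ B i then I.supply (i, t) else 0 := by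
        intro t
        by_cases hs : I.supply (i, t) = 0
        · simp [hs]
        · have := k (i, t) hs
          simp only at this
          by_cases h₁ : t.val ∈ A i <;> by_cases h₂ : t.val ∈ B i <;> simp [this, hC, h₁, h₂]
      rw [Finset.sum_congr rfl fun t _ => this t, Finset.sum_sub_distrib, Finset.sum_sub_distrib,
        eA, eB, eC]
      ring

/-- Each feasible flow is dominated by an integral one with values among the candidates. -/
theorem IsFeasible.exists_integral (hunc : I.IsUncapacitated) (hI : I.SourcesInOneRow)
    {y : Arc L T → ℝ} (hy : I.IsFeasible y) :
    ∃ x : Arc L T → ℤ, I.IsFeasible (fun a => (x a : ℝ)) ∧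
      I.totalCost (fun a => (x a : ℝ)) ≤ I.totalCost y ∧ ∀ a, x a ∈ I.flowValues := by
  obtain ⟨x, h₁, h₂, h₃⟩ := hy.exists_forest hunc
  choose c hc hxc using h₁.exists_flowValue h₃ hI
  obtain rfl : x = fun a => (c a : ℝ) := funext hxc
  exact ⟨c, h₁, h₂, hc⟩

end MFG

end Forest

/-! ### Decomposition of a flow into columns. -/

section Columns

variable {L T : ℕ} {M : Type*} [AddCommMonoid M]

/-- A function on the arcs, indexed by arc keys and extended by `0`. -/
noncomputable def arcExt (x : Arc L T → M) (d : Bool) (l t : ℤ) : M :=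
  Function.extend arcKey x 0 (d, l, t)

theorem arcExt_eq (x : Arc L T → M) (a : Arc L T) {d : Bool} {l t : ℤ}
    (h : arcKey a = (d, l, t)) : arcExt x d l t = x a := by
  rw [arcExt, ← h, arcKey_injective.extend_apply]

theorem arcExt_eq_zero (x : Arc L T → M) {d : Bool} {l t : ℤ}
    (h : ∀ a : Arc L T, arcKey a ≠ (d, l, t)) : arcExt x d l t = 0 := by
  rw [arcExt, Function.extend_apply' _ _ _ fun ⟨a, ha⟩ => h a ha]; rfl

theorem Arc.head_eq (a : Arc L T) :
    (a.isDown = true ∧ a.head.1.val = a.tail.1.val + 1 ∧ a.head.2 = a.tail.2) ∨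
      (a.isDown = false ∧ a.head.1 = a.tail.1 ∧ a.head.2.val = a.tail.2.val + 1) := by
  obtain ⟨⟨u, v⟩, h⟩ := a
  simp only [Arc.isDown, Arc.head, Arc.tail]
  rcases h with h | h
  · exact Or.inl ⟨decide_eq_true h.2.symm, h⟩
  · refine Or.inr ⟨decide_eq_false fun h' => ?_, h⟩
    have := h.2
    simp only at this h'
    rw [h'] at this
    omega

theorem Arc.down_bounds {a : Arc L T} {l t : ℤ} (h : arcKey a = (true, l, t)) :
    0 ≤ l ∧ l + 1 < L ∧ 0 ≤ t ∧ t < T := by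
  simp only [arcKey, vertexKey, Prod.mk.injEq] at h
  have := a.head.1.isLt
  have := a.tail.2.isLt
  rcases a.head_eq with h' | h'
  · omega
  · simp [h'] at h

theorem Arc.forward_bounds {a : Arc L T} {l t : ℤ} (h : arcKey a = (false, l, t)) :
    0 ≤ l ∧ l < L ∧ 0 ≤ t ∧ t + 1 < T := by
  simp only [arcKey, vertexKey, Prod.mk.injEq] at h
  have := a.head.2.isLt
  have := a.tail.1.isLt
  rcases a.head_eq with h' | h'
  · simp [h'] at h
  · omega

theorem exists_down_arc {l t : ℕ} (hl : l + 1 < L) (ht : t < T) :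
    ∃ a : Arc L T, arcKey a = (true, (l : ℤ), (t : ℤ)) :=
  ⟨⟨((⟨l, by omega⟩, ⟨t, ht⟩), (⟨l + 1, hl⟩, ⟨t, ht⟩)), Or.inl ⟨rfl, rfl⟩⟩,
    by simp [arcKey, Arc.isDown, Arc.tail, Arc.head, vertexKey]⟩

theorem exists_forward_arc {l t : ℕ} (hl : l < L) (ht : t + 1 < T) :
    ∃ a : Arc L T, arcKey a = (false, (l : ℤ), (t : ℤ)) :=
  ⟨⟨((⟨l, hl⟩, ⟨t, by omega⟩), (⟨l, hl⟩, ⟨t + 1, ht⟩)), Or.inr ⟨rfl, rfl⟩⟩,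
    by simp [arcKey, Arc.isDown, Arc.tail, Arc.head, vertexKey]⟩

theorem sum_eq_sum_arcExt (x : Arc L T → M) :
    ∑ a, x a = ∑ v : Vertex L T, (arcExt x true v.1.val v.2.val + arcExt x false v.1.val v.2.val) := by
  have h := Fintype.sum_of_injective (fun a : Arc L T => (a.isDown, a.tail))
    (fun a a' h => arcKey_injective (by
      simp only [Prod.mk.injEq] at h
      simp only [arcKey, h])) x
    (fun p : Bool × Vertex L T => arcExt x p.1 p.2.1.val p.2.2.val)
    (fun p hp => arcExt_eq_zero x fun a ha => hp ⟨a, by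
      simp only [arcKey, Prod.mk.injEq] at ha
      exact Prod.ext ha.1 (vertexKey_injective ha.2)⟩)
    (fun a => (arcExt_eq x a rfl).symm)
  rw [h, Fintype.sum_prod_type, Fintype.sum_bool, ← Finset.sum_add_distrib]

theorem sum_tail (x : Arc L T → M) (v : Vertex L T) :
    ∑ a : Arc L T with a.tail = v, x a =
      arcExt x true v.1.val v.2.val + arcExt x false v.1.val v.2.val := by
  classical
  have key : ∀ d (w : Vertex L T), arcExt (fun a : Arc L T => if a.tail = v then x a else 0) d
      w.1.val w.2.val = if w = v then arcExt x d w.1.val w.2.val else 0 := by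
    intro d w
    by_cases h : ∃ a : Arc L T, arcKey a = (d, (w.1.val : ℤ), (w.2.val : ℤ))
    · obtain ⟨a, ha⟩ := h
      rw [arcExt_eq _ a ha, arcExt_eq _ a ha]
      simp only [arcKey, Prod.mk.injEq] at ha
      rw [show a.tail = w from vertexKey_injective ha.2]
    · push Not at h
      rw [arcExt_eq_zero _ h, arcExt_eq_zero _ h, ite_self]
  rw [Finset.sum_filter, sum_eq_sum_arcExt]
  simp [key, Finset.sum_add_distrib]

/-- Arcs are indexed by their tails, so the arcs entering `v` are found one row up and one column to
the left. At the border these keys are off the grid, where the extension is `0`. -/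
theorem sum_head (x : Arc L T → M) (v : Vertex L T) :
    ∑ a : Arc L T with a.head = v, x a =
      arcExt x true (v.1.val - 1) v.2.val + arcExt x false v.1.val (v.2.val - 1) := by
  have inj : Function.Injective (fun a : Arc L T => (a.isDown, a.head)) := by
    intro a a' h
    simp only [Prod.mk.injEq] at h
    obtain ⟨h₁, h₂⟩ := h
    refine arcKey_injective (Prod.ext h₁ ?_)
    simp only [arcKey, vertexKey, Prod.mk.injEq]
    have e₁ := congrArg (fun v => v.1.val) h₂
    have e₂ := congrArg (fun v => v.2.val) h₂
    rcases a.head_eq with h | h <;> rcases a'.head_eq with h' | h' <;>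
      simp only [Fin.ext_iff, h.1, h'.1] at h h' h₁ <;> first | omega | simp at h₁
  have h := Fintype.sum_of_injective _ inj (fun a => if a.head = v then x a else 0)
    (fun p : Bool × Vertex L T => if p.2 = v then
      (if p.1 then arcExt x true (v.1.val - 1) v.2.val else arcExt x false v.1.val (v.2.val - 1))
      else 0) ?_ ?_
  · rw [Finset.sum_filter, h, Fintype.sum_prod_type, Fintype.sum_bool]
    simp
  · rintro ⟨d, w⟩ hp
    simp only
    split_ifs with hw hd
    · subst hw hd
      refine arcExt_eq_zero x fun a ha => hp ⟨a, ?_⟩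
      simp only [arcKey, vertexKey, Prod.mk.injEq] at ha
      rcases a.head_eq with h' | h'
      · exact Prod.ext ha.1 (Prod.ext (Fin.ext (by simp only; omega))
          (Fin.ext (by simp only [h'.2.2]; omega)))
      · simp [h'.1] at ha
    · subst hw
      obtain rfl : d = false := by simpa using hd
      refine arcExt_eq_zero x fun a ha => hp ⟨a, ?_⟩
      simp only [arcKey, vertexKey, Prod.mk.injEq] at ha
      rcases a.head_eq with h' | h'
      · simp [h'.1] at ha
      · exact Prod.ext ha.1 (Prod.ext (Fin.ext (by simp only [h'.2.1]; omega))
          (Fin.ext (by simp only; omega)))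
    · rfl
  · intro a
    split_ifs with hw hd
    · subst hw
      rw [arcExt_eq x a]
      rcases a.head_eq with h' | h'
      · simp [arcKey, vertexKey, h']
      · simp [h'.1] at hd
    · subst hw
      rw [arcExt_eq x a]
      rcases a.head_eq with h' | h'
      · simp [h'.1] at hd
      · simp [arcKey, vertexKey, h']
    · rfl

theorem netOutflow_eq (x : Arc L T → ℝ) (v : Vertex L T) :
    netOutflow x v = arcExt x true v.1.val v.2.val + arcExt x false v.1.val v.2.val -
      (arcExt x true (v.1.val - 1) v.2.val + arcExt x false v.1.val (v.2.val - 1)) := by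
  rw [netOutflow, sum_tail, sum_head]

theorem arcExt_cast (x : Arc L T → ℤ) (d : Bool) (l t : ℤ) :
    arcExt (fun a => (x a : ℝ)) d l t = ((arcExt x d l t : ℤ) : ℝ) := by
  by_cases h : ∃ a : Arc L T, arcKey a = (d, l, t)
  · obtain ⟨a, ha⟩ := h
    rw [arcExt_eq _ a ha, arcExt_eq _ a ha]
  · push Not at h
    rw [arcExt_eq_zero _ h, arcExt_eq_zero _ h, Int.cast_zero]

/-- The sum of the net inflows of the first `n` vertices of column `t`, where `f` and `g` are the
flows entering and leaving the column: the flow down from the `n`-th vertex. -/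
def columnSum (b : ℤ → ℤ → ℤ) (t : ℕ) (f g : ℕ → ℤ) (n : ℕ) : ℤ :=
  ∑ i ∈ Finset.range n, (f i + b i t - g i)

/-- The flows `f` and `g` entering and leaving column `t` extend to a feasible flow in it. -/
def ColumnFeasible (L : ℕ) (b : ℤ → ℤ → ℤ) (t : ℕ) (f g : ℕ → ℤ) : Prop :=
  (∀ l < L, 0 ≤ g l ∧ 0 ≤ columnSum b t f g (l + 1)) ∧ columnSum b t f g L = 0

/-- The cost of the arcs with tail in column `t`. -/
noncomputable def columnCost (O : Oracle) (L : ℕ) (b : ℤ → ℤ → ℤ) (t : ℕ) (f g : ℕ → ℤ) : ℝ :=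
  ∑ l ∈ Finset.range L, (O true l t (columnSum b t f g (l + 1)) + O false l t (g l))

namespace MFG

variable (I : MFG L T)

/-- The oracle is `0` off the arc set. Hence the missing arcs of the last row and the last column
cost nothing, and column costs need no exception for them. -/
theorem oracle_arcExt (x : Arc L T → ℤ) (d : Bool) (l t : ℤ) :
    I.oracle d l t (arcExt x d l t) = arcExt (fun a => I.cost a (x a)) d l t := by
  by_cases h : ∃ a : Arc L T, arcKey a = (d, l, t)
  · obtain ⟨a, ha⟩ := h
    rw [arcExt_eq _ a ha, arcExt_eq _ a ha]
    exact arcExt_eq (fun a' => I.cost a' (x a : ℤ)) a ha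
  · push Not at h
    rw [arcExt_eq_zero (fun a => I.cost a (x a)) h]
    exact arcExt_eq_zero (fun a' => I.cost a' (arcExt x d l t : ℤ)) h

theorem totalCost_eq_sum_columnCost (x : Arc L T → ℤ) (f : ℕ → ℕ → ℤ)
    (hsum : ∀ t < T, ∀ l < L,
      columnSum I.supplyAt t (f t) (f (t + 1)) (l + 1) = arcExt x true l t)
    (hf : ∀ t < T, ∀ l < L, f (t + 1) l = arcExt x false l t) :
    I.totalCost (fun a => (x a : ℝ)) =
      ∑ t ∈ Finset.range T, columnCost I.oracle L I.supplyAt t (f t) (f (t + 1)) := by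
  rw [totalCost, sum_eq_sum_arcExt, Fintype.sum_prod_type_right, ← Fin.sum_univ_eq_sum_range]
  refine Finset.sum_congr rfl fun t _ => ?_
  rw [columnCost, ← Fin.sum_univ_eq_sum_range (fun l : ℕ => I.oracle true l t
    (columnSum I.supplyAt t (f t) (f (t + 1)) (l + 1)) + I.oracle false l t (f (t + 1) l))]
  refine Finset.sum_congr rfl fun l _ => ?_
  rw [hsum t t.isLt l l.isLt, hf t t.isLt l l.isLt, oracle_arcExt, oracle_arcExt]

variable {I}

/-- The column flows of an integral feasible flow. -/
theorem IsFeasible.columns {x : Arc L T → ℤ} (hx : I.IsFeasible fun a => (x a : ℝ)) :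
    ∃ f : ℕ → ℕ → ℤ, (∀ t l, f t l = 0 ∨ ∃ a, f t l = x a) ∧ (∀ l, f 0 l = 0) ∧
      (∀ l, f T l = 0) ∧ (∀ t < T, ColumnFeasible L I.supplyAt t (f t) (f (t + 1))) ∧
      I.totalCost (fun a => (x a : ℝ)) =
        ∑ t ∈ Finset.range T, columnCost I.oracle L I.supplyAt t (f t) (f (t + 1)) := by
  have hsucc : ∀ (t l : ℕ), arcExt x false l (((t + 1 : ℕ) : ℤ) - 1) = arcExt x false l t := by
    intro t l
    congr 1
    push_cast; ring
  have hext : ∀ d l t, arcExt x d l t = 0 ∨ ∃ a, arcExt x d l t = x a := by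
    intro d l t
    by_cases h : ∃ a : Arc L T, arcKey a = (d, l, t)
    · obtain ⟨a, ha⟩ := h
      exact Or.inr ⟨a, arcExt_eq _ a ha⟩
    · push Not at h
      exact Or.inl (arcExt_eq_zero _ h)
  have hnn : ∀ d l t, 0 ≤ arcExt x d l t := by
    intro d l t
    rcases hext d l t with h | ⟨a, h⟩
    · exact h.ge
    · have := hx.2.1 a
      simp only [Int.cast_nonneg_iff] at this
      rwa [h]
  -- Flow balance, added up from the top of the column: what the first `n` vertices receive in
  -- excess must go down from row `n - 1`. For `n = 0` the key is off the grid.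
  have hsum : ∀ t < T, ∀ n ≤ L, columnSum I.supplyAt t (fun l => arcExt x false l ((t : ℤ) - 1))
      (fun l => arcExt x false l (((t + 1 : ℕ) : ℤ) - 1)) n = arcExt x true ((n : ℤ) - 1) t := by
    intro t ht n
    induction n with
    | zero =>
      intro _
      rw [arcExt_eq_zero]
      · simp [columnSum]
      · intro a ha
        have := Arc.down_bounds ha
        simp only [Nat.cast_zero] at this
        omega
    | succ n ih =>
      intro hn
      rw [columnSum, Finset.sum_range_succ, ← columnSum, ih (by omega)]
      have h := hx.1 (⟨n, by omega⟩, ⟨t, ht⟩)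
      have h' := netOutflow_eq (fun a => (x a : ℝ)) (⟨n, by omega⟩, ⟨t, ht⟩)
      rw [netOutflow, h] at h'
      simp only [arcExt_cast] at h'
      have hb := I.supplyAt_coe (⟨n, by omega⟩, ⟨t, ht⟩)
      simp only at hb
      rw [← hb] at h'
      have h'' : I.supplyAt (n : ℤ) (t : ℤ) = arcExt x true n t + arcExt x false n t -
        (arcExt x true ((n : ℤ) - 1) t + arcExt x false n ((t : ℤ) - 1)) := by exact_mod_cast h'
      rw [hsucc, h'', show ((n + 1 : ℕ) : ℤ) - 1 = n by push_cast; ring]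
      ring
  have hsum' : ∀ t < T, ∀ l < L, columnSum I.supplyAt t
      (fun l => arcExt x false l ((t : ℤ) - 1))
      (fun l => arcExt x false l (((t + 1 : ℕ) : ℤ) - 1)) (l + 1) = arcExt x true l t := by
    intro t ht l hl
    rw [hsum t ht _ hl, show ((l + 1 : ℕ) : ℤ) - 1 = l by push_cast; ring]
  refine ⟨fun t l => arcExt x false l ((t : ℤ) - 1), fun t l => hext _ _ _, ?_, ?_, ?_, ?_⟩
  · intro l
    refine arcExt_eq_zero _ fun a ha => ?_
    have := Arc.forward_bounds ha
    simp only [Nat.cast_zero] at this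
    omega
  · intro l
    refine arcExt_eq_zero _ fun a ha => ?_
    have := Arc.forward_bounds ha
    omega
  · intro t ht
    refine ⟨fun l hl => ⟨hnn _ _ _, ?_⟩, ?_⟩
    · rw [hsum' t ht l hl]
      exact hnn _ _ _
    · rw [hsum t ht L le_rfl]
      refine arcExt_eq_zero _ fun a ha => ?_
      have := Arc.down_bounds ha
      omega
  · exact I.totalCost_eq_sum_columnCost x _ hsum' fun t _ l _ => hsucc t l

/-- The flow with the given column flows. -/
theorem isFeasible_of_columns (hunc : I.IsUncapacitated) {x : Arc L T → ℤ} {D F : ℤ → ℤ → ℤ}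
    (hxD : ∀ a : Arc L T, x a = if a.isDown then D a.tail.1.val a.tail.2.val
      else F a.tail.1.val a.tail.2.val)
    {f : ℕ → ℕ → ℤ} (hf₀ : ∀ l < L, f 0 l = 0) (hfT : ∀ l < L, f T l = 0)
    (hf : ∀ t < T, ColumnFeasible L I.supplyAt t (f t) (f (t + 1)))
    (hD : ∀ t < T, ∀ l < L, D l t = columnSum I.supplyAt t (f t) (f (t + 1)) (l + 1))
    (hF : ∀ t < T, ∀ l < L, F l t = f (t + 1) l) :
    I.IsFeasible (fun a => (x a : ℝ)) ∧ I.totalCost (fun a => (x a : ℝ)) =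
        ∑ t ∈ Finset.range T, columnCost I.oracle L I.supplyAt t (f t) (f (t + 1)) := by
  have hsum : ∀ t < T, ∀ n ≤ L, columnSum I.supplyAt t (f t) (f (t + 1)) n =
      arcExt x true ((n : ℤ) - 1) t := by
    intro t ht n hn
    rcases Nat.eq_zero_or_pos n with rfl | hpos
    · rw [arcExt_eq_zero]
      · simp [columnSum]
      · intro a ha
        have := Arc.down_bounds ha
        simp only [Nat.cast_zero] at this
        omega
    obtain ⟨l, rfl⟩ : ∃ l, n = l + 1 := ⟨n - 1, by omega⟩
    rw [show ((l + 1 : ℕ) : ℤ) - 1 = l by push_cast; ring]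
    by_cases hl : l + 1 < L
    · obtain ⟨a, ha⟩ := exists_down_arc hl ht
      rw [arcExt_eq x a ha, hxD]
      simp only [arcKey, vertexKey, Prod.mk.injEq] at ha
      rw [ha.1, ha.2.1, ha.2.2, if_pos rfl, hD t ht l (by omega)]
    -- No downward arc leaves the last row, and column feasibility requires the remaining flow there
    -- to be `0`.
    · obtain rfl : l + 1 = L := by omega
      rw [(hf t ht).2, arcExt_eq_zero]
      intro a ha
      have := Arc.down_bounds ha
      omega
  have hfwd : ∀ t ≤ T, ∀ l < L, f t l = arcExt x false l ((t : ℤ) - 1) := by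
    intro t ht l hl
    rcases Nat.eq_zero_or_pos t with rfl | hpos
    · rw [hf₀ l hl, arcExt_eq_zero]
      intro a ha
      have := Arc.forward_bounds ha
      simp only [Nat.cast_zero] at this
      omega
    obtain ⟨s, rfl⟩ : ∃ s, t = s + 1 := ⟨t - 1, by omega⟩
    rw [show ((s + 1 : ℕ) : ℤ) - 1 = s by push_cast; ring]
    by_cases hs : s + 1 < T
    · obtain ⟨a, ha⟩ := exists_forward_arc hl hs
      rw [arcExt_eq x a ha, hxD]
      simp only [arcKey, vertexKey, Prod.mk.injEq] at ha
      rw [ha.1, ha.2.1, ha.2.2, if_neg (by simp), hF s (by omega) l hl]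
    · obtain rfl : s + 1 = T := by omega
      rw [hfT l hl, arcExt_eq_zero]
      intro a ha
      have := Arc.forward_bounds ha
      omega
  have hsum' : ∀ t < T, ∀ l < L, columnSum I.supplyAt t (f t) (f (t + 1)) (l + 1) =
      arcExt x true l t := by
    intro t ht l hl
    rw [hsum t ht _ hl, show ((l + 1 : ℕ) : ℤ) - 1 = l by push_cast; ring]
  have hfwd' : ∀ t < T, ∀ l < L, f (t + 1) l = arcExt x false l t := by
    intro t ht l hl
    rw [hfwd _ ht l hl, show ((t + 1 : ℕ) : ℤ) - 1 = t by push_cast; ring]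
  refine ⟨(isFeasible_iff hunc _).mpr ⟨fun v => ?_, fun a => ?_⟩,
    I.totalCost_eq_sum_columnCost x f hsum' hfwd'⟩
  · obtain ⟨⟨l, hl⟩, ⟨t, ht⟩⟩ := v
    rw [netOutflow_eq]
    simp only [arcExt_cast]
    have hb := I.supplyAt_coe (⟨l, hl⟩, ⟨t, ht⟩)
    simp only at hb
    rw [← hb, ← hsum t ht l hl.le, ← hsum' t ht l hl, ← hfwd t ht.le l hl, ← hfwd' t ht l hl]
    rw [columnSum, Finset.sum_range_succ, ← columnSum]
    push_cast
    ring
  · have hl := a.tail.1.isLt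
    have ht := a.tail.2.isLt
    have : 0 ≤ x a := by
      rw [hxD]
      split_ifs
      · rw [hD _ ht _ hl]
        exact ((hf _ ht).1 _ hl).2
      · rw [hF _ ht _ hl]
        exact ((hf _ ht).1 _ hl).1
    exact_mod_cast this

end MFG

end Columns

/-! ### A calculus for programs -/

namespace Prog

/-- The integer arrays a program writes to. -/
def WritesInt : Prog → ℕ → Prop
  | skip, _ => False
  | iset r _ _ _, x => x = r
  | rset _ _ _ _, _ => False
  | seq p q, x => p.WritesInt x ∨ q.WritesInt x
  | cond _ p q, x => p.WritesInt x ∨ q.WritesInt x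
  | loop _ p, x => p.WritesInt x

/-- The real arrays a program writes to. -/
def WritesReal : Prog → ℕ → Prop
  | skip, _ => False
  | iset _ _ _ _, _ => False
  | rset r _ _ _, x => x = r
  | seq p q, x => p.WritesReal x ∨ q.WritesReal x
  | cond _ p q, x => p.WritesReal x ∨ q.WritesReal x
  | loop _ p, x => p.WritesReal x

def LoopFree : Prog → Prop
  | skip => True
  | iset _ _ _ _ => True
  | rset _ _ _ _ => True
  | seq p q => p.LoopFree ∧ q.LoopFree
  | cond _ p q => p.LoopFree ∧ q.LoopFree
  | loop _ _ => False

/-- A bound for the number of steps of a loop-free program. -/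
def size : Prog → ℕ
  | skip => 1
  | iset _ i j e => i.steps + j.steps + e.steps + 1
  | rset _ i j e => i.steps + j.steps + e.steps + 1
  | seq p q => p.size + q.size
  | cond b p q => b.steps + (p.size + q.size) + 1
  | loop _ _ => 0

open Classical in
/-- The effect of a loop-free program. -/
noncomputable def run (O : Oracle) : Prog → Store → Store
  | skip, s => s
  | iset r i j e, s => { s with ints := writeCell s.ints r (i.eval s) (j.eval s) (e.eval s) }
  | rset r i j e, s => { s with reals := writeCell s.reals r (i.eval s) (j.eval s) (e.eval O s) }
  | seq p q, s => q.run O (p.run O s)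
  | cond b p q, s => if b.Holds O s then p.run O s else q.run O s
  | loop _ _, s => s

theorem exec_run (O : Oracle) {p : Prog} (hp : p.LoopFree) (s : Store) :
    ∃ n ≤ p.size, Exec O p s n (p.run O s) := by
  induction p generalizing s with
  | skip => exact ⟨1, le_rfl, .skip s⟩
  | iset r i j e => exact ⟨_, le_rfl, .iset r i j e s⟩
  | rset r i j e => exact ⟨_, le_rfl, .rset r i j e s⟩
  | seq p q ihp ihq =>
    obtain ⟨m, hm, h₁⟩ := ihp hp.1 s
    obtain ⟨n, hn, h₂⟩ := ihq hp.2 (p.run O s)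
    exact ⟨m + n, Nat.add_le_add hm hn, h₁.seq h₂⟩
  | cond b p q ihp ihq =>
    by_cases hb : b.Holds O s
    · obtain ⟨m, hm, h⟩ := ihp hp.1 s
      refine ⟨_, ?_, by simpa only [run, if_pos hb] using Exec.cond_true (q := q) hb h⟩
      simp only [size]; omega
    · obtain ⟨m, hm, h⟩ := ihq hp.2 s
      refine ⟨_, ?_, by simpa only [run, if_neg hb] using Exec.cond_false (p := p) hb h⟩
      simp only [size]; omega
  | loop => exact hp.elim

end Prog

/-- `s'` agrees with `s` on the arrays which `p` does not write to. -/
def Frame (p : Prog) (s s' : Store) : Prop :=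
  (∀ r, ¬ p.WritesInt r → s'.ints r = s.ints r) ∧ ∀ r, ¬ p.WritesReal r → s'.reals r = s.reals r

/-- This separates the programs below: each uses its own arrays, so facts about all other arrays
survive its execution. -/
theorem Exec.frame {O : Oracle} {p : Prog} {s s' : Store} {n : ℕ} (h : Exec O p s n s') :
    Frame p s s' := by
  induction h with
  | skip => exact ⟨fun _ _ => rfl, fun _ _ => rfl⟩
  | iset r i j e s =>
    refine ⟨fun x hx => ?_, fun _ _ => rfl⟩
    funext i' j'
    simp only [Prog.WritesInt] at hx
    simp [writeCell, hx]
  | rset r i j e s =>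
    refine ⟨fun _ _ => rfl, fun x hx => ?_⟩
    funext i' j'
    simp only [Prog.WritesReal] at hx
    simp [writeCell, hx]
  | seq _ _ ih₁ ih₂ =>
    exact ⟨fun r hr => (ih₂.1 r fun h => hr (Or.inr h)).trans (ih₁.1 r fun h => hr (Or.inl h)),
      fun r hr => (ih₂.2 r fun h => hr (Or.inr h)).trans (ih₁.2 r fun h => hr (Or.inl h))⟩
  | cond_true _ _ ih =>
    exact ⟨fun r hr => ih.1 r fun h => hr (Or.inl h), fun r hr => ih.2 r fun h => hr (Or.inl h)⟩
  | cond_false _ _ ih =>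
    exact ⟨fun r hr => ih.1 r fun h => hr (Or.inr h), fun r hr => ih.2 r fun h => hr (Or.inr h)⟩
  | loop_true _ _ _ ih₁ ih₂ =>
    exact ⟨fun r hr => (ih₂.1 r hr).trans (ih₁.1 r hr), fun r hr => (ih₂.2 r hr).trans (ih₁.2 r hr)⟩
  | loop_false => exact ⟨fun _ _ => rfl, fun _ _ => rfl⟩

/-- Started in `s`, the program `p` halts within `n` steps in a state with property `Q`. -/
def Terminates (O : Oracle) (s : Store) (p : Prog) (n : ℕ) (Q : Store → Prop) : Prop :=
  ∃ m s', m ≤ n ∧ Exec O p s m s' ∧ Q s'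

namespace Terminates

variable {O : Oracle} {s : Store} {p q : Prog} {m n : ℕ} {Q R : Store → Prop}

theorem mono (h : Terminates O s p m Q) (hmn : m ≤ n) (hQR : ∀ s', Q s' → Frame p s s' → R s') :
    Terminates O s p n R := by
  obtain ⟨k, s', hk, he, hq⟩ := h
  exact ⟨k, s', hk.trans hmn, he, hQR s' hq he.frame⟩

theorem seq (hp : Terminates O s p m Q)
    (hq : ∀ s', Q s' → Frame p s s' → Terminates O s' q n R) :
    Terminates O s (p.seq q) (m + n) R := by
  obtain ⟨k, s', hk, he, hQ⟩ := hp
  obtain ⟨l, s'', hl, he', hR⟩ := hq s' hQ he.frame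
  exact ⟨k + l, s'', Nat.add_le_add hk hl, he.seq he', hR⟩

theorem of_run (hp : p.LoopFree) (h : Q (p.run O s)) : Terminates O s p p.size Q := by
  obtain ⟨k, hk, he⟩ := p.exec_run O hp s
  exact ⟨k, _, hk, he, h⟩

end Terminates

/-- The integer variable stored in the first cell of array `r`. -/
def ivar (r : ℕ) : IExpr := .cell r (.const 0) (.const 0)

/-- Assignment to an integer variable. -/
def setVar (r : ℕ) (e : IExpr) : Prog := .iset r (.const 0) (.const 0) e

/-- The memory state with the integer variable `r` set to `z`. -/
def Store.setInt (s : Store) (r : ℕ) (z : ℤ) : Store :=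
  { s with ints := writeCell s.ints r 0 0 z }

theorem eval_ivar (s : Store) (r : ℕ) : (ivar r).eval s = s.ints r 0 0 := rfl

theorem run_setVar (O : Oracle) (s : Store) (r : ℕ) (e : IExpr) :
    (setVar r e).run O s = s.setInt r (e.eval s) := rfl

theorem Store.setInt_ints (s : Store) (r : ℕ) (z : ℤ) (x : ℕ) (i j : ℤ) :
    (s.setInt r z).ints x i j = if x = r ∧ i = 0 ∧ j = 0 then z else s.ints x i j := rfl

theorem Store.setInt_self (s : Store) (r : ℕ) (z : ℤ) : (s.setInt r z).ints r 0 0 = z := by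
  simp [Store.setInt_ints]

theorem Store.setInt_ne (s : Store) {r x : ℕ} (z : ℤ) (h : x ≠ r) :
    (s.setInt r z).ints x = s.ints x := by
  funext i j
  simp [Store.setInt_ints, h]

theorem Store.setInt_reals (s : Store) (r : ℕ) (z : ℤ) : (s.setInt r z).reals = s.reals := rfl

/-- The loop that runs `p` with the variable `r` equal to `0, 1, …` as long as it is below `B`. -/
def forLoop (r : ℕ) (B : IExpr) (p : Prog) : Prog :=
  .seq (setVar r (.const 0))
    (.loop (.neg (.ile B (ivar r))) (.seq p (setVar r (.add (ivar r) (.const 1)))))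

theorem writesInt_forLoop {r x : ℕ} {B : IExpr} {p : Prog} :
    (forLoop r B p).WritesInt x ↔ x = r ∨ p.WritesInt x := by
  simp only [forLoop, Prog.WritesInt, setVar]; tauto

/-- A loop rule with invariant. The body must not write the counter, and the bound must keep its
value `N` under all writes of the loop. The invariant after a round refers to the state with the
counter already increased. The constant `20` covers the test, the branching, the increment and the
initial assignment. -/
theorem Terminates.forLoop {O : Oracle} {s₀ : Store} {r : ℕ} {B : IExpr} {p : Prog} {N n : ℕ}
    (Inv : ℕ → Store → Prop) (hr : ¬ p.WritesInt r)
    (hB : ∀ s, Frame (forLoop r B p) s₀ s → B.eval s = N)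
    (h₀ : Inv 0 (s₀.setInt r 0))
    (hp : ∀ k < N, ∀ s : Store, s.ints r 0 0 = k → Frame (GridFlow.forLoop r B p) s₀ s → Inv k s →
      Terminates O s p n (fun s' => Inv (k + 1) (s'.setInt r (k + 1)))) :
    Terminates O s₀ (GridFlow.forLoop r B p) ((n + B.steps + 20) * (N + 1)) (Inv N) := by
  set P : Prog := .loop (.neg (.ile B (ivar r))) (.seq p (setVar r (.add (ivar r) (.const 1))))
    with hP
  have main : ∀ d k, k + d = N → ∀ s : Store, s.ints r 0 0 = k → Frame (GridFlow.forLoop r B p) s₀ s →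
      Inv k s → Terminates O s P ((n + B.steps + 20) * d + (B.steps + 10)) (Inv N) := by
    intro d
    induction d with
    | zero =>
      intro k hk s hs hf hi
      obtain rfl : k = N := hk
      refine ⟨_, s, ?_, Exec.loop_false ?_, hi⟩
      · simp only [Test.steps, ivar, IExpr.steps]; omega
      · simp only [Test.Holds, eval_ivar, hs, hB s hf]; simp
    | succ d ih =>
      intro k hk s hs hf hi
      obtain ⟨m, s₁, hm, he, hq⟩ := hp k (by omega) s hs hf hi
      have hs₁ : s₁.ints r 0 0 = k := by rw [he.frame.1 r hr, hs]
      have hset : Exec O (setVar r (.add (ivar r) (.const 1))) s₁ 8 (s₁.setInt r (k + 1)) := by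
        have := Exec.iset (O := O) r (.const 0) (.const 0) (.add (ivar r) (.const 1)) s₁
        simp only [IExpr.eval, eval_ivar, hs₁] at this
        exact this
      have hf' : Frame (GridFlow.forLoop r B p) s₀ (s₁.setInt r (k + 1)) := by
        refine ⟨fun x hx => ?_, fun x hx => ?_⟩
        · have hx' := hx
          simp only [GridFlow.forLoop, Prog.WritesInt, setVar] at hx'
          rw [Store.setInt_ne _ _ fun h => hx' (Or.inl h),
            he.frame.1 x fun h => hx' (Or.inr (Or.inl h)), hf.1 x hx]
        · have hx' := hx
          simp only [GridFlow.forLoop, Prog.WritesReal, setVar] at hx'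
          rw [Store.setInt_reals, he.frame.2 x fun h => hx' (Or.inr (Or.inl h)), hf.2 x hx]
      obtain ⟨l, s₂, hl, he', hq'⟩ := ih (k + 1) (by omega) (s₁.setInt r (k + 1))
        (by rw [Store.setInt_self]; push_cast; rfl) hf' hq
      refine ⟨_, s₂, ?_, Exec.loop_true ?_ (he.seq hset) he', hq'⟩
      · simp only [Test.steps, ivar, IExpr.steps]
        rw [Nat.mul_succ]
        omega
      · simp only [Test.Holds, eval_ivar, hs, hB s hf]
        omega
  have hset : Exec O (setVar r (.const 0)) s₀ 4 (s₀.setInt r 0) :=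
    Exec.iset (O := O) r (.const 0) (.const 0) (.const 0) s₀
  have hf : Frame (GridFlow.forLoop r B p) s₀ (s₀.setInt r 0) := by
    refine ⟨fun x hx => ?_, fun x hx => rfl⟩
    simp only [GridFlow.forLoop, Prog.WritesInt, setVar] at hx
    rw [Store.setInt_ne _ _ fun h => hx (Or.inl h)]
  obtain ⟨l, s₂, hl, he', hq'⟩ := main N 0 (by omega) (s₀.setInt r 0)
    (by rw [Store.setInt_self]; rfl) hf h₀
  refine ⟨_, s₂, ?_, hset.seq he', hq'⟩
  rw [Nat.mul_succ]
  omega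

/-! ### Generating the candidate vectors

Integer array `12` is a list of vectors of length `L`, whose length is the variable `7`. Variables:
`8` the length of the list before a round, `9` the position of the vector that is extended, `10` a
column and `11` the current prefix sum. -/

/-- Copies the first `m` entries of the vector at position `9` to the end of the list. -/
def copyVector : ℕ → Prog
  | 0 => .skip
  | m + 1 => .seq (copyVector m) (.iset 12 (ivar 7) (.const m) (.cell 12 (ivar 9) (.const m)))

/-- Adds or subtracts, depending on the sign. -/
def signedExpr (σ : Bool) (e₁ e₂ : IExpr) : IExpr := if σ then .add e₁ e₂ else .sub e₁ e₂

def signOf (σ : Bool) : ℤ := if σ then 1 else -1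

theorem eval_signedExpr (s : Store) (σ : Bool) (e₁ e₂ : IExpr) :
    (signedExpr σ e₁ e₂).eval s = e₁.eval s + signOf σ * e₂.eval s := by
  cases σ <;> simp [signedExpr, signOf, IExpr.eval, sub_eq_add_neg]

/-- Appends the vector at position `9`, with the current prefix sum added to its entry `l`. -/
def appendVector (L l i : ℕ) (σ : Bool) : Prog :=
  .seq (copyVector L)
    (.seq (.iset 12 (ivar 7) (.const l) (.add (.cell 12 (ivar 7) (.const l)) (ivar 11)))
      (.seq (setVar 7 (.add (ivar 7) (.const 1)))
        (setVar 11 (signedExpr σ (ivar 11) (.cell 1 (.const i) (ivar 10))))))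

/-- The number of columns, as an expression. -/
def columnCount : IExpr := .cell 0 (.const 0) (.const 1)

def extendVector (L l i : ℕ) (σ : Bool) : Prog :=
  .seq (setVar 11 (.const 0)) (forLoop 10 (.add columnCount (.const 1)) (appendVector L l i σ))

/-- Appends to the list all sums of one of its vectors and `σ` times a prefix sum of row `i` in
entry `l`. -/
def extendList (L l i : ℕ) (σ : Bool) : Prog :=
  .seq (setVar 8 (ivar 7)) (forLoop 9 (ivar 8) (extendVector L l i σ))

theorem writesInt_copyVector {m r : ℕ} (h : (copyVector m).WritesInt r) : r = 12 := by
  induction m with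
  | zero => exact h.elim
  | succ m ih => exact h.elim ih id

theorem loopFree_copyVector (m : ℕ) : (copyVector m).LoopFree := by
  induction m with
  | zero => trivial
  | succ m ih => exact ⟨ih, trivial⟩

theorem writesInt_appendVector {L l i : ℕ} {σ : Bool} {r : ℕ}
    (h : (appendVector L l i σ).WritesInt r) : r = 12 ∨ r = 7 ∨ r = 11 := by
  simp only [appendVector, Prog.WritesInt, setVar] at h
  have := @writesInt_copyVector L r
  tauto

theorem writesInt_extendVector {L l i : ℕ} {σ : Bool} {r : ℕ}
    (h : (extendVector L l i σ).WritesInt r) : r = 12 ∨ r = 7 ∨ r = 11 ∨ r = 10 := by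
  simp only [extendVector, forLoop, Prog.WritesInt, setVar] at h
  have := @writesInt_appendVector L l i σ r
  tauto

theorem writesInt_extendList {L l i : ℕ} {σ : Bool} {r : ℕ}
    (h : (extendList L l i σ).WritesInt r) :
    r = 12 ∨ r = 7 ∨ r = 11 ∨ r = 10 ∨ r = 9 ∨ r = 8 := by
  simp only [extendList, forLoop, Prog.WritesInt, setVar] at h
  have := @writesInt_extendVector L l i σ r
  tauto

/-- Source and target position have to differ, since otherwise an entry would be read after it may
have been overwritten. -/
theorem run_copyVector (O : Oracle) (s : Store) (h : s.ints 9 0 0 ≠ s.ints 7 0 0) (m r : ℕ)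
    (i j : ℤ) : ((copyVector m).run O s).ints r i j =
      if r = 12 ∧ i = s.ints 7 0 0 ∧ 0 ≤ j ∧ j < m then s.ints 12 (s.ints 9 0 0) j
      else s.ints r i j := by
  induction m generalizing r i j with
  | zero =>
    rw [if_neg]
    · rfl
    · simp only [Nat.cast_zero]; omega
  | succ m ih =>
    simp only [copyVector, Prog.run, writeCell, IExpr.eval, eval_ivar, ih]
    simp only [show (7 : ℕ) ≠ 12 by decide, show (9 : ℕ) ≠ 12 by decide, false_and, if_false, h,
      and_false, false_and]
    push_cast
    by_cases hj : j = m
    · subst hj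
      simp
    · have : (j < (m : ℤ) + 1) ↔ j < m := by omega
      simp [hj, this]

/-- In round `z`, variable `11` holds the signed sum of the first `z` supplies. There are `T + 1`
rounds, one for each prefix length from `0` to `T`; the supply added in the last round is off the
grid and is never used. -/
theorem extendVector_spec {L' T : ℕ} (I : MFG L' T) (O : Oracle) (L : ℕ) {l i : ℕ}
    (σ : Bool) {s : Store} {a n : ℕ} (hT : s.ints 0 0 1 = T) (hb : s.ints 1 = I.supplyAt)
    (h₉ : s.ints 9 0 0 = a) (h₇ : s.ints 7 0 0 = n) (ha : a < n) :
    Terminates O s (extendVector L l i σ) (((appendVector L l i σ).size + 40) * (T + 2))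
      (fun s' => s'.ints 7 0 0 = n + (T + 1) ∧
        (∀ k : ℕ, k < n → ∀ j, s'.ints 12 k j = s.ints 12 k j) ∧
        ∀ z ≤ T, ∀ j : ℕ, j < L → s'.ints 12 (n + z) j =
          s.ints 12 a j + if j = l then signOf σ * I.prefixSupply i z else 0) := by
  refine Terminates.mono (Terminates.seq (Terminates.of_run (p := setVar 11 (.const 0))
    (Q := fun s' => s' = s.setInt 11 0) trivial rfl) (n := ((appendVector L l i σ).size +
      (IExpr.add columnCount (.const 1)).steps + 20) * (T + 1 + 1)) (R := fun s' =>
      s'.ints 7 0 0 = n + (T + 1) ∧ (∀ k : ℕ, k < n → ∀ j, s'.ints 12 k j = s.ints 12 k j) ∧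
      ∀ z ≤ T, ∀ j : ℕ, j < L → s'.ints 12 (n + z) j =
        s.ints 12 a j + if j = l then signOf σ * I.prefixSupply i z else 0) ?_) ?_
    (fun s' h _ => h)
  · rintro _ rfl -
    refine (Terminates.forLoop (N := T + 1) (n := (appendVector L l i σ).size) (fun m s' =>
      s'.ints 7 0 0 = n + m ∧ s'.ints 11 0 0 = signOf σ * I.prefixSupply i m ∧
      (∀ k : ℕ, k < n → ∀ j, s'.ints 12 k j = s.ints 12 k j) ∧
      ∀ z < m, ∀ j : ℕ, j < L → s'.ints 12 (n + z) j =
        s.ints 12 a j + if j = l then signOf σ * I.prefixSupply i z else 0) ?_ ?_ ?_ ?_).mono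
      le_rfl ?_
    · intro h
      have := writesInt_appendVector h
      omega
    · intro s' hf
      have h0 := hf.1 0 (by
        intro h
        rcases writesInt_forLoop.mp h with h | h
        · omega
        · have := writesInt_appendVector h
          omega)
      simp only [columnCount, IExpr.eval, h0, Store.setInt_ints, hT]
      simp
    · simp only [Store.setInt_ints, h₇, MFG.prefixSupply]
      simp
    · rintro m hm s' h₁₀ hf ⟨e₇, e₁₁, e₁, e₂⟩
      have w : ∀ r, r ≠ 12 → r ≠ 7 → r ≠ 11 → r ≠ 10 → s'.ints r = s.ints r := by
        intro r r₁ r₂ r₃ r₄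
        rw [hf.1 r, Store.setInt_ne _ _ r₃]
        intro h
        rcases writesInt_forLoop.mp h with h | h
        · omega
        · have := writesInt_appendVector h
          omega
      have e₉ : s'.ints 9 0 0 = a := by rw [w 9 (by decide) (by decide) (by decide) (by decide), h₉]
      have hne : s'.ints 9 0 0 ≠ s'.ints 7 0 0 := by rw [e₉, e₇]; omega
      have hsup : s'.ints 1 = I.supplyAt := by
        rw [w 1 (by decide) (by decide) (by decide) (by decide), hb]
      refine Terminates.of_run ⟨loopFree_copyVector L, trivial, trivial, trivial⟩ ?_
      simp only [appendVector, Prog.run, run_setVar, Store.setInt_ints, writeCell, IExpr.eval,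
        eval_ivar, eval_signedExpr, run_copyVector O s' hne, e₇, e₉, e₁₁, h₁₀, hsup]
      simp only [show (7 : ℕ) ≠ 12 by decide, show (11 : ℕ) ≠ 12 by decide,
        show (11 : ℕ) ≠ 7 by decide, show (12 : ℕ) ≠ 7 by decide, show (12 : ℕ) ≠ 11 by decide,
        show (12 : ℕ) ≠ 10 by decide, show (11 : ℕ) ≠ 10 by decide, show (7 : ℕ) ≠ 10 by decide,
        show (7 : ℕ) ≠ 11 by decide, show (1 : ℕ) ≠ 12 by decide,
        show (1 : ℕ) ≠ 7 by decide, show (10 : ℕ) ≠ 12 by decide, show (10 : ℕ) ≠ 7 by decide,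
        false_and, if_false, true_and, and_self, if_true]
      refine ⟨by push_cast; ring, ?_, ?_, ?_⟩
      · simp only [MFG.prefixSupply, Finset.sum_range_succ]; ring
      · intro k hk j
        have : (k : ℤ) ≠ n + m := by omega
        simp only [this, false_and, if_false]
        exact e₁ k hk j
      · intro z hz j hj
        rcases Nat.lt_succ_iff_lt_or_eq.mp hz with hz | rfl
        · have : (n : ℤ) + z ≠ n + m := by omega
          simp only [this, false_and, if_false]
          exact e₂ z hz j hj
        · have hjL : 0 ≤ (j : ℤ) ∧ (j : ℤ) < L := by omega
          have ea := e₁ a ha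
          by_cases hjl : j = l
          · subst hjl
            simp [hjL, ea]
          · have : (j : ℤ) ≠ l := by omega
            simp [hjL, ea, hjl, this]
    · rintro s' ⟨e₇, -, e₁, e₂⟩ -
      exact ⟨by rw [e₇]; push_cast; ring, e₁, fun z hz => e₂ z (by omega)⟩
  · simp only [columnCount, IExpr.steps, setVar, Prog.size]
    nlinarith

/-- The vector `f` is in the list. -/
def Listed (L : ℕ) (s : Store) (f : ℕ → ℤ) : Prop :=
  ∃ k : ℕ, (k : ℤ) < s.ints 7 0 0 ∧ ∀ j < L, s.ints 12 k j = f j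

/-- `f` with `x` added to entry `l`. -/
def addAt (f : ℕ → ℤ) (l : ℕ) (x : ℤ) : ℕ → ℤ := fun j => f j + if j = l then x else 0

/-- Variable `8` freezes the old length, so that new vectors are not extended again. The `n` old
vectors stay and each gives `T + 1` new ones, whence the length `n * (T + 2)`. -/
theorem extendList_spec {L' T : ℕ} (I : MFG L' T) (O : Oracle) (L : ℕ) {l i : ℕ}
    (σ : Bool) {s : Store} {n : ℕ} (hT : s.ints 0 0 1 = T) (hb : s.ints 1 = I.supplyAt)
    (h₇ : s.ints 7 0 0 = n) :
    Terminates O s (extendList L l i σ)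
      ((((appendVector L l i σ).size + 40) * (T + 2) + 40) * (n + 1))
      (fun s' => s'.ints 7 0 0 = n * (T + 2) ∧
        (∀ k : ℕ, k < n → ∀ j, s'.ints 12 k j = s.ints 12 k j) ∧
        ∀ f, Listed L s f → ∀ z ≤ T, Listed L s' (addAt f l (signOf σ * I.prefixSupply i z))) := by
  set c := ((appendVector L l i σ).size + 40) * (T + 2) with hc
  refine Terminates.mono (Terminates.seq (Terminates.of_run (p := setVar 8 (ivar 7))
    (Q := fun s' => s' = s.setInt 8 n) trivial (by rw [run_setVar, eval_ivar, h₇]))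
    (n := (c + (ivar 8).steps + 20) * (n + 1)) (R := fun s' =>
      s'.ints 7 0 0 = n * (T + 2) ∧
        (∀ k : ℕ, k < n → ∀ j, s'.ints 12 k j = s.ints 12 k j) ∧
        ∀ f, Listed L s f → ∀ z ≤ T,
          Listed L s' (addAt f l (signOf σ * I.prefixSupply i z))) ?_) ?_ (fun s' h _ => h)
  · rintro _ rfl -
    refine (Terminates.forLoop (N := n) (n := c) (fun m s' =>
      s'.ints 7 0 0 = n + m * (T + 1) ∧
      (∀ k : ℕ, k < n → ∀ j, s'.ints 12 k j = s.ints 12 k j) ∧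
      ∀ a < m, ∀ z ≤ T, Listed L s'
        (addAt (fun j => s.ints 12 a j) l (signOf σ * I.prefixSupply i z))) ?_ ?_ ?_ ?_).mono
      le_rfl ?_
    · intro h
      have := writesInt_extendVector h
      omega
    · intro s' hf
      have h := hf.1 8 (by
        intro h
        rcases writesInt_forLoop.mp h with h | h
        · omega
        · have := writesInt_extendVector h
          omega)
      simp [eval_ivar, h, Store.setInt_ints]
    · simp only [Store.setInt_ints, h₇]
      simp
    · rintro m hm s' h₉ hf ⟨e₇, e₁, e₂⟩
      have w : ∀ r, r ≠ 12 → r ≠ 7 → r ≠ 11 → r ≠ 10 → r ≠ 9 → r ≠ 8 → s'.ints r = s.ints r := by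
        intro r r₁ r₂ r₃ r₄ r₅ r₆
        rw [hf.1 r, Store.setInt_ne _ _ r₆]
        intro h
        rcases writesInt_forLoop.mp h with h | h
        · omega
        · have := writesInt_extendVector h
          omega
      have e₇' : s'.ints 7 0 0 = (n + m * (T + 1) : ℕ) := by rw [e₇]; push_cast; rfl
      refine (extendVector_spec I O L σ (l := l) (i := i) (a := m)
        (by rw [w 0 (by decide) (by decide) (by decide) (by decide) (by decide) (by decide), hT])
        (by rw [w 1 (by decide) (by decide) (by decide) (by decide) (by decide) (by decide), hb])
        h₉ e₇' (by nlinarith)).mono le_rfl ?_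
      rintro s'' ⟨k₇, k₁, k₂⟩ -
      have n₇ : (s''.setInt 9 (m + 1)).ints 7 = s''.ints 7 := Store.setInt_ne _ _ (by decide)
      have n₁₂ : (s''.setInt 9 (m + 1)).ints 12 = s''.ints 12 := Store.setInt_ne _ _ (by decide)
      simp only [Listed, n₇, n₁₂]
      refine ⟨by rw [k₇]; push_cast; ring, ?_, ?_⟩
      · intro k hk j
        rw [k₁ k (by nlinarith), e₁ k hk]
      · intro a ha z hz
        rcases Nat.lt_succ_iff_lt_or_eq.mp ha with ha | rfl
        · obtain ⟨k, h₁, h₂⟩ := e₂ a ha z hz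
          rw [e₇'] at h₁
          refine ⟨k, by rw [k₇]; omega, fun j hj => ?_⟩
          rw [k₁ k (by exact_mod_cast h₁), h₂ j hj]
        · refine ⟨n + a * (T + 1) + z, by rw [k₇]; push_cast; omega, fun j hj => ?_⟩
          have := k₂ z hz j hj
          rw [e₁ a hm] at this
          push_cast at this ⊢
          rw [this, addAt]
    · rintro s' ⟨e₇, e₁, e₂⟩ -
      refine ⟨by rw [e₇]; ring, e₁, ?_⟩
      rintro f ⟨k, hk, hkf⟩ z hz
      rw [h₇] at hk
      obtain ⟨k', h₁, h₂⟩ := e₂ k (by exact_mod_cast hk) z hz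
      refine ⟨k', h₁, fun j hj => ?_⟩
      rw [h₂ j hj, addAt, addAt, hkf j hj]
  · simp only [ivar, IExpr.steps, setVar, Prog.size]
    nlinarith

/-- Bounded by a polynomial. -/
def PolyBounded (f : ℕ → ℕ) : Prop := ∃ q : Polynomial ℕ, ∀ T, f T ≤ q.eval T

namespace PolyBounded

variable {f g : ℕ → ℕ}

theorem const (c : ℕ) : PolyBounded fun _ => c := ⟨.C c, fun T => by simp⟩

theorem id : PolyBounded fun T => T := ⟨.X, fun T => by simp⟩

theorem add (hf : PolyBounded f) (hg : PolyBounded g) : PolyBounded fun T => f T + g T := by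
  obtain ⟨p, hp⟩ := hf
  obtain ⟨q, hq⟩ := hg
  exact ⟨p + q, fun T => by rw [Polynomial.eval_add]; exact Nat.add_le_add (hp T) (hq T)⟩

theorem mul (hf : PolyBounded f) (hg : PolyBounded g) : PolyBounded fun T => f T * g T := by
  obtain ⟨p, hp⟩ := hf
  obtain ⟨q, hq⟩ := hg
  exact ⟨p * q, fun T => by rw [Polynomial.eval_mul]; exact Nat.mul_le_mul (hp T) (hq T)⟩

theorem pow (hf : PolyBounded f) (n : ℕ) : PolyBounded fun T => f T ^ n := by
  induction n with
  | zero => simpa using const 1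
  | succ n ih => simpa only [pow_succ] using ih.mul hf

end PolyBounded

/-- Runs `extendList` for a list of rounds `(l, i, σ)`. -/
def extendAll (L : ℕ) : List (ℕ × ℕ × Bool) → Prog
  | [] => .skip
  | (l, i, σ) :: ρ => .seq (extendList L l i σ) (extendAll L ρ)

/-- A bound for the running time of `extendAll` on a list of `n` vectors. -/
def extendAllTime (L T : ℕ) : List (ℕ × ℕ × Bool) → ℕ → ℕ
  | [], _ => 1
  | (l, i, σ) :: ρ, n => (((appendVector L l i σ).size + 40) * (T + 2) + 40) * (n + 1) +
      extendAllTime L T ρ (n * (T + 2))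

/-- The list of rounds does not depend on `T`, and each round multiplies the length of the list by
`T + 2` only, so lengths and times remain polynomial. -/
theorem polyBounded_extendAllTime (L : ℕ) (ρ : List (ℕ × ℕ × Bool)) {n : ℕ → ℕ}
    (hn : PolyBounded n) : PolyBounded fun T => extendAllTime L T ρ (n T) := by
  induction ρ generalizing n with
  | nil => exact .const 1
  | cons r ρ ih =>
    obtain ⟨l, i, σ⟩ := r
    have h₂ := PolyBounded.id.add (.const 2)
    exact ((((PolyBounded.const _).mul h₂).add (.const 40)).mul (hn.add (.const 1))).add
      (ih (hn.mul h₂))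

theorem writesInt_extendAll {L : ℕ} {ρ : List (ℕ × ℕ × Bool)} {r : ℕ}
    (h : (extendAll L ρ).WritesInt r) : r = 12 ∨ r = 7 ∨ r = 11 ∨ r = 10 ∨ r = 9 ∨ r = 8 := by
  induction ρ with
  | nil => exact h.elim
  | cons x ρ ih =>
    obtain ⟨l, i, σ⟩ := x
    exact h.elim writesInt_extendList ih

/-- The vector `g` results from `f` by the given rounds. -/
def Generates {L' T : ℕ} (I : MFG L' T) : List (ℕ × ℕ × Bool) → (ℕ → ℤ) → (ℕ → ℤ) → Prop
  | [], f, g => f = g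
  | (l, i, σ) :: ρ, f, g =>
      ∃ z ≤ T, Generates I ρ (addAt f l (signOf σ * I.prefixSupply i z)) g

theorem Generates.append {L' T : ℕ} {I : MFG L' T} {ρ ρ' : List (ℕ × ℕ × Bool)}
    {f g h : ℕ → ℤ} (h₁ : Generates I ρ f g) (h₂ : Generates I ρ' g h) :
    Generates I (ρ ++ ρ') f h := by
  induction ρ generalizing f with
  | nil => obtain rfl : f = g := h₁; exact h₂
  | cons x ρ ih =>
    obtain ⟨l, i, σ⟩ := x
    obtain ⟨z, hz, h₁⟩ := h₁
    exact ⟨z, hz, ih h₁⟩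

/-- That old positions are preserved matters beyond the induction: the zero vector has to remain at
position `0`, where the dynamic program starts. -/
theorem extendAll_spec {L' T : ℕ} (I : MFG L' T) (O : Oracle) (L : ℕ)
    (ρ : List (ℕ × ℕ × Bool)) {s : Store} {n : ℕ} (hT : s.ints 0 0 1 = T)
    (hb : s.ints 1 = I.supplyAt) (h₇ : s.ints 7 0 0 = n) :
    Terminates O s (extendAll L ρ) (extendAllTime L T ρ n) (fun s' =>
      s'.ints 7 0 0 = n * (T + 2) ^ ρ.length ∧
      (∀ k : ℕ, k < n → ∀ j, s'.ints 12 k j = s.ints 12 k j) ∧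
      ∀ f g, Listed L s f → Generates I ρ f g → Listed L s' g) := by
  induction ρ generalizing s n with
  | nil =>
    refine Terminates.of_run (p := .skip) trivial ⟨by simp [Prog.run, h₇], fun _ _ _ => rfl, ?_⟩
    rintro f _ hf rfl
    exact hf
  | cons x ρ ih =>
    obtain ⟨l, i, σ⟩ := x
    refine (extendList_spec I O L σ hT hb h₇).seq ?_
    rintro s₁ ⟨e₇, e₁, e₂⟩ hf
    have w : ∀ r < 2, s₁.ints r = s.ints r := fun r hr => hf.1 r fun h => by
      have := writesInt_extendList h
      omega
    refine (ih (n := n * (T + 2)) (by rw [w 0 (by decide), hT]) (by rw [w 1 (by decide), hb])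
      (by rw [e₇]; push_cast; rfl)).mono le_rfl ?_
    rintro s₂ ⟨k₇, k₁, k₂⟩ -
    refine ⟨by rw [k₇, List.length_cons]; push_cast; ring, fun k hk j => ?_, ?_⟩
    · rw [k₁ k (by nlinarith), e₁ k hk]
    · rintro f g hf ⟨z, hz, hg⟩
      exact k₂ _ _ (e₂ f hf z hz) hg

/-- The rounds that add the row values of row `i` to entry `l`. -/
def rowRounds (l i : ℕ) : List (ℕ × ℕ × Bool) :=
  [(l, i, true), (l, i, false), (l, i, true), (l, i, false), (l, i, true), (l, i, false)]

/-- The rounds that generate all candidate vectors. -/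
def candidateRounds (L : ℕ) : List (ℕ × ℕ × Bool) :=
  (List.range L).flatMap fun l => (List.range L).flatMap (rowRounds l)

theorem addAt_addAt (f : ℕ → ℤ) (l : ℕ) (x y : ℤ) :
    addAt (addAt f l x) l y = addAt f l (x + y) := by
  funext j
  simp only [addAt]
  split_ifs <;> ring

theorem generates_rowRounds {L T : ℕ} {I : MFG L T} {i : ℕ} {d : ℤ} (hd : d ∈ I.rowValues i)
    (f : ℕ → ℤ) (l : ℕ) : Generates I (rowRounds l i) f (addAt f l d) := by
  obtain ⟨z, hz, rfl⟩ := hd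
  refine ⟨z 0, hz 0, z 1, hz 1, z 2, hz 2, z 3, hz 3, z 4, hz 4, z 5, hz 5, ?_⟩
  simp only [Generates, addAt_addAt, signOf]
  congr 1
  simp
  ring

theorem generates_flatMap_rowRounds {L T : ℕ} {I : MFG L T} {d : ℕ → ℤ} (n : ℕ)
    (hd : ∀ i < n, d i ∈ I.rowValues i) (f : ℕ → ℤ) (l : ℕ) :
    Generates I ((List.range n).flatMap (rowRounds l)) f
      (addAt f l (∑ i ∈ Finset.range n, d i)) := by
  induction n with
  | zero =>
    funext j
    simp [addAt]
  | succ n ih =>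
    rw [List.range_succ, List.flatMap_append, Finset.sum_range_succ, ← addAt_addAt]
    refine (ih fun i hi => hd i (by omega)).append ?_
    simpa using generates_rowRounds (hd n (by omega)) _ l

/-- The entries are filled one after the other, beginning with the zero vector; those not yet
treated are `0`. -/
theorem generates_candidateRounds {L T : ℕ} {I : MFG L T} {f : ℕ → ℤ} (n : ℕ)
    (hf : ∀ l < n, f l ∈ I.flowValues) :
    Generates I ((List.range n).flatMap fun l => (List.range L).flatMap (rowRounds l)) (fun _ => 0)
      (fun l => if l < n then f l else 0) := by
  induction n with
  | zero => simp [Generates]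
  | succ n ih =>
    rw [List.range_succ, List.flatMap_append]
    refine (ih fun i hi => hf i (by omega)).append ?_
    obtain ⟨d, hd, hfd⟩ := hf n (by omega)
    have h := generates_flatMap_rowRounds L hd (fun l => if l < n then f l else 0) n
    rw [← hfd] at h
    simp only [List.flatMap_cons, List.flatMap_nil, List.append_nil]
    convert h using 1
    funext l
    simp only [addAt]
    rcases lt_trichotomy l n with h | rfl | h
    · simp [h, h.ne, h.trans (Nat.lt_succ_self n)]
    · simp
    · simp [h.ne', not_lt.mpr h.le, show ¬ l < n + 1 by omega]

/-- Generates the list of all candidate vectors. -/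
def generate (L : ℕ) : Prog := .seq (setVar 7 (.const 1)) (extendAll L (candidateRounds L))

/-- The number of vectors generated. -/
def vectorCount (L T : ℕ) : ℕ := (T + 2) ^ (candidateRounds L).length

theorem polyBounded_vectorCount (L : ℕ) : PolyBounded (vectorCount L) :=
  (PolyBounded.id.add (.const 2)).pow _

theorem vectorCount_pos (L T : ℕ) : 0 < vectorCount L T := by
  unfold vectorCount; positivity

/-- Memory is initially `0`, so setting the length to `1` already makes the list consist of the zero
vector. -/
theorem generate_spec {L T : ℕ} (I : MFG L T) (O : Oracle) :
    Terminates O I.input (generate L) (4 + extendAllTime L T (candidateRounds L) 1) (fun s =>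
      s.ints 0 0 1 = T ∧ s.ints 1 = I.supplyAt ∧ s.ints 7 0 0 = vectorCount L T ∧
      (∀ j, s.ints 12 0 j = 0) ∧
      ∀ f : ℕ → ℤ, (∀ l < L, f l ∈ I.flowValues) →
        ∃ k < vectorCount L T, ∀ l < L, s.ints 12 k l = f l) := by
  refine Terminates.seq (Terminates.of_run (p := setVar 7 (.const 1))
    (Q := fun s' => s' = I.input.setInt 7 1) trivial rfl) ?_
  rintro _ rfl -
  have i₀ : (I.input.setInt 7 1).ints 0 0 1 = T := by
    rw [Store.setInt_ne _ _ (by decide)]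
    simp [MFG.input]
  have i₁ : (I.input.setInt 7 1).ints 1 = I.supplyAt := by
    rw [Store.setInt_ne _ _ (by decide)]
    rfl
  refine (extendAll_spec I O L (candidateRounds L) (n := 1) i₀ i₁
    (by simp [Store.setInt_self])).mono le_rfl ?_
  rintro s ⟨e₇, e₁, e₂⟩ hf
  have w : ∀ r < 2, s.ints r = (I.input.setInt 7 1).ints r := fun r hr => hf.1 r fun h => by
    have := writesInt_extendAll h
    omega
  have k₇ : s.ints 7 0 0 = vectorCount L T := by rw [e₇, vectorCount]; push_cast; ring
  refine ⟨by rw [w 0 (by decide), i₀], by rw [w 1 (by decide), i₁], k₇, ?_, ?_⟩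
  · intro j
    have := e₁ 0 (by decide) j
    rw [Nat.cast_zero, Store.setInt_ne _ _ (by decide)] at this
    rw [this]; rfl
  · intro f hf
    obtain ⟨k, h₁, h₂⟩ := e₂ (fun _ => 0) _ ⟨0, by simp [Store.setInt_self], fun j _ => by
      rw [Store.setInt_ne _ _ (by decide)]; rfl⟩ (generates_candidateRounds L hf)
    rw [k₇] at h₁
    refine ⟨k, by exact_mod_cast h₁, fun l hl => ?_⟩
    rw [h₂ l hl]
    exact if_pos hl

/-! ### The dynamic program

Position `j` of the list of vectors stands for the flows entering a column. With `k` columns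
remaining, integer arrays `18` and `19` hold at `(k, j)` whether these columns can be completed, and
the best position for the next column; real array `0` holds the least cost. Variables: `13` the
number `k`, `14` and `15` positions, `16` a flow down, `17` a flag, `21` a column. -/

def eqTest (e₁ e₂ : IExpr) : Test := .conj (.ile e₁ e₂) (.ile e₂ e₁)

theorem holds_eqTest (O : Oracle) (s : Store) (e₁ e₂ : IExpr) :
    (eqTest e₁ e₂).Holds O s ↔ e₁.eval s = e₂.eval s := by
  simp only [eqTest, Test.Holds]; omega

/-- Decides in variable `17` whether the first `m` entries of the vector at position `14` are
`0`. -/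
def zeroTest : ℕ → Prog
  | 0 => setVar 17 (.const 1)
  | m + 1 => .seq (zeroTest m)
      (.cond (eqTest (.cell 12 (ivar 14) (.const m)) (.const 0)) .skip (setVar 17 (.const 0)))

def initEntry (L : ℕ) : Prog :=
  .seq (zeroTest L) (.seq (.iset 18 (.const 0) (ivar 14) (ivar 17))
    (.rset 0 (.const 0) (ivar 14) .zero))

/-- Computes for the first `m` rows of column `21`, with entering and leaving flows at positions
`14` and `15`, the flow down, its feasibility and the cost. -/
def columnProg : ℕ → Prog
  | 0 => .seq (setVar 16 (.const 0)) (.seq (setVar 17 (.const 1))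
      (.rset 1 (.const 0) (.const 0) .zero))
  | m + 1 => .seq (columnProg m)
      (.seq (setVar 16 (.sub (.add (.add (ivar 16) (.cell 12 (ivar 14) (.const m)))
          (.cell 1 (.const m) (ivar 21))) (.cell 12 (ivar 15) (.const m))))
        (.seq (.cond (.conj (.ile (.const 0) (.cell 12 (ivar 15) (.const m)))
            (.ile (.const 0) (ivar 16))) .skip (setVar 17 (.const 0)))
          (.rset 1 (.const 0) (.const 0) (.add (.cell 1 (.const 0) (.const 0))
            (.add (.query true (.const m) (ivar 21) (ivar 16))
              (.query false (.const m) (ivar 21) (.cell 12 (ivar 15) (.const m))))))))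

def succVar (r : ℕ) : IExpr := .add (ivar r) (.const 1)

/-- The cost of the continuation through position `15`. -/
def newCost : RExpr := .add (.cell 1 (.const 0) (.const 0)) (.cell 0 (ivar 13) (ivar 15))

/-- Position `15` yields a feasible continuation, better than the best one so far. -/
def improves : Test :=
  .conj (.conj (eqTest (ivar 17) (.const 1)) (eqTest (ivar 16) (.const 0)))
    (.neg (.conj (eqTest (.cell 18 (succVar 13) (ivar 14)) (.const 1))
      (.neg (.rle newCost (.cell 0 (succVar 13) (ivar 14))))))

def recordEntry : Prog :=
  .seq (.iset 18 (succVar 13) (ivar 14) (.const 1))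
    (.seq (.iset 19 (succVar 13) (ivar 14) (ivar 15)) (.rset 0 (succVar 13) (ivar 14) newCost))

def relax (L : ℕ) : Prog :=
  .cond (eqTest (.cell 18 (ivar 13) (ivar 15)) (.const 1))
    (.seq (setVar 21 (.sub (.sub columnCount (.const 1)) (ivar 13)))
      (.seq (columnProg L) (.cond improves recordEntry .skip)))
    .skip

def computeEntry (L : ℕ) : Prog :=
  .seq (.iset 18 (succVar 13) (ivar 14) (.const 0)) (forLoop 15 (ivar 7) (relax L))

def computeLayer (L : ℕ) : Prog := forLoop 14 (ivar 7) (computeEntry L)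

def computeTables (L : ℕ) : Prog :=
  .seq (forLoop 14 (ivar 7) (initEntry L)) (forLoop 13 columnCount (computeLayer L))

section Writes

variable {L m r : ℕ}

theorem writesInt_zeroTest (h : (zeroTest m).WritesInt r) : r = 17 := by
  induction m with
  | zero => exact h
  | succ m ih => exact h.elim ih fun h => h.elim False.elim id

theorem loopFree_zeroTest (m : ℕ) : (zeroTest m).LoopFree := by
  induction m with
  | zero => trivial
  | succ m ih => exact ⟨ih, trivial, trivial⟩

theorem writesReal_zeroTest : ¬ (zeroTest m).WritesReal r := by
  induction m with
  | zero => exact id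
  | succ m ih => exact fun h => h.elim ih fun h => h.elim id id

theorem writesInt_columnProg (h : (columnProg m).WritesInt r) : r = 16 ∨ r = 17 := by
  induction m with
  | zero => simp only [columnProg, Prog.WritesInt, setVar] at h; tauto
  | succ m ih => simp only [columnProg, Prog.WritesInt, setVar] at h; tauto

theorem writesReal_columnProg (h : (columnProg m).WritesReal r) : r = 1 := by
  induction m with
  | zero => simp only [columnProg, Prog.WritesReal, setVar] at h; tauto
  | succ m ih => simp only [columnProg, Prog.WritesReal, setVar] at h; tauto

theorem loopFree_columnProg (m : ℕ) : (columnProg m).LoopFree := by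
  induction m with
  | zero => exact ⟨trivial, trivial, trivial⟩
  | succ m ih => exact ⟨ih, trivial, ⟨trivial, trivial⟩, trivial⟩

theorem writesInt_relax (h : (relax L).WritesInt r) :
    r = 16 ∨ r = 17 ∨ r = 18 ∨ r = 19 ∨ r = 21 := by
  simp only [relax, recordEntry, Prog.WritesInt, setVar] at h
  have := @writesInt_columnProg L r
  tauto

theorem writesInt_computeEntry (h : (computeEntry L).WritesInt r) :
    r = 15 ∨ r = 16 ∨ r = 17 ∨ r = 18 ∨ r = 19 ∨ r = 21 := by
  simp only [computeEntry, Prog.WritesInt, writesInt_forLoop] at h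
  have := @writesInt_relax L r
  tauto

theorem writesInt_computeLayer (h : (computeLayer L).WritesInt r) :
    r = 14 ∨ r = 15 ∨ r = 16 ∨ r = 17 ∨ r = 18 ∨ r = 19 ∨ r = 21 := by
  simp only [computeLayer, writesInt_forLoop] at h
  have := @writesInt_computeEntry L r
  tauto

theorem writesInt_initEntry (h : (initEntry L).WritesInt r) : r = 17 ∨ r = 18 := by
  simp only [initEntry, Prog.WritesInt] at h
  have := @writesInt_zeroTest L r
  tauto

theorem writesInt_computeTables (h : (computeTables L).WritesInt r) : 13 ≤ r := by
  simp only [computeTables, Prog.WritesInt, writesInt_forLoop] at h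
  rcases h with (h | h) | h | h
  · omega
  · have := writesInt_initEntry h
    omega
  · omega
  · have := writesInt_computeLayer h
    omega

end Writes

theorem frame_run (O : Oracle) {p : Prog} (hp : p.LoopFree) (s : Store) :
    Frame p s (p.run O s) := by
  obtain ⟨_, _, h⟩ := p.exec_run O hp s
  exact h.frame

open Classical in
theorem run_zeroTest (O : Oracle) (s : Store) (m : ℕ) :
    ((zeroTest m).run O s).ints 17 0 0 =
      if ∀ l < m, s.ints 12 (s.ints 14 0 0) (l : ℕ) = 0 then 1 else 0 := by
  induction m with
  | zero => simp [zeroTest, run_setVar, Store.setInt_self, IExpr.eval]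
  | succ m ih =>
    have hf := (frame_run O (loopFree_zeroTest m) s).1
    have h₁₂ := hf 12 fun h => by have := writesInt_zeroTest h; omega
    have h₁₄ := hf 14 fun h => by have := writesInt_zeroTest h; omega
    simp only [zeroTest, Prog.run, holds_eqTest, IExpr.eval, eval_ivar, h₁₂, h₁₄, run_setVar,
      Nat.forall_lt_succ_right]
    by_cases h : s.ints 12 (s.ints 14 0 0) (m : ℕ) = 0
    · simp only [h, if_true, and_true, ih]
    · simp only [h, if_false, and_false, Store.setInt_self]

-- Variable `17` records nonnegativity of the flows, and variable `16` ends as the flow down from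
-- the last row, which must vanish. Together they decide column feasibility.
open Classical in
theorem run_columnProg (O : Oracle) (s : Store) {t : ℕ} (ht : s.ints 21 0 0 = t) {b : ℤ → ℤ → ℤ}
    (hb : s.ints 1 = b) {f g : ℕ → ℤ} (hf : ∀ l : ℕ, s.ints 12 (s.ints 14 0 0) l = f l)
    (hg : ∀ l : ℕ, s.ints 12 (s.ints 15 0 0) l = g l) (m : ℕ) :
    ((columnProg m).run O s).ints 16 0 0 = columnSum b t f g m ∧
    ((columnProg m).run O s).ints 17 0 0 =
      (if ∀ l < m, 0 ≤ g l ∧ 0 ≤ columnSum b t f g (l + 1) then 1 else 0) ∧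
    ((columnProg m).run O s).reals 1 0 0 = columnCost O m b t f g := by
  induction m with
  | zero =>
    simp [columnProg, Prog.run, run_setVar, Store.setInt_ints, writeCell, IExpr.eval, columnSum,
      columnCost, RExpr.eval]
  | succ m ih =>
    obtain ⟨i₁₆, i₁₇, i₁⟩ := ih
    have hfr := (frame_run O (loopFree_columnProg m) s).1
    have w : ∀ r, r ≠ 16 → r ≠ 17 → ((columnProg m).run O s).ints r = s.ints r :=
      fun r h₁ h₂ => hfr r fun h => by have := writesInt_columnProg h; omega
    have w₁ := w 1 (by decide) (by decide)
    have w₁₂ := w 12 (by decide) (by decide)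
    have w₁₄ := w 14 (by decide) (by decide)
    have w₁₅ := w 15 (by decide) (by decide)
    have w₂₁ := w 21 (by decide) (by decide)
    have hsum : columnSum b t f g m + f m + b m t - g m = columnSum b t f g (m + 1) := by
      rw [columnSum, columnSum, Finset.sum_range_succ]; ring
    set s₁ := (columnProg m).run O s with hs₁
    have e : (IExpr.sub (.add (.add (ivar 16) (.cell 12 (ivar 14) (.const m)))
        (.cell 1 (.const m) (ivar 21))) (.cell 12 (ivar 15) (.const m))).eval s₁ =
        columnSum b t f g (m + 1) := by
      simp only [IExpr.eval, eval_ivar, i₁₆, w₁, w₁₂, w₁₄, w₁₅, w₂₁, hb, ht, hf, hg, hsum]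
    simp only [columnProg, Prog.run, ← hs₁, run_setVar, e]
    set s₂ := s₁.setInt 16 (columnSum b t f g (m + 1)) with hs₂
    have v₁₆ : s₂.ints 16 0 0 = columnSum b t f g (m + 1) := Store.setInt_self _ _ _
    have v : ∀ r, r ≠ 16 → s₂.ints r = s₁.ints r := fun r hr => Store.setInt_ne _ _ hr
    have v₁₂ : (IExpr.cell 12 (ivar 15) (.const m)).eval s₂ = g m := by
      simp only [IExpr.eval, eval_ivar, v 12 (by decide), v 15 (by decide), w₁₂, w₁₅, hg]
    have hholds : (Test.conj (.ile (.const 0) (.cell 12 (ivar 15) (.const m)))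
        (.ile (.const 0) (ivar 16))).Holds O s₂ ↔ 0 ≤ g m ∧ 0 ≤ columnSum b t f g (m + 1) := by
      simp only [Test.Holds, v₁₂, eval_ivar, v₁₆]
      rfl
    rw [hholds]
    obtain ⟨s₃, hs₃⟩ : ∃ s₃, s₃ = @ite _ (0 ≤ g m ∧ 0 ≤ columnSum b t f g (m + 1))
      (Classical.propDecidable _) s₂ (s₂.setInt 17 (IExpr.eval s₂ (.const 0))) := ⟨_, rfl⟩
    rw [← hs₃]
    have u : ∀ r, r ≠ 17 → s₃.ints r = s₂.ints r := by
      intro r hr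
      rw [hs₃]
      split_ifs
      · rfl
      · exact Store.setInt_ne _ _ hr
    have u₀ : s₃.reals = s₁.reals := by
      rw [hs₃]
      split_ifs <;> rfl
    refine ⟨?_, ?_, ?_⟩
    · show s₃.ints 16 0 0 = _
      rw [u 16 (by decide), v₁₆]
    · show s₃.ints 17 0 0 = _
      rw [hs₃]
      simp only [Nat.forall_lt_succ_right]
      by_cases h : 0 ≤ g m ∧ 0 ≤ columnSum b t f g (m + 1)
      · simp only [h, and_self, if_true, and_true]
        rw [v 17 (by decide), i₁₇]
      · simp only [h, if_false, and_false, Store.setInt_self, IExpr.eval]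
    · simp only [writeCell, IExpr.eval, eval_ivar, RExpr.eval, u 21 (by decide),
        u 16 (by decide), u 12 (by decide), u 15 (by decide), v 21 (by decide), v₁₆,
        v 12 (by decide), v 15 (by decide), w₂₁, w₁₂, w₁₅, ht, hg, u₀, i₁]
      rw [columnCost, columnCost, Finset.sum_range_succ]
      simp

/-- The table entry at `(k + 1, j)` is correct with respect to the continuations through the first
`m` positions. -/
def EntrySpec (O : Oracle) (b : ℤ → ℤ → ℤ) (L T : ℕ) (τ : ℕ → ℕ → ℤ) (s : Store)
    (k j m : ℕ) : Prop :=
  (s.ints 18 (k + 1) j = 0 ∨ s.ints 18 (k + 1) j = 1) ∧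
  (s.ints 18 (k + 1) j = 1 → ∃ i < m, s.ints 19 (k + 1) j = i ∧ s.ints 18 k i = 1 ∧
    ColumnFeasible L b (T - 1 - k) (τ j) (τ i) ∧
    s.reals 0 (k + 1) j = columnCost O L b (T - 1 - k) (τ j) (τ i) + s.reals 0 k i) ∧
  ∀ i < m, s.ints 18 k i = 1 → ColumnFeasible L b (T - 1 - k) (τ j) (τ i) →
    s.ints 18 (k + 1) j = 1 ∧
    s.reals 0 (k + 1) j ≤ columnCost O L b (T - 1 - k) (τ j) (τ i) + s.reals 0 k i

/-- The tables of `s` and `s'` agree at `(x, y)`. -/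
def SameEntry (s s' : Store) (x y : ℤ) : Prop :=
  s'.ints 18 x y = s.ints 18 x y ∧ s'.ints 19 x y = s.ints 19 x y ∧ s'.reals 0 x y = s.reals 0 x y

theorem SameEntry.trans {s s' s'' : Store} {x y : ℤ} (h : SameEntry s s' x y)
    (h' : SameEntry s' s'' x y) : SameEntry s s'' x y :=
  ⟨h'.1.trans h.1, h'.2.1.trans h.2.1, h'.2.2.trans h.2.2⟩

section

variable {O : Oracle} {b : ℤ → ℤ → ℤ} {L T : ℕ} {τ : ℕ → ℕ → ℤ} {s s' : Store} {k j m : ℕ}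

theorem EntrySpec.congr (h : EntrySpec O b L T τ s k j m) (h₁ : ∀ i < m, SameEntry s s' k (i : ℕ))
    (h₂ : SameEntry s s' (k + 1) j) : EntrySpec O b L T τ s' k j m := by
  obtain ⟨a₁, a₂, a₃⟩ := h
  refine ⟨by rwa [h₂.1], fun h => ?_, fun i hi => ?_⟩
  · rw [h₂.1] at h
    obtain ⟨i, hi, c₁, c₂, c₃, c₄⟩ := a₂ h
    exact ⟨i, hi, by rw [h₂.2.1, c₁], by rw [(h₁ i hi).1, c₂], c₃,
      by rw [h₂.2.2, (h₁ i hi).2.2, c₄]⟩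
  · rw [h₂.1, h₂.2.2, (h₁ i hi).1, (h₁ i hi).2.2]
    exact a₃ i hi

theorem EntrySpec.succ (h : EntrySpec O b L T τ s k j m)
    (hm : s.ints 18 k m = 1 → ColumnFeasible L b (T - 1 - k) (τ j) (τ m) →
      s.ints 18 (k + 1) j = 1 ∧
      s.reals 0 (k + 1) j ≤ columnCost O L b (T - 1 - k) (τ j) (τ m) + s.reals 0 k m) :
    EntrySpec O b L T τ s k j (m + 1) := by
  obtain ⟨a₁, a₂, a₃⟩ := h
  refine ⟨a₁, fun h => ?_, fun i hi => ?_⟩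
  · obtain ⟨i, hi, c⟩ := a₂ h
    exact ⟨i, by omega, c⟩
  · rcases Nat.lt_succ_iff_lt_or_eq.mp hi with hi | rfl
    · exact a₃ i hi
    · exact hm

/-- The new value is at most the old one, if there was one, and therefore still at most all earlier
candidates. -/
theorem EntrySpec.record (h : EntrySpec O b L T τ s k j m)
    (h₁ : ∀ i ≤ m, SameEntry s s' k (i : ℕ)) (hm : s.ints 18 k m = 1)
    (hf : ColumnFeasible L b (T - 1 - k) (τ j) (τ m))
    (hb : s.ints 18 (k + 1) j = 1 →
      columnCost O L b (T - 1 - k) (τ j) (τ m) + s.reals 0 k m ≤ s.reals 0 (k + 1) j)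
    (e₁ : s'.ints 18 (k + 1) j = 1) (e₂ : s'.ints 19 (k + 1) j = m)
    (e₃ : s'.reals 0 (k + 1) j = columnCost O L b (T - 1 - k) (τ j) (τ m) + s.reals 0 k m) :
    EntrySpec O b L T τ s' k j (m + 1) := by
  refine ⟨Or.inr e₁, fun _ => ⟨m, by omega, e₂, by rw [(h₁ m le_rfl).1, hm], hf,
    by rw [e₃, (h₁ m le_rfl).2.2]⟩, fun i hi h' hf' => ⟨e₁, ?_⟩⟩
  rw [e₃, (h₁ i (by omega)).2.2]
  rcases Nat.lt_succ_iff_lt_or_eq.mp hi with hi | rfl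
  · rw [(h₁ i hi.le).1] at h'
    obtain ⟨c₁, c₂⟩ := h.2.2 i hi h' hf'
    exact (hb c₁).trans c₂
  · exact le_rfl

/-- One candidate `m` is compared with the best so far. Only the entry at `(k + 1, j)` may change,
so the entries at `k` on which it depends stay valid. -/
theorem relax_spec (hT : s.ints 0 0 1 = T) (hb : s.ints 1 = b) (h₁₃ : s.ints 13 0 0 = k)
    (h₁₄ : s.ints 14 0 0 = j) (h₁₅ : s.ints 15 0 0 = m) (hk : k < T)
    (hτ : ∀ i l : ℕ, s.ints 12 i l = τ i l) (h : EntrySpec O b L T τ s k j m) :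
    EntrySpec O b L T τ ((relax L).run O s) k j (m + 1) ∧
      ∀ x y : ℤ, (x ≠ (k : ℤ) + 1 ∨ y ≠ j) → SameEntry s ((relax L).run O s) x y := by
  have hsame : ∀ x y, SameEntry s s x y := fun x y => ⟨rfl, rfl, rfl⟩
  by_cases c₁ : s.ints 18 k m = 1
  swap
  · have hrun : (relax L).run O s = s := by
      simp only [relax, Prog.run, holds_eqTest, IExpr.eval, eval_ivar, h₁₃, h₁₅, c₁, if_false]
    rw [hrun]
    exact ⟨h.succ fun h => absurd h c₁, fun x y _ => hsame x y⟩
  -- With `k` columns remaining after it, the current column is `T - 1 - k`. As `k < T`, the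
  -- truncated difference agrees with the integer that the program computes.
  set t : ℕ := T - 1 - k with ht
  have et : (T : ℤ) - 1 - k = t := by omega
  set s₂ := (columnProg L).run O (s.setInt 21 t) with hs₂
  have hrun : (relax L).run O s = (Prog.cond improves recordEntry .skip).run O s₂ := by
    have c : (eqTest (.cell 18 (ivar 13) (ivar 15)) (.const 1)).Holds O s := by
      rw [holds_eqTest]
      simp only [IExpr.eval, eval_ivar, h₁₃, h₁₅, c₁]
    have e : (setVar 21 (.sub (.sub columnCount (.const 1)) (ivar 13))).run O s =
        s.setInt 21 t := by
      rw [run_setVar]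
      simp only [columnCount, IExpr.eval, eval_ivar, h₁₃, hT, et]
    rw [relax, Prog.run, if_pos c, Prog.run, Prog.run, e]
  have hfr := frame_run O (loopFree_columnProg L) (s.setInt 21 t)
  have w : ∀ r, r ≠ 16 → r ≠ 17 → r ≠ 21 → s₂.ints r = s.ints r := by
    intro r h₁ h₂ h₃
    rw [hs₂, hfr.1 r fun h => by have := writesInt_columnProg h; omega, Store.setInt_ne _ _ h₃]
  have w₀ : s₂.reals 0 = s.reals 0 :=
    hfr.2 0 fun h => by have := writesReal_columnProg h; omega
  have w₁₃ := w 13 (by decide) (by decide) (by decide)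
  have w₁₄ := w 14 (by decide) (by decide) (by decide)
  have w₁₅ := w 15 (by decide) (by decide) (by decide)
  have w₁₈ := w 18 (by decide) (by decide) (by decide)
  have w₁₉ := w 19 (by decide) (by decide) (by decide)
  have same₂ : ∀ x y, SameEntry s s₂ x y := fun x y => ⟨by rw [w₁₈], by rw [w₁₉], by rw [w₀]⟩
  obtain ⟨v₁₆, v₁₇, v₁⟩ := run_columnProg O (s.setInt 21 t) (t := t) (Store.setInt_self _ _ _)
    (b := b) (by rw [Store.setInt_ne _ _ (by decide), hb]) (f := τ j) (g := τ m)
    (fun l => by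
      rw [Store.setInt_ne _ _ (by decide), Store.setInt_ne _ _ (by decide), h₁₄, hτ])
    (fun l => by
      rw [Store.setInt_ne _ _ (by decide), Store.setInt_ne _ _ (by decide), h₁₅, hτ]) L
  rw [← hs₂] at v₁₆ v₁₇ v₁
  have himp : improves.Holds O s₂ ↔ ColumnFeasible L b t (τ j) (τ m) ∧
      ¬ (s.ints 18 (k + 1) j = 1 ∧
        ¬ columnCost O L b t (τ j) (τ m) + s.reals 0 k m ≤ s.reals 0 (k + 1) j) := by
    simp only [improves, Test.Holds, holds_eqTest, succVar, newCost, RExpr.eval, IExpr.eval,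
      eval_ivar, v₁₆, v₁₇, v₁, w₁₃, w₁₄, w₁₅, w₁₈, w₀, h₁₃, h₁₄, h₁₅, ColumnFeasible]
    simp
  rw [hrun, Prog.run]
  by_cases c₂ : improves.Holds O s₂
  · rw [if_pos c₂]
    obtain ⟨hf, hbest⟩ := himp.mp c₂
    have hne : ∀ x y : ℤ, (x ≠ (k : ℤ) + 1 ∨ y ≠ j) → SameEntry s (recordEntry.run O s₂) x y := by
      intro x y hxy
      have hxy' : ¬ (x = (k : ℤ) + 1 ∧ y = j) := by tauto
      refine ⟨?_, ?_, ?_⟩ <;>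
        simp [recordEntry, Prog.run, writeCell, succVar, IExpr.eval, eval_ivar, w₁₃, w₁₄, w₁₅,
          w₁₈, w₁₉, w₀, h₁₃, h₁₄, hxy']
    refine ⟨h.record (fun i _ => hne _ _ (Or.inl (by omega))) c₁ hf (fun h' => ?_) ?_ ?_ ?_, hne⟩
    · by_contra hcon
      exact hbest ⟨h', hcon⟩
    · simp [recordEntry, Prog.run, writeCell, succVar, IExpr.eval, eval_ivar, w₁₃, w₁₄, h₁₃, h₁₄]
    · simp [recordEntry, Prog.run, writeCell, succVar, IExpr.eval, eval_ivar, w₁₃, w₁₄, w₁₅,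
        h₁₃, h₁₄, h₁₅]
    · simp [recordEntry, Prog.run, writeCell, succVar, IExpr.eval, eval_ivar, w₁₃, w₁₄, w₁₅,
        h₁₃, h₁₄, h₁₅, newCost, RExpr.eval, v₁, w₀, ht]
  · rw [if_neg c₂, Prog.run]
    refine ⟨(h.succ fun _ hf => ?_).congr (fun i _ => same₂ _ _) (same₂ _ _),
      fun x y _ => same₂ x y⟩
    rw [himp] at c₂
    by_contra hcon
    refine c₂ ⟨hf, fun h' => hcon ⟨h'.1, ?_⟩⟩
    exact (not_le.mp h'.2).le

theorem loopFree_relax (L : ℕ) : (relax L).LoopFree :=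
  ⟨⟨trivial, loopFree_columnProg L, ⟨⟨trivial, trivial, trivial⟩, trivial⟩⟩, trivial⟩

theorem computeEntry_spec {K : ℕ} (hT : s.ints 0 0 1 = T) (hb : s.ints 1 = b)
    (hK : s.ints 7 0 0 = K) (h₁₃ : s.ints 13 0 0 = k) (h₁₄ : s.ints 14 0 0 = j) (hk : k < T)
    (hτ : ∀ i l : ℕ, s.ints 12 i l = τ i l) :
    Terminates O s (computeEntry L) (((relax L).size + 40) * (K + 2)) (fun s' =>
      EntrySpec O b L T τ s' k j K ∧
      ∀ x y : ℤ, (x ≠ (k : ℤ) + 1 ∨ y ≠ j) → SameEntry s s' x y) := by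
  refine Terminates.mono (Terminates.seq (Terminates.of_run
    (p := .iset 18 (succVar 13) (ivar 14) (.const 0)) (Q := fun s' => s'.ints 18 (k + 1) j = 0 ∧
      ∀ x y : ℤ, (x ≠ (k : ℤ) + 1 ∨ y ≠ j) → SameEntry s s' x y) trivial ?_)
    (n := ((relax L).size + (ivar 7).steps + 20) * (K + 1))
    (R := fun s' => EntrySpec O b L T τ s' k j K ∧
      ∀ x y : ℤ, (x ≠ (k : ℤ) + 1 ∨ y ≠ j) → SameEntry s s' x y) ?_) ?_ (fun s' h _ => h)
  · refine ⟨?_, fun x y hxy => ⟨?_, ?_, rfl⟩⟩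
    · simp [Prog.run, writeCell, succVar, IExpr.eval, eval_ivar, h₁₃, h₁₄]
    · have hxy' : ¬ (x = (k : ℤ) + 1 ∧ y = j) := by tauto
      simp [Prog.run, writeCell, succVar, IExpr.eval, eval_ivar, h₁₃, h₁₄, hxy']
    · simp [Prog.run, writeCell]
  · rintro s₁ ⟨hz, hs₁⟩ hf₁
    have w₁ : ∀ r, r ≠ 18 → s₁.ints r = s.ints r := fun r hr => hf₁.1 r hr
    refine (Terminates.forLoop (N := K) (n := (relax L).size) (fun m s' =>
      EntrySpec O b L T τ s' k j m ∧
      ∀ x y : ℤ, (x ≠ (k : ℤ) + 1 ∨ y ≠ j) → SameEntry s s' x y) ?_ ?_ ?_ ?_).mono le_rfl ?_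
    · intro h
      have := writesInt_relax h
      omega
    · intro s' hf
      have h := hf.1 7 (by
        intro h
        rcases writesInt_forLoop.mp h with h | h
        · omega
        · have := writesInt_relax h
          omega)
      rw [eval_ivar, h, w₁ 7 (by decide), hK]
    · have e : ∀ r, r ≠ 15 → (s₁.setInt 15 0).ints r = s₁.ints r :=
        fun r hr => Store.setInt_ne _ _ hr
      refine ⟨⟨Or.inl ?_, fun h => ?_, fun i hi => absurd hi (Nat.not_lt_zero i)⟩, fun x y hxy => ?_⟩
      · rw [e 18 (by decide), hz]
      · rw [e 18 (by decide), hz] at h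
        exact absurd h (by decide)
      · exact (hs₁ x y hxy).trans ⟨by rw [e 18 (by decide)], by rw [e 19 (by decide)], rfl⟩
    · rintro m hm s' h₁₅ hf ⟨hE, hS⟩
      have w : ∀ r, r ≠ 15 → r ≠ 16 → r ≠ 17 → r ≠ 18 → r ≠ 19 → r ≠ 21 →
          s'.ints r = s.ints r := by
        intro r r₁ r₂ r₃ r₄ r₅ r₆
        rw [hf.1 r, w₁ r r₄]
        intro h
        rcases writesInt_forLoop.mp h with h | h
        · omega
        · have := writesInt_relax h
          omega
      have W : ∀ r, r < 15 → s'.ints r = s.ints r := fun r hr =>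
        w r (by omega) (by omega) (by omega) (by omega) (by omega) (by omega)
      obtain ⟨g₁, g₂⟩ := relax_spec (O := O) (L := L) (by rw [W 0 (by decide), hT])
        (by rw [W 1 (by decide), hb]) (by rw [W 13 (by decide), h₁₃])
        (by rw [W 14 (by decide), h₁₄]) h₁₅ hk (fun i l => by rw [W 12 (by decide), hτ]) hE
      refine Terminates.of_run (loopFree_relax L) ?_
      have e : ∀ r, r ≠ 15 → (((relax L).run O s').setInt 15 (m + 1)).ints r =
        ((relax L).run O s').ints r := fun r hr => Store.setInt_ne _ _ hr
      have hse : ∀ x y, SameEntry ((relax L).run O s') (((relax L).run O s').setInt 15 (m + 1)) x y :=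
        fun x y => ⟨by rw [e 18 (by decide)], by rw [e 19 (by decide)], rfl⟩
      exact ⟨g₁.congr (fun i _ => hse _ _) (hse _ _),
        fun x y hxy => ((hS x y hxy).trans (g₂ x y hxy)).trans (hse x y)⟩
    · rintro s' h -
      exact h
  · simp only [succVar, ivar, IExpr.steps, Prog.size]
    generalize (relax L).size = c
    nlinarith

theorem computeLayer_spec {K : ℕ} (hT : s.ints 0 0 1 = T) (hb : s.ints 1 = b)
    (hK : s.ints 7 0 0 = K) (h₁₃ : s.ints 13 0 0 = k) (hk : k < T)
    (hτ : ∀ i l : ℕ, s.ints 12 i l = τ i l) :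
    Terminates O s (computeLayer L) ((((relax L).size + 40) * (K + 2) + 40) * (K + 1)) (fun s' =>
      (∀ j < K, EntrySpec O b L T τ s' k j K) ∧
      ∀ x y : ℤ, x ≠ (k : ℤ) + 1 → SameEntry s s' x y) := by
  refine (Terminates.forLoop (N := K) (n := ((relax L).size + 40) * (K + 2)) (fun m s' =>
    (∀ j < m, EntrySpec O b L T τ s' k j K) ∧
    ∀ x y : ℤ, x ≠ (k : ℤ) + 1 → SameEntry s s' x y) ?_ ?_ ?_ ?_).mono ?_ ?_
  · intro h
    have := writesInt_computeEntry h
    omega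
  · intro s' hf
    have h := hf.1 7 (by
      intro h
      rcases writesInt_forLoop.mp h with h | h
      · omega
      · have := writesInt_computeEntry h
        omega)
    rw [eval_ivar, h, hK]
  · refine ⟨fun j hj => absurd hj (Nat.not_lt_zero j), fun x y _ => ⟨?_, ?_, rfl⟩⟩ <;>
      rw [Store.setInt_ne _ _ (by decide)]
  · rintro m hm s' h₁₄ hf ⟨hE, hS⟩
    have W : ∀ r, r < 14 → s'.ints r = s.ints r := by
      intro r hr
      rw [hf.1 r]
      intro h
      rcases writesInt_forLoop.mp h with h | h
      · omega
      · have := writesInt_computeEntry h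
        omega
    refine (computeEntry_spec (O := O) (L := L) (τ := τ) (by rw [W 0 (by decide), hT])
      (by rw [W 1 (by decide), hb]) (by rw [W 7 (by decide), hK]) (by rw [W 13 (by decide), h₁₃])
      h₁₄ hk (fun i l => by rw [W 12 (by decide), hτ])).mono le_rfl ?_
    rintro s'' ⟨g₁, g₂⟩ -
    have e : ∀ r, r ≠ 14 → (s''.setInt 14 (m + 1)).ints r = s''.ints r :=
      fun r hr => Store.setInt_ne _ _ hr
    have hse : ∀ x y, SameEntry s'' (s''.setInt 14 (m + 1)) x y :=
      fun x y => ⟨by rw [e 18 (by decide)], by rw [e 19 (by decide)], rfl⟩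
    refine ⟨fun j hj => ?_, fun x y hx => ((hS x y hx).trans (g₂ x y (Or.inl hx))).trans (hse x y)⟩
    rcases Nat.lt_succ_iff_lt_or_eq.mp hj with hj | rfl
    · refine (hE j hj).congr (fun i _ => ?_) ?_
      · exact (g₂ _ _ (Or.inl (by omega))).trans (hse _ _)
      · exact (g₂ _ _ (Or.inr (by omega))).trans (hse _ _)
    · exact g₁.congr (fun i _ => hse _ _) (hse _ _)
  · refine Nat.mul_le_mul_right _ ?_
    simp only [ivar, IExpr.steps]
    omega
  · rintro s' h -
    exact h

/-- The table entries for no remaining columns are correct. -/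
def InitSpec (L : ℕ) (τ : ℕ → ℕ → ℤ) (s : Store) (j : ℕ) : Prop :=
  (s.ints 18 0 j = 0 ∨ s.ints 18 0 j = 1) ∧ (s.ints 18 0 j = 1 ↔ ∀ l < L, τ j l = 0) ∧
    s.reals 0 0 j = 0

theorem InitSpec.congr (h : InitSpec L τ s j) (h' : SameEntry s s' 0 j) : InitSpec L τ s' j := by
  unfold InitSpec
  rw [h'.1, h'.2.2]
  exact h

theorem loopFree_initEntry (L : ℕ) : (initEntry L).LoopFree :=
  ⟨loopFree_zeroTest L, trivial, trivial⟩

theorem run_initEntry (h₁₄ : s.ints 14 0 0 = j) (hτ : ∀ i l : ℕ, s.ints 12 i l = τ i l) :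
    InitSpec L τ ((initEntry L).run O s) j ∧
      ∀ y, y ≠ (j : ℤ) → SameEntry s ((initEntry L).run O s) 0 y := by
  classical
  have hf := frame_run O (loopFree_zeroTest L) s
  have hz := run_zeroTest O s L
  have w : ∀ r, r ≠ 17 → ((zeroTest L).run O s).ints r = s.ints r :=
    fun r hr => hf.1 r fun h => hr (writesInt_zeroTest h)
  have w₀ : ((zeroTest L).run O s).reals 0 = s.reals 0 := hf.2 0 writesReal_zeroTest
  simp only [h₁₄, hτ] at hz
  constructor
  · simp only [InitSpec, initEntry, Prog.run, writeCell, IExpr.eval, eval_ivar, w 14 (by decide),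
      h₁₄, RExpr.eval, hz, and_self, if_true]
    by_cases h : ∀ l < L, τ j l = 0
    · rw [if_pos h]
      exact ⟨Or.inr rfl, iff_of_true rfl h, by simp⟩
    · rw [if_neg h]
      exact ⟨Or.inl rfl, iff_of_false (by decide) h, by simp⟩
  · intro y hy
    refine ⟨?_, ?_, ?_⟩ <;>
      simp [initEntry, Prog.run, writeCell, IExpr.eval, eval_ivar, w, h₁₄, w₀, hy]

theorem computeTables_spec {K : ℕ} (hT : s.ints 0 0 1 = T) (hb : s.ints 1 = b)
    (hK : s.ints 7 0 0 = K) (hτ : ∀ i l : ℕ, s.ints 12 i l = τ i l) :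
    Terminates O s (computeTables L) (((initEntry L).size + 40) * (K + 1) +
      ((((relax L).size + 40) * (K + 2) + 40) * (K + 1) + 40) * (T + 1)) (fun s' =>
      (∀ j < K, InitSpec L τ s' j) ∧ ∀ k < T, ∀ j < K, EntrySpec O b L T τ s' k j K) := by
  refine Terminates.seq (Q := fun s' => ∀ j < K, InitSpec L τ s' j)
    ((Terminates.forLoop (N := K) (n := (initEntry L).size)
      (fun m s' => ∀ j < m, InitSpec L τ s' j) ?_ ?_ ?_ ?_).mono ?_ ?_) ?_
  · intro h
    have := writesInt_initEntry h
    omega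
  · intro s' hf
    have h := hf.1 7 (by
      intro h
      rcases writesInt_forLoop.mp h with h | h
      · omega
      · have := writesInt_initEntry h
        omega)
    rw [eval_ivar, h, hK]
  · exact fun j hj => absurd hj (Nat.not_lt_zero j)
  · rintro m hm s' h₁₄ hf hI
    have W : ∀ r, r < 14 → s'.ints r = s.ints r := by
      intro r hr
      rw [hf.1 r]
      intro h
      rcases writesInt_forLoop.mp h with h | h
      · omega
      · have := writesInt_initEntry h
        omega
    obtain ⟨g₁, g₂⟩ := run_initEntry (O := O) (L := L) h₁₄
      (fun i l => by rw [W 12 (by decide), hτ i l])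
    refine Terminates.of_run (loopFree_initEntry L) ?_
    have e : ∀ r, r ≠ 14 → (((initEntry L).run O s').setInt 14 (m + 1)).ints r =
      ((initEntry L).run O s').ints r := fun r hr => Store.setInt_ne _ _ hr
    have hse : ∀ x y, SameEntry ((initEntry L).run O s')
        (((initEntry L).run O s').setInt 14 (m + 1)) x y :=
      fun x y => ⟨by rw [e 18 (by decide)], by rw [e 19 (by decide)], rfl⟩
    intro j hj
    rcases Nat.lt_succ_iff_lt_or_eq.mp hj with hj | rfl
    · exact (hI j hj).congr ((g₂ j (by omega)).trans (hse _ _))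
    · exact g₁.congr (hse _ _)
  · refine Nat.mul_le_mul_right _ ?_
    simp only [ivar, IExpr.steps]
    omega
  · rintro s' h -
    exact h
  · intro s₁ hI₁ hf₁
    have W₁ : ∀ r, r < 14 → s₁.ints r = s.ints r := by
      intro r hr
      rw [hf₁.1 r]
      intro h
      rcases writesInt_forLoop.mp h with h | h
      · omega
      · have := writesInt_initEntry h
        omega
    refine (Terminates.forLoop (N := T) (n := (((relax L).size + 40) * (K + 2) + 40) * (K + 1))
      (fun m s' => (∀ j < K, InitSpec L τ s' j) ∧
        ∀ k < m, ∀ j < K, EntrySpec O b L T τ s' k j K) ?_ ?_ ?_ ?_).mono ?_ ?_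
    · intro h
      have := writesInt_computeLayer h
      omega
    · intro s' hf
      have h := hf.1 0 (by
        intro h
        rcases writesInt_forLoop.mp h with h | h
        · omega
        · have := writesInt_computeLayer h
          omega)
      simp only [columnCount, IExpr.eval]
      rw [h, W₁ 0 (by decide), hT]
    · refine ⟨fun j hj => (hI₁ j hj).congr ⟨?_, ?_, rfl⟩, fun k hk => absurd hk (Nat.not_lt_zero k)⟩ <;>
        rw [Store.setInt_ne _ _ (by decide)]
    · rintro m hm s' h₁₃ hf ⟨hI, hE⟩
      have W : ∀ r, r < 13 → s'.ints r = s.ints r := by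
        intro r hr
        rw [hf.1 r, W₁ r (by omega)]
        intro h
        rcases writesInt_forLoop.mp h with h | h
        · omega
        · have := writesInt_computeLayer h
          omega
      refine (computeLayer_spec (O := O) (L := L) (τ := τ) (by rw [W 0 (by decide), hT])
        (by rw [W 1 (by decide), hb]) (by rw [W 7 (by decide), hK]) h₁₃ hm
        (fun i l => by rw [W 12 (by decide), hτ])).mono le_rfl ?_
      rintro s'' ⟨g₁, g₂⟩ -
      have e : ∀ r, r ≠ 13 → (s''.setInt 13 (m + 1)).ints r = s''.ints r :=
        fun r hr => Store.setInt_ne _ _ hr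
      have hse : ∀ x y, SameEntry s'' (s''.setInt 13 (m + 1)) x y :=
        fun x y => ⟨by rw [e 18 (by decide)], by rw [e 19 (by decide)], rfl⟩
      -- This layer changes only the table entries with first index `m + 1`; the earlier
      -- specifications refer to first indices at most `m`.
      refine ⟨fun j hj => (hI j hj).congr ((g₂ _ _ (by omega)).trans (hse _ _)),
        fun k hk j hj => ?_⟩
      rcases Nat.lt_succ_iff_lt_or_eq.mp hk with hk | rfl
      · exact (hE k hk j hj).congr (fun i _ => (g₂ _ _ (by omega)).trans (hse _ _))
          ((g₂ _ _ (by omega)).trans (hse _ _))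
      · exact (g₁ j hj).congr (fun i _ => hse _ _) (hse _ _)
    · refine Nat.mul_le_mul_right _ ?_
      simp only [columnCount, IExpr.steps]
      omega
    · rintro s' h -
      exact h

end

/-! ### The output

Integer arrays `5` and `6` receive the flow along the best continuations. Variables: `20` the
position for the entering flows, `15` that for the leaving flows, `16` the flow down, `21` the
column. -/

def emitRows : ℕ → Prog
  | 0 => setVar 16 (.const 0)
  | m + 1 => .seq (emitRows m)
      (.seq (setVar 16 (.sub (.add (.add (ivar 16) (.cell 12 (ivar 20) (.const m)))
          (.cell 1 (.const m) (ivar 21))) (.cell 12 (ivar 15) (.const m))))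
        (.seq (.iset 5 (.const m) (ivar 21) (ivar 16))
          (.iset 6 (.const m) (ivar 21) (.cell 12 (ivar 15) (.const m)))))

def emitColumn (L : ℕ) : Prog :=
  .seq (setVar 15 (.cell 19 (.sub columnCount (ivar 21)) (ivar 20)))
    (.seq (emitRows L) (setVar 20 (ivar 15)))

def emitFlow (L : ℕ) : Prog :=
  .seq (.iset 4 (.const 0) (.const 0) (.cell 18 columnCount (.const 0)))
    (.seq (setVar 20 (.const 0)) (forLoop 21 columnCount (emitColumn L)))

theorem writesInt_emitRows {m r : ℕ} (h : (emitRows m).WritesInt r) : r = 16 ∨ r = 5 ∨ r = 6 := by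
  induction m with
  | zero => exact Or.inl h
  | succ m ih => simp only [emitRows, Prog.WritesInt, setVar] at h; tauto

theorem loopFree_emitRows (m : ℕ) : (emitRows m).LoopFree := by
  induction m with
  | zero => trivial
  | succ m ih => exact ⟨ih, trivial, trivial, trivial⟩

theorem writesInt_emitColumn {L r : ℕ} (h : (emitColumn L).WritesInt r) :
    r = 15 ∨ r = 16 ∨ r = 5 ∨ r = 6 ∨ r = 20 := by
  simp only [emitColumn, Prog.WritesInt, setVar] at h
  have := @writesInt_emitRows L r
  tauto

theorem run_emitRows (O : Oracle) (s : Store) {t : ℕ} (ht : s.ints 21 0 0 = t) {b : ℤ → ℤ → ℤ}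
    (hb : s.ints 1 = b) {f g : ℕ → ℤ} (hf : ∀ l : ℕ, s.ints 12 (s.ints 20 0 0) l = f l)
    (hg : ∀ l : ℕ, s.ints 12 (s.ints 15 0 0) l = g l) (m : ℕ) :
    ((emitRows m).run O s).ints 16 0 0 = columnSum b t f g m ∧
    (∀ l < m, ((emitRows m).run O s).ints 5 l t = columnSum b t f g (l + 1) ∧
      ((emitRows m).run O s).ints 6 l t = g l) ∧
    ∀ x y, y ≠ (t : ℤ) → ((emitRows m).run O s).ints 5 x y = s.ints 5 x y ∧
      ((emitRows m).run O s).ints 6 x y = s.ints 6 x y := by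
  induction m with
  | zero =>
    refine ⟨by simp [emitRows, run_setVar, Store.setInt_self, IExpr.eval, columnSum],
      fun l hl => absurd hl (Nat.not_lt_zero l), fun x y _ => ?_⟩
    simp [emitRows, run_setVar, Store.setInt_ints]
  | succ m ih =>
    obtain ⟨i₁₆, i₅, i₆⟩ := ih
    have hfr := (frame_run O (loopFree_emitRows m) s).1
    have w : ∀ r, r ≠ 16 → r ≠ 5 → r ≠ 6 → ((emitRows m).run O s).ints r = s.ints r :=
      fun r h₁ h₂ h₃ => hfr r fun h => by have := writesInt_emitRows h; omega
    have w₁ := w 1 (by decide) (by decide) (by decide)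
    have w₁₂ := w 12 (by decide) (by decide) (by decide)
    have w₁₅ := w 15 (by decide) (by decide) (by decide)
    have w₂₀ := w 20 (by decide) (by decide) (by decide)
    have w₂₁ := w 21 (by decide) (by decide) (by decide)
    have hsum : columnSum b t f g m + f m + b m t - g m = columnSum b t f g (m + 1) := by
      rw [columnSum, columnSum, Finset.sum_range_succ]; ring
    set s₁ := (emitRows m).run O s with hs₁
    have e : (IExpr.sub (.add (.add (ivar 16) (.cell 12 (ivar 20) (.const m)))
        (.cell 1 (.const m) (ivar 21))) (.cell 12 (ivar 15) (.const m))).eval s₁ =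
        columnSum b t f g (m + 1) := by
      simp only [IExpr.eval, eval_ivar, i₁₆, w₁, w₁₂, w₂₀, w₁₅, w₂₁, hb, ht, hf, hg, hsum]
    simp only [emitRows, Prog.run, ← hs₁, run_setVar, e]
    set s₂ := s₁.setInt 16 (columnSum b t f g (m + 1)) with hs₂
    have v₁₆ : s₂.ints 16 0 0 = columnSum b t f g (m + 1) := Store.setInt_self _ _ _
    have v : ∀ r, r ≠ 16 → s₂.ints r = s₁.ints r := fun r hr => Store.setInt_ne _ _ hr
    refine ⟨by simp [writeCell, v₁₆], fun l hl => ?_, fun x y hy => ?_⟩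
    · rcases Nat.lt_succ_iff_lt_or_eq.mp hl with hl | rfl
      · have : (l : ℤ) ≠ m := by omega
        simp [writeCell, IExpr.eval, v, i₅ l hl, this]
      · simp [writeCell, IExpr.eval, eval_ivar, v, w₂₁, w₁₂, w₁₅, ht, v₁₆, hg]
    · simp [writeCell, IExpr.eval, eval_ivar, v, w₂₁, ht, hy, i₆ x y hy]

/-- The positions along the best continuations. -/
def bestPath (s : Store) (T : ℕ) : ℕ → ℤ
  | 0 => 0
  | t + 1 => s.ints 19 ((T : ℤ) - t) (bestPath s T t)

/-- Nothing enters column `0`, so the path of positions starts at `0`, the zero vector. At column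
`t` there remain `T - t` columns, which is the index for reading array `19`. The loop runs whatever
the flag is; without a feasible flow only the flag matters. -/
theorem emitFlow_spec {O : Oracle} {s : Store} {b : ℤ → ℤ → ℤ} (L : ℕ) {T : ℕ}
    (hT : s.ints 0 0 1 = T) (hb : s.ints 1 = b) :
    Terminates O s (emitFlow L) (20 + ((emitColumn L).size + 40) * (T + 1)) (fun s' =>
      s'.ints 4 0 0 = s.ints 18 T 0 ∧
      ∀ t < T, ∀ l < L,
        s'.ints 5 l t = columnSum b t (fun l => s.ints 12 (bestPath s T t) l)
          (fun l => s.ints 12 (bestPath s T (t + 1)) l) (l + 1) ∧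
        s'.ints 6 l t = s.ints 12 (bestPath s T (t + 1)) l) := by
  refine Terminates.mono (Terminates.seq (Terminates.of_run
    (p := .iset 4 (.const 0) (.const 0) (.cell 18 columnCount (.const 0)))
    (Q := fun s' => s'.ints 4 0 0 = s.ints 18 T 0) trivial ?_)
    (fun s₁ h₁ hf₁ => Terminates.seq (Terminates.of_run (p := setVar 20 (.const 0))
      (Q := fun s' => s' = s₁.setInt 20 0) trivial rfl)
      (n := ((emitColumn L).size + columnCount.steps + 20) * (T + 1)) (R := fun s' =>
      s'.ints 4 0 0 = s.ints 18 T 0 ∧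
      ∀ t < T, ∀ l < L,
        s'.ints 5 l t = columnSum b t (fun l => s.ints 12 (bestPath s T t) l)
          (fun l => s.ints 12 (bestPath s T (t + 1)) l) (l + 1) ∧
        s'.ints 6 l t = s.ints 12 (bestPath s T (t + 1)) l) ?_)) ?_ (fun s' h _ => h)
  · simp [Prog.run, writeCell, IExpr.eval, columnCount, hT]
  · rintro _ rfl -
    have w₁ : ∀ r, r ≠ 4 → s₁.ints r = s.ints r := fun r hr => hf₁.1 r hr
    refine (Terminates.forLoop (N := T) (n := (emitColumn L).size) (fun m s' =>
      s'.ints 20 0 0 = bestPath s T m ∧ ∀ t < m, ∀ l < L,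
        s'.ints 5 l t = columnSum b t (fun l => s.ints 12 (bestPath s T t) l)
          (fun l => s.ints 12 (bestPath s T (t + 1)) l) (l + 1) ∧
        s'.ints 6 l t = s.ints 12 (bestPath s T (t + 1)) l) ?_ ?_ ?_ ?_).mono le_rfl ?_
    · intro h
      have := writesInt_emitColumn h
      omega
    · intro s' hf
      have h := hf.1 0 (by
        intro h
        rcases writesInt_forLoop.mp h with h | h
        · omega
        · have := writesInt_emitColumn h
          omega)
      simp only [columnCount, IExpr.eval]
      rw [h, Store.setInt_ne _ _ (by decide), w₁ 0 (by decide), hT]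
    · refine ⟨?_, fun t ht => absurd ht (Nat.not_lt_zero t)⟩
      rw [Store.setInt_ne _ _ (by decide), Store.setInt_self, bestPath]
    · rintro m hm s' h₂₁ hf ⟨h₂₀, hS⟩
      have w : ∀ r, r ≠ 15 → r ≠ 16 → r ≠ 5 → r ≠ 6 → r ≠ 20 → r ≠ 21 → r ≠ 4 →
          s'.ints r = s.ints r := by
        intro r r₁ r₂ r₃ r₄ r₅ r₆ r₇
        rw [hf.1 r, Store.setInt_ne _ _ r₅, w₁ r r₇]
        intro h
        rcases writesInt_forLoop.mp h with h | h
        · omega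
        · have := writesInt_emitColumn h
          omega
      have e₁₅ : (IExpr.cell 19 (.sub columnCount (ivar 21)) (ivar 20)).eval s' =
          bestPath s T (m + 1) := by
        simp only [IExpr.eval, eval_ivar, columnCount, h₂₁, h₂₀, bestPath,
          w 0 (by decide) (by decide) (by decide) (by decide) (by decide) (by decide) (by decide),
          w 19 (by decide) (by decide) (by decide) (by decide) (by decide) (by decide) (by decide),
          hT]
      refine Terminates.of_run ⟨trivial, loopFree_emitRows L, trivial⟩ ?_
      simp only [emitColumn, Prog.run, run_setVar, e₁₅, eval_ivar]
      have z : ∀ r, r ≠ 15 → (s'.setInt 15 (bestPath s T (m + 1))).ints r = s'.ints r :=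
        fun r hr => Store.setInt_ne _ _ hr
      obtain ⟨-, g₁, g₂⟩ := run_emitRows O (s'.setInt 15 (bestPath s T (m + 1))) (t := m)
        (b := b) (by rw [z 21 (by decide), h₂₁])
        (by rw [z 1 (by decide), w 1 (by decide) (by decide) (by decide) (by decide) (by decide)
          (by decide) (by decide), hb])
        (f := fun l => s.ints 12 (bestPath s T m) l)
        (g := fun l => s.ints 12 (bestPath s T (m + 1)) l)
        (fun l => by
          rw [z 12 (by decide), z 20 (by decide), h₂₀, w 12 (by decide) (by decide) (by decide)
            (by decide) (by decide) (by decide) (by decide)])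
        (fun l => by
          rw [z 12 (by decide), Store.setInt_self, w 12 (by decide) (by decide) (by decide)
            (by decide) (by decide) (by decide) (by decide)]) L
      have hfr := (frame_run O (loopFree_emitRows L) (s'.setInt 15 (bestPath s T (m + 1)))).1
      have h₁₅ : ((emitRows L).run O (s'.setInt 15 (bestPath s T (m + 1)))).ints 15 0 0 =
          bestPath s T (m + 1) := by
        rw [hfr 15 fun h => by have := writesInt_emitRows h; omega, Store.setInt_self]
      refine ⟨?_, fun t ht l hl => ?_⟩
      · rw [Store.setInt_ne _ _ (by decide), Store.setInt_self, h₁₅]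
      · rw [Store.setInt_ne _ _ (by decide), Store.setInt_ne _ _ (by decide),
          Store.setInt_ne _ _ (by decide), Store.setInt_ne _ _ (by decide)]
        rcases Nat.lt_succ_iff_lt_or_eq.mp ht with ht | rfl
        · obtain ⟨q₁, q₂⟩ := g₂ l t (by omega)
          rw [q₁, q₂, z 5 (by decide), z 6 (by decide)]
          exact hS t ht l hl
        · exact g₁ l hl
    · rintro s' ⟨-, h⟩ hf
      refine ⟨?_, h⟩
      rw [hf.1 4, Store.setInt_ne _ _ (by decide), h₁]
      intro h
      rcases writesInt_forLoop.mp h with h | h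
      · omega
      · have := writesInt_emitColumn h
        omega
  · simp only [columnCount, IExpr.steps, setVar, Prog.size]
    generalize (emitColumn L).size = c
    nlinarith

/-! ### Optimality -/

section

variable {O : Oracle} {b : ℤ → ℤ → ℤ} {L T K : ℕ} {τ : ℕ → ℕ → ℤ} {s : Store}

theorem columnSum_congr {t n : ℕ} {f f' g g' : ℕ → ℤ} (hf : ∀ l < n, f l = f' l)
    (hg : ∀ l < n, g l = g' l) : columnSum b t f g n = columnSum b t f' g' n :=
  Finset.sum_congr rfl fun l hl => by
    rw [hf l (Finset.mem_range.mp hl), hg l (Finset.mem_range.mp hl)]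

theorem ColumnFeasible.congr {t : ℕ} {f f' g g' : ℕ → ℤ} (h : ColumnFeasible L b t f g)
    (hf : ∀ l < L, f l = f' l) (hg : ∀ l < L, g l = g' l) : ColumnFeasible L b t f' g' := by
  refine ⟨fun l hl => ?_, ?_⟩
  · rw [← hg l hl, ← columnSum_congr (fun i hi => hf i (by omega)) (fun i hi => hg i (by omega))]
    exact h.1 l hl
  · rw [← columnSum_congr hf hg]
    exact h.2

theorem columnCost_congr {t : ℕ} {f f' g g' : ℕ → ℤ}
    (hf : ∀ l < L, f l = f' l) (hg : ∀ l < L, g l = g' l) :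
    columnCost O L b t f g = columnCost O L b t f' g' := by
  refine Finset.sum_congr rfl fun l hl => ?_
  have hl := Finset.mem_range.mp hl
  rw [hg l hl, columnSum_congr (fun i hi => hf i (by omega)) (fun i hi => hg i (by omega))]

/-- A recorded entry equals the cost of its column plus the entry of its recorded successor. By
telescoping, the cost of the first `t` columns plus the entry for the rest is the same for all `t`.
-/
theorem bestPath_spec (hτ : ∀ i l : ℕ, s.ints 12 i l = τ i l) (hK : 0 < K)
    (hE : ∀ k < T, ∀ j < K, EntrySpec O b L T τ s k j K)
    (h₁ : s.ints 18 T 0 = 1) (t : ℕ) (ht : t ≤ T) :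
    ∃ i < K, bestPath s T t = i ∧ s.ints 18 ((T - t : ℕ) : ℤ) i = 1 ∧
      (∀ u < t, ColumnFeasible L b u (fun l => s.ints 12 (bestPath s T u) l)
        (fun l => s.ints 12 (bestPath s T (u + 1)) l)) ∧
      ∑ u ∈ Finset.range t, columnCost O L b u (fun l => s.ints 12 (bestPath s T u) l)
        (fun l => s.ints 12 (bestPath s T (u + 1)) l) + s.reals 0 ((T - t : ℕ) : ℤ) i =
        s.reals 0 T 0 := by
  induction t with
  | zero => exact ⟨0, hK, rfl, by simpa using h₁, fun u hu => absurd hu (Nat.not_lt_zero u), by simp⟩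
  | succ t ih =>
    obtain ⟨i, hi, hp, hfe, hcf, hsum⟩ := ih (by omega)
    obtain ⟨-, a₂, -⟩ := hE (T - (t + 1)) (by omega) i hi
    rw [show ((T - (t + 1) : ℕ) : ℤ) + 1 = ((T - t : ℕ) : ℤ) by omega,
      show T - 1 - (T - (t + 1)) = t by omega] at a₂
    obtain ⟨j, hj, c₁, c₂, c₃, c₄⟩ := a₂ hfe
    have hp' : bestPath s T (t + 1) = j := by
      rw [bestPath, hp, ← c₁]
      congr 1
      omega
    have e₁ : (fun l : ℕ => s.ints 12 (bestPath s T t) l) = τ i := funext fun l => by rw [hp, hτ]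
    have e₂ : (fun l : ℕ => s.ints 12 (bestPath s T (t + 1)) l) = τ j :=
      funext fun l => by rw [hp', hτ]
    refine ⟨j, hj, hp', c₂, fun u hu => ?_, ?_⟩
    · rcases Nat.lt_succ_iff_lt_or_eq.mp hu with hu | rfl
      · exact hcf u hu
      · rw [e₁, e₂]
        exact c₃
    · rw [Finset.sum_range_succ, e₁, e₂, ← hsum, c₄]
      ring

/-- Backward induction: each entry is at most the cost through any given feasible continuation, in
particular through the next position of the sequence `q`. -/
theorem table_le (hI : ∀ j < K, InitSpec L τ s j)
    (hE : ∀ k < T, ∀ j < K, EntrySpec O b L T τ s k j K) {q : ℕ → ℕ} (hq : ∀ t, q t < K)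
    (hqT : ∀ l < L, τ (q T) l = 0)
    (hqf : ∀ t < T, ColumnFeasible L b t (τ (q t)) (τ (q (t + 1)))) (k : ℕ) (hk : k ≤ T) :
    s.ints 18 k (q (T - k)) = 1 ∧ s.reals 0 k (q (T - k)) ≤
      ∑ t ∈ Finset.Ico (T - k) T, columnCost O L b t (τ (q t)) (τ (q (t + 1))) := by
  induction k with
  | zero =>
    obtain ⟨-, h₁, h₂⟩ := hI (q T) (hq T)
    simp only [Nat.sub_zero, Nat.cast_zero, Finset.Ico_self, Finset.sum_empty]
    exact ⟨h₁.mpr hqT, h₂.le⟩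
  | succ k ih =>
    obtain ⟨h₁, h₂⟩ := ih (by omega)
    obtain ⟨-, -, a₃⟩ := hE k (by omega) (q (T - (k + 1))) (hq _)
    have e : T - k = T - (k + 1) + 1 := by omega
    have e' : T - 1 - k = T - (k + 1) := by omega
    rw [e'] at a₃
    obtain ⟨c₁, c₂⟩ := a₃ (q (T - k)) (hq _) h₁ (by rw [e]; exact hqf _ (by omega))
    push_cast
    refine ⟨c₁, c₂.trans ?_⟩
    rw [Finset.sum_eq_sum_Ico_succ_bot (by omega), ← e]
    linarith

theorem flag_eq (hI : ∀ j < K, InitSpec L τ s j)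
    (hE : ∀ k < T, ∀ j < K, EntrySpec O b L T τ s k j K) (hK : 0 < K) :
    s.ints 18 T 0 = 0 ∨ s.ints 18 T 0 = 1 := by
  cases T with
  | zero => exact (hI 0 hK).1
  | succ T =>
    have := (hE T (Nat.lt_succ_self T) 0 hK).1
    push_cast at this ⊢
    exact this

end

/-- The program that solves the problem on grids with `L` rows. -/
def solver (L : ℕ) : Prog := .seq (generate L) (.seq (computeTables L) (emitFlow L))

/-- A bound for the running time of `solver`. -/
def solverTime (L T : ℕ) : ℕ :=
  4 + extendAllTime L T (candidateRounds L) 1 +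
    (((initEntry L).size + 40) * (vectorCount L T + 1) +
      ((((relax L).size + 40) * (vectorCount L T + 2) + 40) * (vectorCount L T + 1) + 40) * (T + 1) +
    (20 + ((emitColumn L).size + 40) * (T + 1)))

theorem polyBounded_solverTime (L : ℕ) : PolyBounded (solverTime L) := by
  have hK := polyBounded_vectorCount L
  have h₁ := PolyBounded.id.add (.const 1)
  have c := PolyBounded.const
  exact ((c 4).add (polyBounded_extendAllTime L _ (c 1))).add
    ((((c _).mul (hK.add (c 1))).add
      ((((((c _).mul (hK.add (c 2))).add (c 40)).mul (hK.add (c 1))).add (c 40)).mul h₁)).add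
      ((c 20).add ((c _).mul h₁)))

theorem solver_spec {L T : ℕ} {I : MFG L T} (hunc : I.IsUncapacitated)
    (hrow : I.SourcesInOneRow) :
    Terminates I.oracle I.input (solver L) (solverTime L T) I.SolvedBy := by
  refine (generate_spec I I.oracle).seq ?_
  rintro s₁ ⟨hT, hb, hK, hz, hlist⟩ -
  obtain ⟨τ, hτ⟩ : ∃ τ : ℕ → ℕ → ℤ, ∀ i l : ℕ, s₁.ints 12 i l = τ i l := ⟨_, fun _ _ => rfl⟩
  refine (computeTables_spec (O := I.oracle) (L := L) hT hb hK hτ).seq ?_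
  rintro s₂ ⟨hI, hE⟩ hf
  have w : ∀ r < 13, s₂.ints r = s₁.ints r := fun r hr => hf.1 r fun h => by
    have := writesInt_computeTables h
    omega
  refine (emitFlow_spec (b := I.supplyAt) L (by rw [w 0 (by decide), hT])
    (by rw [w 1 (by decide), hb])).mono le_rfl ?_
  rintro s₃ ⟨hflag, hout⟩ -
  have hτ₂ : ∀ i l : ℕ, s₂.ints 12 i l = τ i l := fun i l => by rw [w 12 (by decide), hτ]
  have hKpos := vectorCount_pos L T
  -- The table bounds every real feasible flow from below: the flow is dominated by an integral one
  -- with candidate values, whose column flows are all in the list.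
  have lower : ∀ y, I.IsFeasible y → s₂.ints 18 T 0 = 1 ∧ s₂.reals 0 T 0 ≤ I.totalCost y := by
    intro y hy
    obtain ⟨x, hx, hxy, hxc⟩ := hy.exists_integral hunc hrow
    obtain ⟨f, hfx, hf₀, hfT, hff, hcost⟩ := hx.columns
    have hfv : ∀ t l, f t l ∈ I.flowValues := by
      intro t l
      rcases hfx t l with h | ⟨a, h⟩
      · rw [h]; exact I.zero_mem_flowValues
      · rw [h]; exact hxc a
    choose p hp hpf using fun t => hlist (f t) fun l _ => hfv t l
    -- The zero vector may be listed several times, and `p 0` may be any of its positions; the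
    -- answer is read at position `0`, so the sequence is made to start there.
    obtain ⟨q, hq⟩ : ∃ q : ℕ → ℕ, ∀ t, q t = if t = 0 then 0 else p t := ⟨_, fun _ => rfl⟩
    have hqf : ∀ t, ∀ l < L, f t l = τ (q t) l := by
      intro t l hl
      rw [hq]
      split_ifs with h
      · rw [h, hf₀, ← hτ, Nat.cast_zero, hz]
      · rw [← hpf t l hl, hτ]
    have hqK : ∀ t, q t < vectorCount L T := by
      intro t
      rw [hq]
      split_ifs
      · exact hKpos
      · exact hp t
    obtain ⟨h₁, h₂⟩ := table_le hI hE hqK (fun l hl => by rw [← hqf T l hl, hfT])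
      (fun t ht => (hff t ht).congr (hqf t) (hqf (t + 1))) T le_rfl
    have hq₀ : q (T - T) = 0 := by rw [Nat.sub_self, hq, if_pos rfl]
    rw [hq₀, Nat.cast_zero] at h₁ h₂
    refine ⟨h₁, h₂.trans (le_trans (le_of_eq ?_) hxy)⟩
    rw [hcost, Nat.sub_self, Nat.Ico_zero_eq_range]
    exact Finset.sum_congr rfl fun t _ => (columnCost_congr (hqf t) (hqf (t + 1))).symm
  -- Conversely, if the flag is `1`, the recorded path is a feasible flow that attains the table
  -- value. So the flag cannot be `1` for an infeasible instance.
  have upper : s₂.ints 18 T 0 = 1 → I.IsFeasible (outputFlow s₃) ∧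
      I.totalCost (outputFlow s₃) = s₂.reals 0 T 0 := by
    intro h₁
    have hpath := bestPath_spec hτ₂ hKpos hE h₁
    obtain ⟨i, hi, hpT, hfe, hcf, hsum⟩ := hpath T le_rfl
    rw [Nat.sub_self, Nat.cast_zero] at hfe hsum
    obtain ⟨-, k₁, k₂⟩ := hI i hi
    rw [k₂, add_zero] at hsum
    obtain ⟨c₁, c₂⟩ := MFG.isFeasible_of_columns (I := I) hunc (D := s₃.ints 5) (F := s₃.ints 6)
      (f := fun t l => s₂.ints 12 (bestPath s₂ T t) l) (fun a => rfl)
      (fun l _ => by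
        show s₂.ints 12 0 l = 0
        rw [w 12 (by decide), hz])
      (fun l hl => by
        show s₂.ints 12 (bestPath s₂ T T) l = 0
        rw [hpT, hτ₂]
        exact k₁.mp hfe l hl)
      hcf (fun t ht l hl => (hout t ht l hl).1) (fun t ht l hl => (hout t ht l hl).2)
    have hflow : outputFlow s₃ = fun a : Arc L T => ((if a.isDown then
        s₃.ints 5 a.tail.1.val a.tail.2.val else s₃.ints 6 a.tail.1.val a.tail.2.val : ℤ) : ℝ) := by
      funext a
      simp only [outputFlow]
      split_ifs <;> rfl
    rw [hflow]
    exact ⟨c₁, c₂.trans hsum⟩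
  refine ⟨?_, fun hno => ?_⟩
  · rintro ⟨y, hy⟩
    have h₁ := (lower y hy).1
    obtain ⟨c₁, c₂⟩ := upper h₁
    refine ⟨hflag.trans h₁, c₁, fun y hy => ?_⟩
    rw [c₂]
    exact (lower y hy).2
  · rw [hflag]
    exact (flag_eq hI hE hKpos).resolve_right fun h₁ => hno ⟨_, (upper h₁).1⟩

end GridFlow

theorem mainTheorem7 (L : ℕ) :
    GridFlow.PolynomiallySolvable L
      (fun _ I => I.IsUncapacitated ∧ I.SourcesInOneRow) := by
  obtain ⟨q, hq⟩ := GridFlow.polyBounded_solverTime L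
  refine ⟨GridFlow.solver L, q, fun T I hI => ?_⟩
  obtain ⟨n, s, hn, he, hs⟩ := GridFlow.solver_spec hI.1 hI.2
  exact ⟨n, s, he, hn.trans (hq T), hs⟩
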